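/- Let $0<\alpha<\gamma\le \frac1{100}$, $\mu>0$, $A>0$, $1\le\nu<\mathrm e$ and $p(v)=Av^{-\nu}$. Consider on $\mathbb R$ the isentropic compressible Navier–Stokes system in Lagrangian coordinates $$v_t-u_x=0,\qquad u_t+(p(v))_x=\Big(\frac{\mu u_x}{v}\Big)_x,\qquad (v(0),u(0))=(v_0,u_0).\tag{1}$$ For $h:\mathbb R\to\mathbb R$ let $\|h\|_{BV}$ be the total variation of $h$ over $\mathbb R$ (the least one among the functions equal to $h$ almost everywhere), and let $$\|h\|_{W^{2\gamma,1}}=\|h\|_{L^1}+\iint_{\mathbb R^2}\frac{|h(x)-h(y)|}{|x-y|^{1+2\gamma}}\,dx\,dy .$$ For a norm $N$ of functions on $\mathbb R$, $T>0$, $\sigma\ge0$ and $f:(0,T)\times\mathbb R\to\mathbb R$ put $$N^\sigma_T(f)=\sup_{0<s<T}s^\sigma N(f(s))+\sup_{0<s<t<T}s^{\sigma+\alpha}\frac{N(f(t)-f(s))}{(t-s)^\alpha},$$ and write $\|f\|_{X_T^{\sigma,p}}$ for $N=\|\cdot\|_{L^p}$ and $\|f\|_{BV_T^\sigma}$ for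 $N=\|\cdot\|_{BV}$. Let $$\|f\|_{Y_T}=\|f\|_{X_T^{0,1}}+\|f\|_{X_T^{0,\infty}}+\|f\|_{BV_T^0},\qquad \|w\|_T=\|\partial_xw\|_{X_T^{1-\gamma,\infty}}+\|\partial_xw\|_{X_T^{\frac12-\gamma,1}}+\|\partial_xw\|_{BV_T^{1-\gamma}}.$$ A solution of (1) on $[0,T]$ is a pair of measurable functions $(v,u)$ on $(0,T)\times\mathbb R$ such that $v>0$ almost everywhere, $u(t)$ has a locally integrable weak derivative $u_x(t)$ for every $t\in(0,T)$, the functions $v$, $u$, $u_x$ and $p(v)-\mu u_x/v$ are integrable on $(0,T)\times(-R,R)$ for every $R$, and, for every $\varphi\in C_c^\infty([0,T)\times\mathbb R)$, $$\int_0^T\!\!\int_{\mathbb R}(v\varphi_t-u\varphi_x)\,dx\,dt+\int_{\mathbb R}v_0\,\varphi(0,x)\,dx=0,\qquad \int_0^T\!\!\int_{\mathbb R}\Big(u\varphi_t+\Big(p(v)-\frac{\mu u_x}{v}\Big)\varphi_x\Big)dx\,dt+\int_{\mathbb R}u_0\,\varphi(0,x)\,dx=0 .$$ **Theorem 3.1.**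 There exist $\varepsilon_0,T\in(0,1)$ and $C>0$, depending only on $\alpha,\gamma,\mu,A,\nu$, such that for all initial data $(v_0,u_0)$ with $$M_1:=\|v_0-1\|_{L^1}+\|v_0-1\|_{BV}+\|u_0\|_{W^{2\gamma,1}}\le\varepsilon_0,$$ the system (1) has a solution $(v,u)$ on $[0,T]$ with $$\|v-1\|_{Y_T}+\|u\|_T\le C M_1,\tag{2}$$ and any two solutions of (1) on $[0,T]$ with the same initial data that satisfy (2) are equal almost everywhere on $(0,T)\times\mathbb R$. -/

import Mathlib

open MeasureTheory Set
open scoped ENNReal ContDiff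

noncomputable section

namespace IsentropicNS

/-- The `BV` norm (total variation over `ℝ`) of a function given up to a null set: the smallest
value, over the representatives `g` of `f`, of the supremum of `∑ |g (x_{i+1}) - g (x_i)|` over
all partitions. -/
def bvNorm (f : ℝ → ℝ) : ℝ≥0∞ :=
  ⨅ (g : ℝ → ℝ) (_ : g =ᵐ[volume] f), eVariationOn g univ

/-- The homogeneous fractional Sobolev (Gagliardo) norm of `Ẇ^{s,1}(ℝ)`, for `0 < s < 1`. -/
def homSobolevNorm (s : ℝ) (f : ℝ → ℝ) : ℝ≥0∞ :=
  ∫⁻ x, ∫⁻ y, ENNReal.ofReal (|f x - f y| / |x - y| ^ (1 + s))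

/-- The inhomogeneous norm of `W^{s,1}(ℝ)`, for `0 < s < 1`. -/
def sobolevNorm (s : ℝ) (f : ℝ → ℝ) : ℝ≥0∞ :=
  eLpNorm f 1 volume + homSobolevNorm s f

/-- The size `M₁ = ‖v₀ - 1‖_{L¹ ∩ BV} + ‖u₀‖_{W^{2γ,1}}` of the initial data. -/
def dataSize (γ : ℝ) (v₀ u₀ : ℝ → ℝ) : ℝ≥0∞ :=
  eLpNorm (fun x => v₀ x - 1) 1 volume + bvNorm (fun x => v₀ x - 1) + sobolevNorm (2 * γ) u₀

/-- For a norm `N` of functions on `ℝ`, the time-weighted, time-Hölder norm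
`sup_{0<s<T} s^σ N(f(s)) + sup_{0<s<t<T} s^{σ+α} N(f(t)-f(s)) / (t-s)^α`. -/
def timeNorm (N : (ℝ → ℝ) → ℝ≥0∞) (α T σ : ℝ) (f : ℝ → ℝ → ℝ) : ℝ≥0∞ :=
  (⨆ s ∈ Ioo 0 T, ENNReal.ofReal (s ^ σ) * N (f s)) +
    ⨆ s ∈ Ioo 0 T, ⨆ t ∈ Ioo s T,
      ENNReal.ofReal (s ^ (σ + α) / (t - s) ^ α) * N (fun x => f t x - f s x)

/-- The norm of `X_T^{σ,p}`. -/
def xNorm (α T σ : ℝ) (p : ℝ≥0∞) (f : ℝ → ℝ → ℝ) : ℝ≥0∞ :=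
  timeNorm (fun h => eLpNorm h p volume) α T σ f

/-- The norm of `BV_T^σ`. -/
def bvTimeNorm (α T σ : ℝ) (f : ℝ → ℝ → ℝ) : ℝ≥0∞ :=
  timeNorm bvNorm α T σ f

/-- The norm of `Y_T`. -/
def yNorm (α T : ℝ) (f : ℝ → ℝ → ℝ) : ℝ≥0∞ :=
  xNorm α T 0 1 f + xNorm α T 0 ∞ f + bvTimeNorm α T 0 f

/-- The norm `‖u‖_T`, written as a function of the spatial derivative `ux = ∂ₓ u`. -/
def velocityNorm (α γ T : ℝ) (ux : ℝ → ℝ → ℝ) : ℝ≥0∞ :=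
  xNorm α T (1 - γ) ∞ ux + xNorm α T (1 / 2 - γ) 1 ux + bvTimeNorm α T (1 - γ) ux

/-- `g` is the weak derivative of `f` on `ℝ`. -/
def HasWeakDeriv (f g : ℝ → ℝ) : Prop :=
  LocallyIntegrable f volume ∧ LocallyIntegrable g volume ∧
    ∀ φ : ℝ → ℝ, ContDiff ℝ ∞ φ → HasCompactSupport φ →
      ∫ x, f x * deriv φ x = -∫ x, g x * φ x

/-- The space-time strip `(0,T) × ℝ`. -/
def strip (T : ℝ) : Set (ℝ × ℝ) := Ioo 0 T ×ˢ univ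

/-- Integrability on every bounded part of the strip `(0,T) × ℝ`, up to the times `0` and `T`. -/
def LocIntegrableOnStrip (T : ℝ) (f : ℝ × ℝ → ℝ) : Prop :=
  ∀ R : ℝ, IntegrableOn f (Ioo 0 T ×ˢ Icc (-R) R) volume

/-- Test functions on `[0,T) × ℝ`: smooth, compactly supported, vanishing near `t = T`
but not necessarily at `t = 0`. -/
def IsTestFunction (T : ℝ) (φ : ℝ × ℝ → ℝ) : Prop :=
  ContDiff ℝ ∞ φ ∧ HasCompactSupport φ ∧ tsupport φ ⊆ {z | z.1 < T}

/-- The pressure law `p(v) = A v^{-ν}`. -/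
def pressure (A ν v : ℝ) : ℝ := A * v ^ (-ν)

/-- The momentum flux `p(v) - μ u_x / v`. -/
def flux (A ν μ : ℝ) (v ux : ℝ → ℝ → ℝ) (z : ℝ × ℝ) : ℝ :=
  pressure A ν (v z.1 z.2) - μ * ux z.1 z.2 / v z.1 z.2

/-- `(v,u)` is a weak solution on `[0,T]` of `v_t - u_x = 0`, `u_t + (p(v))_x = (μ u_x / v)_x`
with `(v(0),u(0)) = (v₀,u₀)`; the initial values enter through test functions that need not vanish
at `t = 0`. The function `ux` is the weak spatial derivative of `u`. -/
structure IsWeakSolution (A ν μ T : ℝ) (v₀ u₀ : ℝ → ℝ) (v u ux : ℝ → ℝ → ℝ) : Prop where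
  aestronglyMeasurable_slice : ∀ t ∈ Ioo 0 T, AEStronglyMeasurable (v t) volume
  hasWeakDeriv : ∀ t ∈ Ioo 0 T, HasWeakDeriv (u t) (ux t)
  locIntegrable_v : LocIntegrableOnStrip T (fun z => v z.1 z.2)
  locIntegrable_u : LocIntegrableOnStrip T (fun z => u z.1 z.2)
  locIntegrable_ux : LocIntegrableOnStrip T (fun z => ux z.1 z.2)
  pos : ∀ᵐ z ∂(volume.restrict (strip T)), 0 < v z.1 z.2
  locIntegrable_flux : LocIntegrableOnStrip T (flux A ν μ v ux)
  mass : ∀ φ : ℝ × ℝ → ℝ, IsTestFunction T φ →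
    (∫ z in strip T, (v z.1 z.2 * fderiv ℝ φ z (1, 0) - u z.1 z.2 * fderiv ℝ φ z (0, 1)))
      + ∫ x, v₀ x * φ (0, x) = 0
  momentum : ∀ φ : ℝ × ℝ → ℝ, IsTestFunction T φ →
    (∫ z in strip T,
        (u z.1 z.2 * fderiv ℝ φ z (1, 0) + flux A ν μ v ux z * fderiv ℝ φ z (0, 1)))
      + ∫ x, u₀ x * φ (0, x) = 0

end IsentropicNS

end

/-! With V = v - 1 and W = u_x the system becomes V = V₀ + ∫₀ᵗ W together with W_t = μ W_xx + F_xx,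
where F = φ(V) W + ψ(V), φ(z) = μ(1/(1+z) - 1) and ψ(z) = A - A(1+z)^(-ν). Both nonlinearities
vanish at 0. Hence W should be a fixed point of `mildMap`: the gradient of the heat flow of u₀ plus
the Duhamel integral of ∂ₓ²e^{μ(t-r)∂ₓ²}F(r).

The kernel of that integral has size 1/(t-r), so size bounds on F do not suffice. Hölder continuity
in time repairs this: after subtraction of F(t) the integrand is of order (t-r)^(α-1), and the
time-weighted Hölder norm of F is reproduced (`ParabolicPair.wHolder_duhamel`). This operator brings
no smallness. Smallness comes from the nonlinearity: φ(V) W is quadratic in the size of the data,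
and ψ(V) is linear but less singular at t = 0, which gains T^(1/2-γ) (`nonlin_inBall`). The W^{2γ,1}
norm of u₀ controls the initial layer (`wHolder_gradHeat`, `wHolderBV_gradHeat`).

All analysis takes place in L¹. A function of L¹ has a representative of variation at most K exactly
when ‖f(· + h) - f‖₁ ≤ K h for all h > 0 (`HasBV.of_eVariationOn`, `HasBV.exists_representative`).
Since the heat operators commute with translations, a BV estimate is an L¹ estimate for translation
differences, and L^∞ bounds follow from BV bounds (`HasBV.ae_abs_le`). The map contracts in the
weighted L¹ norm only (`nonlin_contraction`); the BV bounds are merely preserved and survive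
pointwise limits. This gives `exists_mildSolution` and `mildSolution_unique`.

Mild and weak solutions are compared through Fourier transforms: at each frequency the mild formula
is the variation of constants formula of a scalar linear equation (`mild_iff_fourierAt`). From W, an
L¹ velocity u with u_x = W is rebuilt by `velocity`, and `exists_isWeakSolution` checks the weak
equations. Conversely, a weak solution in the class (2) has V = V₀ + ∫ W
(`IsWeakSolution.eq_density`) and satisfies the Fourier form (`IsWeakSolution.fourierAt_eq`), so its
W is the fixed point. Then v is determined, u is determined up to a function of time, and the
momentum equation removes that freedom (`IsWeakSolution.ae_eq`). -/

noncomputable section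

open Filter Topology

namespace IsentropicNS

/-! ### The space `L¹(ℝ)` and its translations -/

/-- The Banach space `L¹(ℝ)`. -/
abbrev L1 := Lp ℝ 1 (volume : Measure ℝ)

/-- Translation `f ↦ f (· + h)` as an isometry of `L¹(ℝ)`. -/
def translate (h : ℝ) : L1 →ₗᵢ[ℝ] L1 :=
  Lp.compMeasurePreservingₗᵢ ℝ (fun x => x + h) (measurePreserving_add_right volume h)

lemma integrable_coe (f : L1) : Integrable f volume := L1.integrable_coeFn f

lemma translate_ae (h : ℝ) (f : L1) : translate h f =ᵐ[volume] fun x => f (x + h) :=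
  Lp.coeFn_compMeasurePreserving f (measurePreserving_add_right volume h)

lemma continuous_translate (f : L1) : Continuous fun h => translate h f := by
  have := Continuous.compMeasurePreservingLp (μ := (volume : Measure ℝ)) (ν := volume)
    (p := 1) (f := fun _ : ℝ => f) (g := fun h : ℝ => (⟨fun x => x + h, by fun_prop⟩ : C(ℝ, ℝ)))
    continuous_const ?_ (fun h => measurePreserving_add_right volume h) (by simp)
  · exact this
  · refine ContinuousMap.continuous_of_continuous_uncurry _ ?_
    simp only [Function.uncurry_def, ContinuousMap.coe_mk]
    fun_prop

lemma ae_comp_add {P : ℝ → Prop} (h : ℝ) (hP : ∀ᵐ x, P x) : ∀ᵐ x : ℝ, P (x + h) :=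
  (measurePreserving_add_right volume h).quasiMeasurePreserving.ae hP

lemma norm_eq_integral (f : L1) : ‖f‖ = ∫ x, |f x| := L1.norm_eq_integral_norm f

lemma norm_translate_sub (h : ℝ) (f : L1) :
    ‖translate h f - f‖ = ∫ x, |f (x + h) - f x| := by
  rw [norm_eq_integral]
  refine integral_congr_ae ?_
  filter_upwards [Lp.coeFn_sub (translate h f) f, translate_ae h f] with x h1 h2
  rw [h1, Pi.sub_apply, h2]

lemma integrable_translate_sub (h : ℝ) (f : L1) :
    Integrable (fun x => f (x + h) - f x) volume :=
  ((integrable_coe f).comp_add_right h).sub (integrable_coe f)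

/-! ### Functions of bounded variation in terms of `L¹` translation differences -/

/-- `f ∈ L¹` has total variation at most `K`, expressed by its translation differences. -/
def HasBV (K : ℝ) (f : L1) : Prop := ∀ h > 0, ‖translate h f - f‖ ≤ K * h

lemma HasBV.nonneg {K : ℝ} {f : L1} (hf : HasBV K f) : 0 ≤ K := by
  simpa using (norm_nonneg _).trans (hf 1 one_pos)

/-- If m is the variation function of g, then |g(x+h) - g(x)| ≤ m(x+h) - m(x). The integral of the
right side over [-R,R] telescopes to two integrals of m over intervals of length h, whose values of
m differ by at most K; the bound K h is uniform in R. -/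
lemma HasBV.of_eVariationOn {K : ℝ} (hK : 0 ≤ K) {f : L1} {g : ℝ → ℝ} (hg : g =ᵐ[volume] f)
    (hv : eVariationOn g univ ≤ ENNReal.ofReal K) : HasBV K f := by
  intro h hh
  have hbv : BoundedVariationOn g univ := ne_top_of_le_ne_top ENNReal.ofReal_ne_top hv
  have hloc := hbv.locallyBoundedVariationOn
  set m : ℝ → ℝ := fun x => variationOnFromTo g univ 0 x with hm
  have hmono : Monotone m := monotoneOn_univ.1 (variationOnFromTo.monotoneOn hloc (mem_univ 0))
  have hsub : ∀ a b, m b - m a = variationOnFromTo g univ a b := fun a b => by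
    simpa [hm] using variationOnFromTo.sub_right hloc (mem_univ 0) (mem_univ b) (mem_univ a)
  have hle : ∀ a b, m b - m a ≤ K := fun a b => by
    rw [hsub]
    refine (le_abs_self _).trans ((variationOnFromTo.abs_le_eVariationOn hbv).trans ?_)
    exact ENNReal.toReal_le_of_le_ofReal hK hv
  have hdiff : ∀ x, |g (x + h) - g x| ≤ m (x + h) - m x := fun x => by
    rw [hsub, variationOnFromTo.eq_of_le _ _ (by linarith), ← Real.dist_eq, dist_edist]
    refine ENNReal.toReal_mono (hloc _ _ (mem_univ _) (mem_univ _)) ?_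
    exact eVariationOn.edist_le _ ⟨mem_univ _, by constructor <;> linarith⟩
      ⟨mem_univ _, by constructor <;> linarith⟩
  rw [norm_translate_sub]
  have hint : ∀ a b, IntervalIntegrable m volume a b := fun a b => hmono.intervalIntegrable
  have hint' : ∀ a b, IntervalIntegrable (fun x => m (x + h)) volume a b := fun a b =>
    Monotone.intervalIntegrable fun x y hxy => hmono (by linarith)
  have hlim := intervalIntegral_tendsto_integral (integrable_translate_sub h f).abs
    tendsto_neg_atTop_atBot (tendsto_id (α := ℝ))
  refine le_of_tendsto hlim ?_
  filter_upwards [eventually_ge_atTop 0] with R hR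
  simp only [id]
  calc ∫ x in -R..R, |f (x + h) - f x| = ∫ x in -R..R, |g (x + h) - g x| := by
        refine intervalIntegral.integral_congr_ae ?_
        filter_upwards [hg, ae_comp_add h hg] with x h1 h2 _
        rw [h1, h2]
    _ ≤ ∫ x in -R..R, (m (x + h) - m x) := by
        refine intervalIntegral.integral_mono_on (by linarith) ?_ ?_ fun x _ => hdiff x
        · have : (fun x => |f (x + h) - f x|) =ᵐ[volume.restrict (uIoc (-R) R)]
              fun x => |g (x + h) - g x| := by
            refine ae_restrict_of_ae ?_
            filter_upwards [hg, ae_comp_add h hg] with x h1 h2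
            rw [h1, h2]
          exact ((integrable_translate_sub h f).abs.intervalIntegrable).congr_ae this
        · exact (hint' _ _).sub (hint _ _)
    _ = (∫ x in R..(R + h), m x) - ∫ x in (-R)..(-R + h), m x := by
        rw [intervalIntegral.integral_sub (hint' _ _) (hint _ _),
          intervalIntegral.integral_comp_add_right]
        · have e1 := intervalIntegral.integral_add_adjacent_intervals (hint (-R) (-R + h))
            (hint (-R + h) (R + h))
          have e2 := intervalIntegral.integral_add_adjacent_intervals (hint (-R) R)
            (hint R (R + h))
          linarith
    _ ≤ (∫ _ in R..(R + h), m (R + h)) - ∫ _ in (-R)..(-R + h), m (-R) := by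
        refine sub_le_sub ?_ ?_
        · exact intervalIntegral.integral_mono_on (by linarith) (hint _ _) (by simp)
            fun x hx => hmono hx.2
        · exact intervalIntegral.integral_mono_on (by linarith) (by simp) (hint _ _)
            fun x hx => hmono hx.1
    _ ≤ K * h := by
        simp only [intervalIntegral.integral_const, smul_eq_mul]
        nlinarith [hle (-R) (R + h)]

/-- The average of `f` over `[x, x + 1/(n+1)]`. -/
def avg (f : ℝ → ℝ) (n : ℕ) (x : ℝ) : ℝ := (n + 1) * ∫ y in x..(x + 1 / (n + 1)), f y

lemma avg_ae_tendsto (f : L1) : ∀ᵐ x, Tendsto (fun n => avg f n x) atTop (𝓝 (f x)) := by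
  filter_upwards [LocallyIntegrable.ae_hasDerivAt_integral (integrable_coe f).locallyIntegrable]
    with x hx
  have h := (hasDerivAt_iff_tendsto_slope_zero.1 (hx x))
  have h2 : Tendsto (fun n : ℕ => 1 / ((n : ℝ) + 1)) atTop (𝓝[≠] 0) := by
    refine tendsto_nhdsWithin_iff.2 ⟨tendsto_one_div_add_atTop_nhds_zero_nat, ?_⟩
    exact Eventually.of_forall fun n => by
      have : (0 : ℝ) < n + 1 := by positivity
      simp only [mem_compl_iff, mem_singleton_iff]; positivity
  refine (h.comp h2).congr fun n => ?_
  simp [avg]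

lemma avg_sub (f : L1) (n : ℕ) (a b : ℝ) :
    avg f n b - avg f n a = (n + 1) * ∫ x in a..b, (f (x + 1 / (n + 1)) - f x) := by
  have hint : ∀ a b, IntervalIntegrable f volume a b := fun a b => (integrable_coe f).intervalIntegrable
  have e := intervalIntegral.integral_add_adjacent_intervals (hint a (a + 1 / (n + 1)))
    (hint (a + 1 / (n + 1)) (b + 1 / (n + 1)))
  have e2 := intervalIntegral.integral_add_adjacent_intervals (hint a b)
    (hint b (b + 1 / (n + 1)))
  rw [intervalIntegral.integral_sub _ (hint _ _), intervalIntegral.integral_comp_add_right, avg, avg]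
  · linear_combination (n + 1 : ℝ) * (e2 - e)
  · exact ((integrable_coe f).comp_add_right _).intervalIntegrable

/-- By `avg_sub`, increments of the average are n+1 times integrals of the translation difference
with step 1/(n+1). Summed over a partition they give at most (n+1) · K/(n+1) = K, with no dependence
on n. -/
lemma HasBV.eVariationOn_avg_le {K : ℝ} {f : L1} (hf : HasBV K f) (n : ℕ) :
    eVariationOn (avg f n) univ ≤ ENNReal.ofReal K := by
  set h : ℝ := 1 / (n + 1) with hh
  have hn : (0 : ℝ) < n + 1 := by positivity
  have hpos : 0 < h := by positivity
  set d : ℝ → ℝ := fun x => f (x + h) - f x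
  have hd : Integrable d := integrable_translate_sub h f
  refine iSup_le fun ⟨N, u, hu, _⟩ => ?_
  have : ∀ i, edist (avg f n (u (i + 1))) (avg f n (u i)) ≤
      ENNReal.ofReal ((n + 1) * ∫ x in (u i)..(u (i + 1)), |d x|) := fun i => by
    rw [edist_dist, Real.dist_eq, avg_sub, abs_mul, abs_of_pos hn]
    refine ENNReal.ofReal_le_ofReal (mul_le_mul_of_nonneg_left ?_ hn.le)
    exact intervalIntegral.abs_integral_le_integral_abs (hu (Nat.le_succ i))
  refine (Finset.sum_le_sum fun i _ => this i).trans ?_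
  rw [← ENNReal.ofReal_sum_of_nonneg]
  · refine ENNReal.ofReal_le_ofReal ?_
    rw [← Finset.mul_sum, intervalIntegral.sum_integral_adjacent_intervals
      fun k _ => hd.abs.intervalIntegrable]
    have h1 : ∫ x in (u 0)..(u N), |d x| ≤ K * h := by
      rw [intervalIntegral.integral_of_le (hu (Nat.zero_le N))]
      refine (setIntegral_le_integral hd.abs (Eventually.of_forall fun x => abs_nonneg _)).trans ?_
      rw [← norm_translate_sub]
      exact hf h hpos
    calc (n + 1 : ℝ) * ∫ x in (u 0)..(u N), |d x| ≤ (n + 1) * (K * h) := by gcongr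
      _ = K := by rw [hh]; field_simp
  · intro i _
    exact mul_nonneg hn.le (intervalIntegral.integral_nonneg (hu (Nat.le_succ i))
      fun x _ => abs_nonneg _)

lemma tendsto_avg_atTop (f : L1) (n : ℕ) : Tendsto (avg f n) atTop (𝓝 0) := by
  have hint : ∀ a b, IntervalIntegrable f volume a b := fun a b => (integrable_coe f).intervalIntegrable
  have h1 := intervalIntegral_tendsto_integral_Ioi 0 (integrable_coe f).integrableOn
    (tendsto_atTop_add_const_right atTop (1 / ((n : ℝ) + 1)) tendsto_id)
  have h2 := intervalIntegral_tendsto_integral_Ioi 0 (integrable_coe f).integrableOn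
    (tendsto_id (α := ℝ))
  have h3 := (h1.sub h2).const_mul ((n : ℝ) + 1)
  rw [sub_self, mul_zero] at h3
  refine h3.congr fun x => ?_
  rw [avg, intervalIntegral.integral_interval_sub_left (hint _ _) (hint _ _)]
  rfl

/-- An average of an integrable function tends to 0 at +∞, so its variation bounds its absolute
value. -/
lemma HasBV.abs_avg_le {K : ℝ} {f : L1} (hf : HasBV K f) (n : ℕ) (x : ℝ) :
    |avg f n x| ≤ K := by
  have h1 : ∀ y, |avg f n x - avg f n y| ≤ K := fun y => by
    rw [← Real.dist_eq, ← ENNReal.ofReal_le_ofReal_iff hf.nonneg, ← edist_dist]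
    exact (eVariationOn.edist_le _ (mem_univ _) (mem_univ _)).trans (hf.eVariationOn_avg_le n)
  have h2 : Tendsto (fun y => |avg f n x - avg f n y|) atTop (𝓝 |avg f n x - 0|) :=
    ((tendsto_const_nhds).sub (tendsto_avg_atTop f n)).abs
  rw [sub_zero] at h2
  exact le_of_tendsto h2 (Eventually.of_forall h1)

/-- A Helly argument without subsequences: the averages are bounded by K, so they converge at every
point along an ultrafilter. The limit is f almost everywhere by Lebesgue differentiation, and
variation is lower semicontinuous under pointwise convergence. -/
lemma HasBV.exists_representative {K : ℝ} {f : L1} (hf : HasBV K f) :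
    ∃ g : ℝ → ℝ, g =ᵐ[volume] f ∧ eVariationOn g univ ≤ ENNReal.ofReal K ∧ ∀ x, |g x| ≤ K := by
  have hex : ∀ x, ∃ y ∈ Icc (-K) K,
      Tendsto (fun n => avg f n x) (hyperfilter ℕ : Filter ℕ) (𝓝 y) := fun x => by
    obtain ⟨y, hy, hle⟩ := isCompact_Icc.ultrafilter_le_nhds
      ((hyperfilter ℕ).map (fun n => avg f n x)) (s := Icc (-K) K) (by
        rw [Ultrafilter.coe_map, le_principal_iff, mem_map]
        exact Eventually.of_forall fun n : ℕ => abs_le.1 (hf.abs_avg_le n x))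
    exact ⟨y, hy, hle⟩
  choose g hgK hg using hex
  refine ⟨g, ?_, ?_, fun x => abs_le.2 (hgK x)⟩
  · filter_upwards [avg_ae_tendsto f] with x hx
    exact tendsto_nhds_unique (hg x) (hx.mono_left Nat.hyperfilter_le_atTop)
  · by_contra! hlt
    obtain ⟨n, hn⟩ := (eVariationOn.lowerSemicontinuous_aux (fun x _ => hg x) hlt).exists
    exact absurd (hf.eVariationOn_avg_le n) (not_le.2 hn)

/-- The source of every L^∞ bound below: an integrable function of variation K is bounded by K,
because it is small somewhere near infinity. -/
lemma HasBV.ae_abs_le {K : ℝ} {f : L1} (hf : HasBV K f) : ∀ᵐ x, |f x| ≤ K := by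
  obtain ⟨g, hg, -, hK⟩ := hf.exists_representative
  filter_upwards [hg] with x hx
  rw [← hx]
  exact hK x

lemma HasBV.bvNorm_le {K : ℝ} {f : L1} (hf : HasBV K f) {g : ℝ → ℝ} (hg : g =ᵐ[volume] f) :
    bvNorm g ≤ ENNReal.ofReal K := by
  obtain ⟨k, hk, hv, -⟩ := hf.exists_representative
  have hkg : k =ᵐ[volume] g := hk.trans hg.symm
  exact (iInf₂_le (f := fun (k : ℝ → ℝ) (_ : k =ᵐ[volume] g) => eVariationOn k univ) k hkg).trans hv

lemma HasBV.of_bvNorm_le {K : ℝ} (hK : 0 ≤ K) {f : L1} {g : ℝ → ℝ} (hg : g =ᵐ[volume] f)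
    (hv : bvNorm g ≤ ENNReal.ofReal K) : HasBV K f := by
  -- The infimum in `bvNorm` is not known to be attained, hence the loss ε; below it is taken as ε /
  -- h so that the factor h disappears.
  have key : ∀ ε > 0, HasBV (K + ε) f := fun ε hε => by
    have : bvNorm g < ENNReal.ofReal (K + ε) :=
      hv.trans_lt ((ENNReal.ofReal_lt_ofReal_iff (by linarith)).2 (by linarith))
    simp only [bvNorm, iInf_lt_iff] at this
    obtain ⟨k, hk, hlt⟩ := this
    exact HasBV.of_eVariationOn (by linarith) (hk.trans hg) hlt.le
  intro h hh
  refine le_of_forall_pos_le_add fun ε hε => ?_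
  have := key (ε / h) (by positivity) h hh
  rwa [add_mul, div_mul_cancel₀ _ hh.ne'] at this

end IsentropicNS

end

noncomputable section

open Filter Topology
open scoped FourierTransform

namespace IsentropicNS

/-! ### Fourier coefficients of `L¹` functions -/

lemma norm_cexp_mul_I_eq_one (m x : ℝ) : ‖Complex.exp (-(m * x : ℝ) * Complex.I)‖ = 1 := by
  simpa using Complex.norm_exp_ofReal_mul_I (-(m * x))

lemma integrable_cexp_mul (m : ℝ) {f : ℝ → ℝ} (hf : Integrable f) :
    Integrable (fun x => Complex.exp (-(m * x : ℝ) * Complex.I) * (f x : ℂ)) := by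
  refine hf.ofReal.bdd_mul (c := 1) ?_ (Eventually.of_forall fun x => ?_)
  · exact Continuous.aestronglyMeasurable (by fun_prop)
  · exact (norm_cexp_mul_I_eq_one m x).le

/-- The Fourier transform `∫ e^{-imx} f(x) dx` at the frequency `m`. -/
def fourierAt (m : ℝ) : L1 →L[ℝ] ℂ :=
  LinearMap.mkContinuous
    { toFun := fun f => ∫ x, Complex.exp (-(m * x : ℝ) * Complex.I) * (f x : ℂ)
      map_add' := fun f g => by
        rw [← integral_add (integrable_cexp_mul m (integrable_coe f))
          (integrable_cexp_mul m (integrable_coe g))]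
        refine integral_congr_ae ?_
        filter_upwards [Lp.coeFn_add f g] with x hx
        rw [hx, Pi.add_apply, Complex.ofReal_add, mul_add]
      map_smul' := fun c f => by
        rw [RingHom.id_apply, ← integral_smul]
        refine integral_congr_ae ?_
        filter_upwards [Lp.coeFn_smul c f] with x hx
        rw [hx, Pi.smul_apply, Complex.real_smul, smul_eq_mul, Complex.ofReal_mul c]
        ring }
    1 fun f => by
      rw [one_mul, norm_eq_integral]
      refine (norm_integral_le_integral_norm _).trans (le_of_eq (integral_congr_ae ?_))
      refine Eventually.of_forall fun x => ?_
      simp only [norm_mul, norm_cexp_mul_I_eq_one, one_mul, Complex.norm_real, Real.norm_eq_abs]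

lemma fourierAt_apply (m : ℝ) (f : L1) :
    fourierAt m f = ∫ x, Complex.exp (-(m * x : ℝ) * Complex.I) * (f x : ℂ) := rfl

lemma fourierAt_two_pi_mul (ξ : ℝ) (f : L1) :
    fourierAt (2 * Real.pi * ξ) f = 𝓕 (fun x => (f x : ℂ)) ξ := by
  rw [Real.fourier_real_eq_integral_exp_smul, fourierAt_apply]
  refine integral_congr_ae (Eventually.of_forall fun x => ?_)
  simp only [smul_eq_mul]
  congr 2
  push_cast
  ring

lemma fourierAt_translate (m h : ℝ) (f : L1) :
    fourierAt m (translate h f) = Complex.exp ((m * h : ℝ) * Complex.I) * fourierAt m f := by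
  rw [fourierAt_apply, fourierAt_apply, ← integral_const_mul]
  rw [← integral_add_right_eq_self (fun x => Complex.exp ((m * h : ℝ) * Complex.I) *
    (Complex.exp (-(m * x : ℝ) * Complex.I) * (f x : ℂ))) h]
  refine integral_congr_ae ?_
  filter_upwards [translate_ae h f] with x hx
  rw [hx, ← mul_assoc, ← Complex.exp_add]
  congr 2
  push_cast
  ring

/-- Self-adjointness of the Fourier integral, applied to f and the inverse transform of η, which is
a Schwartz function. It transfers identities between Fourier transforms to pairings with test
functions. -/
lemma integral_mul_eq_integral_fourierAt (f : L1) {η : ℝ → ℝ} (hη : ContDiff ℝ ∞ η)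
    (hc : HasCompactSupport η) :
    ((∫ x, f x * η x : ℝ) : ℂ) =
      ∫ ξ, fourierAt (2 * Real.pi * ξ) f * 𝓕 (fun x => (η x : ℂ)) (-ξ) := by
  have hηc : HasCompactSupport (fun x => (η x : ℂ)) := hc.comp_left Complex.ofReal_zero
  have hηd : ContDiff ℝ ∞ (fun x => (η x : ℂ)) := Complex.ofRealCLM.contDiff.comp hη
  set s : SchwartzMap ℝ ℂ := hηc.toSchwartzMap hηd with hs
  have hcoe : (s : ℝ → ℂ) = fun x => (η x : ℂ) := rfl
  have h := VectorFourier.integral_fourierIntegral_smul_eq_flip (L := innerₗ ℝ)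
    (μ := volume) (ν := volume) (f := fun x => (f x : ℂ)) (g := (𝓕⁻ s : SchwartzMap ℝ ℂ))
    Real.continuous_fourierChar continuous_inner (integrable_coe f).ofReal
    (SchwartzMap.integrable _)
  have h1 : VectorFourier.fourierIntegral Real.fourierChar volume (innerₗ ℝ).flip
      (𝓕⁻ s : SchwartzMap ℝ ℂ) = fun x => (η x : ℂ) := by
    rw [flip_innerₗ]
    change 𝓕 ((𝓕⁻ s : SchwartzMap ℝ ℂ) : ℝ → ℂ) = _
    rw [← SchwartzMap.fourier_coe, FourierTransform.fourier_fourierInv_eq, hcoe]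
  rw [h1] at h
  have h2 : ((∫ x, f x * η x : ℝ) : ℂ) = ∫ x, (f x : ℂ) • (η x : ℂ) := by
    rw [← integral_complex_ofReal]
    simp
  rw [h2, ← h]
  refine integral_congr_ae (Eventually.of_forall fun ξ => ?_)
  simp only [smul_eq_mul]
  rw [fourierAt_two_pi_mul, SchwartzMap.fourierInv_coe, Real.fourierInv_eq_fourier_neg, hcoe]
  rfl

/-- An `L¹` function with vanishing Fourier transform is zero. -/
lemma eq_zero_of_fourierAt {f : L1} (h : ∀ m, fourierAt m f = 0) : f = 0 := by
  apply Lp.ext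
  refine EventuallyEq.trans ?_ (Lp.coeFn_zero ℝ 1 volume).symm
  refine ae_eq_zero_of_integral_contDiff_smul_eq_zero (integrable_coe f).locallyIntegrable
    fun η hη hc => ?_
  have := integral_mul_eq_integral_fourierAt f hη hc
  simp only [h, zero_mul, integral_zero, Complex.ofReal_eq_zero] at this
  rw [← this]
  refine integral_congr_ae (Eventually.of_forall fun x => ?_)
  simp [mul_comm]

/-- The device for operator identities on `L1`: semigroup laws, commutation with translations and
Duhamel formulas are verified one frequency at a time. -/
lemma ext_fourierAt {f g : L1} (h : ∀ m, fourierAt m f = fourierAt m g) : f = g :=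
  sub_eq_zero.1 (eq_zero_of_fourierAt fun m => by rw [map_sub, h, sub_self])

/-- `g` is the derivative of `f`, in terms of Fourier transforms. -/
def IsFourierDeriv (f g : L1) : Prop := ∀ m, fourierAt m g = Complex.I * m * fourierAt m f

lemma IsFourierDeriv.integral_mul_deriv {f g : L1} (h : IsFourierDeriv f g) {η : ℝ → ℝ}
    (hη : ContDiff ℝ ∞ η) (hc : HasCompactSupport η) :
    ∫ x, f x * deriv η x = -∫ x, g x * η x := by
  have hη' : ContDiff ℝ ∞ (deriv η) := (contDiff_infty_iff_deriv.1 hη).2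
  have hηd : ContDiff ℝ ∞ (fun x => (η x : ℂ)) := Complex.ofRealCLM.contDiff.comp hη
  have hd : (fun x => ((deriv η x : ℝ) : ℂ)) = deriv (fun x => (η x : ℂ)) := by
    ext x
    exact ((hη.differentiable (by simp)).differentiableAt.hasDerivAt.ofReal_comp).deriv.symm
  have i1 : Integrable (fun x => (η x : ℂ)) := (hη.continuous.integrable_of_hasCompactSupport hc).ofReal
  have i2 : Integrable (deriv (fun x => (η x : ℂ))) := by
    rw [← hd]
    exact (hη'.continuous.integrable_of_hasCompactSupport hc.deriv).ofReal
  have key : ((∫ x, f x * deriv η x : ℝ) : ℂ) = ((-∫ x, g x * η x : ℝ) : ℂ) := by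
    rw [Complex.ofReal_neg, integral_mul_eq_integral_fourierAt f hη' hc.deriv,
      integral_mul_eq_integral_fourierAt g hη hc, ← integral_neg]
    refine integral_congr_ae (Eventually.of_forall fun ξ => ?_)
    simp only []
    rw [hd, Real.fourier_deriv i1 (hηd.differentiable (by simp)) i2, h]
    simp only [smul_eq_mul]
    push_cast
    ring
  exact_mod_cast key

lemma intervalIntegrable_translate (f : L1) (a b : ℝ) :
    IntervalIntegrable (fun y => translate y f) volume a b :=
  (continuous_translate f).intervalIntegrable a b

/-- The fundamental theorem of calculus for a derivative defined by its Fourier transform: r ↦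
exp(imr) f̂(m) has derivative exp(imr) ĝ(m). -/
lemma IsFourierDeriv.translate_sub {f g : L1} (h : IsFourierDeriv f g) (y : ℝ) :
    translate y f - f = ∫ r in (0 : ℝ)..y, translate r g := by
  apply ext_fourierAt
  intro m
  rw [← ContinuousLinearMap.intervalIntegral_comp_comm _ (intervalIntegrable_translate g 0 y)]
  simp only [map_sub, fourierAt_translate]
  have hd : ∀ r ∈ uIcc 0 y, HasDerivAt
      (fun r : ℝ => Complex.exp ((m * r : ℝ) * Complex.I) * fourierAt m f)
      (Complex.exp ((m * r : ℝ) * Complex.I) * fourierAt m g) r := fun r _ => by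
    have h1 : HasDerivAt (fun r : ℝ => ((m * r : ℝ) : ℂ)) ((m * 1 : ℝ) : ℂ) r :=
      ((hasDerivAt_id r).const_mul m).ofReal_comp
    have h2 := ((h1.mul_const Complex.I).cexp).mul_const (fourierAt m f)
    refine h2.congr_deriv ?_
    rw [h m]
    push_cast
    ring
  rw [intervalIntegral.integral_eq_sub_of_hasDerivAt hd]
  · simp
  · exact Continuous.intervalIntegrable (by fun_prop) _ _

lemma IsFourierDeriv.norm_translate_sub_le {f g : L1} (h : IsFourierDeriv f g) (y : ℝ) :
    ‖translate y f - f‖ ≤ ‖g‖ * |y| := by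
  rw [h.translate_sub]
  have := intervalIntegral.norm_integral_le_of_norm_le_const (a := (0 : ℝ)) (b := y)
    (f := fun r => translate r g) (C := ‖g‖) fun r _ => ((translate r).norm_map g).le
  simpa using this

lemma IsFourierDeriv.hasBV {f g : L1} (h : IsFourierDeriv f g) : HasBV ‖g‖ f := fun y hy => by
  simpa [abs_of_pos hy] using h.norm_translate_sub_le y

end IsentropicNS

end

noncomputable section

open Filter Topology
open ProbabilityTheory

namespace IsentropicNS

/-! ### The heat semigroup on `L¹` and its derivatives -/

/-- The centred Gaussian law of variance `a`. -/
abbrev gauss (a : ℝ) : Measure ℝ := gaussianReal 0 a.toNNReal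

lemma aestronglyMeasurable_translate (f : L1) (ν : Measure ℝ) :
    AEStronglyMeasurable (fun y => translate y f) ν :=
  (continuous_translate f).aestronglyMeasurable

lemma integrable_translate_gauss (a : ℝ) (f : L1) :
    Integrable (fun y => translate y f) (gauss a) := by
  refine (integrable_const ‖f‖).mono' (aestronglyMeasurable_translate f _) ?_
  exact Eventually.of_forall fun y => ((translate y).norm_map f).le

lemma integrable_id_gauss (a : ℝ) : Integrable (fun y : ℝ => y) (gauss a) :=
  memLp_one_iff_integrable.1 (memLp_id_gaussianReal' 1 (by simp))

lemma integrable_sq_gauss (a : ℝ) : Integrable (fun y : ℝ => y ^ 2) (gauss a) :=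
  (memLp_id_gaussianReal' 2 (by simp)).integrable_sq

lemma integral_sq_gauss {a : ℝ} (ha : 0 < a) : ∫ y, y ^ 2 ∂(gauss a) = a := by
  have h := variance_fun_id_gaussianReal (μ := 0) (v := a.toNNReal)
  rw [variance_eq_integral aemeasurable_id'] at h
  simpa [integral_id_gaussianReal, ha.le] using h

lemma integral_abs_gauss_le {a : ℝ} (ha : 0 < a) : ∫ y, |y| ∂(gauss a) ≤ √a := by
  have hs : 0 < √a := Real.sqrt_pos.2 ha
  have hsq : √a * √a = a := Real.mul_self_sqrt ha.le
  -- Young's inequality |y| ≤ y²/(2√a) + √a/2, whose two terms contribute √a/2 each.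
  calc ∫ y, |y| ∂(gauss a) ≤ ∫ y, ((1 / (2 * √a)) * y ^ 2 + √a / 2) ∂(gauss a) := by
        refine integral_mono (integrable_id_gauss a).abs
          (((integrable_sq_gauss a).const_mul _).add (integrable_const _)) fun y => ?_
        have e : (1 / (2 * √a)) * y ^ 2 + √a / 2 - |y| = (|y| - √a) ^ 2 / (2 * √a) := by
          rw [← sq_abs y]; field_simp; ring
        have : 0 ≤ (|y| - √a) ^ 2 / (2 * √a) := by positivity
        simp only
        linarith
    _ = √a := by
        rw [integral_add ((integrable_sq_gauss a).const_mul _) (integrable_const _),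
          integral_const_mul, integral_sq_gauss ha]
        simp only [integral_const, probReal_univ, one_smul]
        field_simp
        nlinarith

/-- The heat operator: averaging translations over the Gaussian law of variance `a`. -/
def heat (a : ℝ) : L1 →L[ℝ] L1 :=
  LinearMap.mkContinuous
    { toFun := fun f => ∫ y, translate y f ∂(gauss a)
      map_add' := fun f g => by
        simp only [map_add]
        exact integral_add (integrable_translate_gauss a f) (integrable_translate_gauss a g)
      map_smul' := fun c f => by
        simp only [map_smul, RingHom.id_apply]
        exact integral_smul c _ }
    1 fun f => by
      have := norm_integral_le_of_norm_le_const (μ := gauss a)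
        (Eventually.of_forall fun y => ((translate y).norm_map f).le)
      simpa using this

lemma heat_apply (a : ℝ) (f : L1) : heat a f = ∫ y, translate y f ∂(gauss a) := rfl

lemma norm_heat_le (a : ℝ) (f : L1) : ‖heat a f‖ ≤ ‖f‖ := by
  simpa using (heat a).le_of_opNorm_le (LinearMap.mkContinuous_norm_le _ zero_le_one _) f

lemma integrable_smul_translate (a : ℝ) (f : L1) :
    Integrable (fun y => (y / a) • translate y f) (gauss a) := by
  refine (((integrable_id_gauss a).div_const a).norm.mul_const ‖f‖).mono' ?_ ?_
  · exact (by fun_prop : Continuous fun y : ℝ => y / a).aestronglyMeasurable.smul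
      (aestronglyMeasurable_translate f _)
  · exact Eventually.of_forall fun y => by rw [norm_smul, (translate y).norm_map]

/-- The derivative of the heat operator. -/
def gradHeat (a : ℝ) : L1 →L[ℝ] L1 :=
  LinearMap.mkContinuous
    { toFun := fun f => ∫ y, (y / a) • translate y f ∂(gauss a)
      map_add' := fun f g => by
        simp only [map_add, smul_add]
        exact integral_add (integrable_smul_translate a f) (integrable_smul_translate a g)
      map_smul' := fun c f => by
        simp only [map_smul, RingHom.id_apply, smul_comm _ c]
        exact integral_smul c _ }
    (∫ y, |y / a| ∂(gauss a)) fun f => by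
      refine (norm_integral_le_integral_norm _).trans (le_of_eq ?_)
      simp only [norm_smul, (translate _).norm_map, Real.norm_eq_abs]
      rw [integral_mul_const]

lemma gradHeat_apply (a : ℝ) (f : L1) :
    gradHeat a f = ∫ y, (y / a) • translate y f ∂(gauss a) := rfl

lemma norm_gradHeat_le {a : ℝ} (ha : 0 < a) (f : L1) : ‖gradHeat a f‖ ≤ (√a)⁻¹ * ‖f‖ := by
  have h1 : ∫ y, |y / a| ∂(gauss a) ≤ (√a)⁻¹ := by
    simp only [abs_div, abs_of_pos ha]
    rw [integral_div, div_le_iff₀ ha]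
    refine (integral_abs_gauss_le ha).trans (le_of_eq ?_)
    rw [← Real.sqrt_div_self]
    field_simp
  refine ((gradHeat a).le_of_opNorm_le (LinearMap.mkContinuous_norm_le _ ?_ _) f).trans ?_
  · positivity
  · gcongr

lemma complexMGF_gauss {a : ℝ} (ha : 0 < a) (z : ℂ) :
    complexMGF id (gauss a) z = Complex.exp (a * z ^ 2 / 2) := by
  rw [complexMGF_id_gaussianReal]
  simp [ha.le]

lemma fourierAt_heat {a : ℝ} (ha : 0 < a) (m : ℝ) (f : L1) :
    fourierAt m (heat a f) = Real.exp (-(a * m ^ 2 / 2)) * fourierAt m f := by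
  rw [heat_apply, ← ContinuousLinearMap.integral_comp_comm _ (integrable_translate_gauss a f)]
  simp only [fourierAt_translate]
  rw [integral_mul_const]
  have h := complexMGF_gauss ha (m * Complex.I)
  rw [complexMGF] at h
  congr 1
  have e : (a * (m * Complex.I) ^ 2 / 2 : ℂ) = ((-(a * m ^ 2 / 2) : ℝ) : ℂ) := by
    rw [mul_pow, Complex.I_sq]; push_cast; ring
  rw [e, ← Complex.ofReal_exp] at h
  rw [← h]
  refine integral_congr_ae (Eventually.of_forall fun y => ?_)
  simp only [id]
  congr 1
  push_cast
  ring

/-- The factor y/a amounts to differentiating the Gaussian moment generating function exp(az²/2) at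
z = im and dividing by a, which produces im. -/
lemma fourierAt_gradHeat {a : ℝ} (ha : 0 < a) (m : ℝ) (f : L1) :
    fourierAt m (gradHeat a f) =
      Complex.I * m * (Real.exp (-(a * m ^ 2 / 2)) * fourierAt m f) := by
  rw [gradHeat_apply, ← ContinuousLinearMap.integral_comp_comm _ (integrable_smul_translate a f)]
  simp only [map_smul, fourierAt_translate, Complex.real_smul, ← mul_assoc]
  rw [integral_mul_const]
  have h := hasDerivAt_complexMGF (X := id) (μ := gauss a) (z := m * Complex.I)
    (by rw [integrableExpSet_id_gaussianReal]; simp)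
  have h2 : HasDerivAt (complexMGF id (gauss a))
      (Complex.exp (a * (m * Complex.I) ^ 2 / 2) * (a * (2 * (m * Complex.I)) / 2))
      (m * Complex.I) := by
    rw [funext (complexMGF_gauss ha)]
    have h3 : HasDerivAt (fun z : ℂ => a * z ^ 2 / 2) (a * (2 * (m * Complex.I)) / 2)
        (m * Complex.I) := by
      simpa using (((hasDerivAt_id (m * Complex.I : ℂ)).pow 2).const_mul (a : ℂ)).div_const 2
    exact h3.cexp
  have h4 := h.unique h2
  have e : (a * (m * Complex.I) ^ 2 / 2 : ℂ) = ((-(a * m ^ 2 / 2) : ℝ) : ℂ) := by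
    rw [mul_pow, Complex.I_sq]; push_cast; ring
  rw [e, ← Complex.ofReal_exp] at h4
  congr 1
  have ha' : (a : ℂ) ≠ 0 := by exact_mod_cast ha.ne'
  have : ∫ y : ℝ, ((y / a : ℝ) : ℂ) * Complex.exp ((m * y : ℝ) * Complex.I) ∂(gauss a) =
      (a : ℂ)⁻¹ * ∫ y : ℝ, ((id y : ℝ) : ℂ) * Complex.exp (m * Complex.I * (id y : ℝ)) ∂(gauss a) := by
    rw [← integral_const_mul]
    refine integral_congr_ae (Eventually.of_forall fun y => ?_)
    simp only [id]
    have : ((m * y : ℝ) : ℂ) * Complex.I = m * Complex.I * y := by push_cast; ring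
    rw [this]
    push_cast
    ring
  rw [this, h4]
  field_simp

/-- The second derivative of the heat operator. -/
def hessHeat (a : ℝ) : L1 →L[ℝ] L1 := gradHeat (a / 2) ∘L gradHeat (a / 2)

lemma fourierAt_hessHeat {a : ℝ} (ha : 0 < a) (m : ℝ) (f : L1) :
    fourierAt m (hessHeat a f) = -m ^ 2 * (Real.exp (-(a * m ^ 2 / 2)) * fourierAt m f) := by
  have ha2 : 0 < a / 2 := by positivity
  rw [hessHeat, ContinuousLinearMap.comp_apply, fourierAt_gradHeat ha2, fourierAt_gradHeat ha2]
  have : Real.exp (-(a * m ^ 2 / 2)) =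
      Real.exp (-(a / 2 * m ^ 2 / 2)) * Real.exp (-(a / 2 * m ^ 2 / 2)) := by
    rw [← Real.exp_add]; ring_nf
  rw [this]
  push_cast
  linear_combination (m ^ 2 * (Complex.exp (-(a / 2 * m ^ 2 / 2))) ^ 2 * fourierAt m f) *
    Complex.I_sq

lemma heat_heat {a b : ℝ} (ha : 0 < a) (hb : 0 < b) (f : L1) :
    heat (a + b) f = heat a (heat b f) := by
  refine ext_fourierAt fun m => ?_
  rw [fourierAt_heat (by positivity), fourierAt_heat ha, fourierAt_heat hb, ← mul_assoc,
    ← Complex.ofReal_mul, ← Real.exp_add]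
  ring_nf

lemma heat_gradHeat {a b : ℝ} (ha : 0 < a) (hb : 0 < b) (f : L1) :
    gradHeat (a + b) f = heat a (gradHeat b f) := by
  refine ext_fourierAt fun m => ?_
  rw [fourierAt_gradHeat (by positivity), fourierAt_heat ha, fourierAt_gradHeat hb]
  have : Real.exp (-((a + b) * m ^ 2 / 2)) =
      Real.exp (-(a * m ^ 2 / 2)) * Real.exp (-(b * m ^ 2 / 2)) := by
    rw [← Real.exp_add]; ring_nf
  rw [this, Complex.ofReal_mul]
  ring

lemma heat_hessHeat {a b : ℝ} (ha : 0 < a) (hb : 0 < b) (f : L1) :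
    hessHeat (a + b) f = heat a (hessHeat b f) := by
  refine ext_fourierAt fun m => ?_
  rw [fourierAt_hessHeat (by positivity), fourierAt_heat ha, fourierAt_hessHeat hb]
  have : Real.exp (-((a + b) * m ^ 2 / 2)) =
      Real.exp (-(a * m ^ 2 / 2)) * Real.exp (-(b * m ^ 2 / 2)) := by
    rw [← Real.exp_add]; ring_nf
  rw [this, Complex.ofReal_mul]
  ring

lemma isFourierDeriv_heat {a : ℝ} (ha : 0 < a) (f : L1) :
    IsFourierDeriv (heat a f) (gradHeat a f) := fun m => by
  rw [fourierAt_gradHeat ha, fourierAt_heat ha]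

lemma isFourierDeriv_gradHeat {a : ℝ} (ha : 0 < a) (f : L1) :
    IsFourierDeriv (gradHeat a f) (hessHeat a f) := fun m => by
  rw [fourierAt_gradHeat ha, fourierAt_hessHeat ha]
  linear_combination -(m ^ 2 * Real.exp (-(a * m ^ 2 / 2)) * fourierAt m f) * Complex.I_sq

lemma heat_translate {a : ℝ} (ha : 0 < a) (h : ℝ) (f : L1) :
    heat a (translate h f) = translate h (heat a f) := by
  refine ext_fourierAt fun m => ?_
  rw [fourierAt_heat ha, fourierAt_translate, fourierAt_translate, fourierAt_heat ha]
  ring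

lemma hessHeat_translate {a : ℝ} (ha : 0 < a) (h : ℝ) (f : L1) :
    hessHeat a (translate h f) = translate h (hessHeat a f) := by
  refine ext_fourierAt fun m => ?_
  rw [fourierAt_hessHeat ha, fourierAt_translate, fourierAt_translate, fourierAt_hessHeat ha]
  ring

lemma heat_sub_eq (a : ℝ) (f : L1) :
    heat a f - f = ∫ y, (translate y f - f) ∂(gauss a) := by
  rw [integral_sub (integrable_translate_gauss a f) (integrable_const _), heat_apply]
  simp

/-- The difference is a Gaussian average of translation differences, each of size at most |y| ‖g‖,
and the mean of |y| is at most √a. -/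
lemma norm_heat_sub_le {a : ℝ} (ha : 0 < a) {f g : L1} (h : IsFourierDeriv f g) :
    ‖heat a f - f‖ ≤ √a * ‖g‖ := by
  rw [heat_sub_eq]
  refine (norm_integral_le_of_norm_le (((integrable_id_gauss a).abs).const_mul ‖g‖)
    (Eventually.of_forall fun y => h.norm_translate_sub_le y)).trans ?_
  rw [integral_const_mul, mul_comm]
  gcongr
  exact integral_abs_gauss_le ha

/-- The flow up to a supplies a derivative at the price a^(-1/2), and this derivative controls the
further flow up to h. All Hölder estimates in time rest on this bound. -/
lemma norm_heat_add_sub_le {a h : ℝ} (ha : 0 < a) (hh : 0 < h) (f : L1) :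
    ‖heat (a + h) f - heat a f‖ ≤ √h * ((√a)⁻¹ * ‖f‖) := by
  rw [add_comm, heat_heat hh ha]
  refine (norm_heat_sub_le hh (isFourierDeriv_heat ha f)).trans ?_
  gcongr
  exact norm_gradHeat_le ha f

lemma norm_hessHeat_le {a : ℝ} (ha : 0 < a) (f : L1) : ‖hessHeat a f‖ ≤ 2 / a * ‖f‖ := by
  have ha2 : 0 < a / 2 := by positivity
  refine (norm_gradHeat_le ha2 _).trans ?_
  have h1 := norm_gradHeat_le ha2 f
  calc (√(a / 2))⁻¹ * ‖gradHeat (a / 2) f‖ ≤ (√(a / 2))⁻¹ * ((√(a / 2))⁻¹ * ‖f‖) := by gcongr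
    _ = 2 / a * ‖f‖ := by
        rw [← mul_assoc, ← mul_inv, Real.mul_self_sqrt ha2.le, inv_div]

/-- The parameter a is split into halves: one half produces the second derivative, the other half
makes the semigroup difference small. -/
lemma norm_hessHeat_add_sub_le {a h : ℝ} (ha : 0 < a) (hh : 0 < h) (f : L1) :
    ‖hessHeat (a + h) f - hessHeat a f‖ ≤ √h * ((√(a / 2))⁻¹ * (4 / a * ‖f‖)) := by
  have ha2 : 0 < a / 2 := by positivity
  have e1 : hessHeat (a + h) f = heat (a / 2 + h) (hessHeat (a / 2) f) := by
    rw [← heat_hessHeat (by positivity) ha2]; ring_nf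
  have e2 : hessHeat a f = heat (a / 2) (hessHeat (a / 2) f) := by
    rw [← heat_hessHeat ha2 ha2]; ring_nf
  rw [e1, e2]
  refine (norm_heat_add_sub_le ha2 hh _).trans ?_
  gcongr
  refine (norm_hessHeat_le ha2 f).trans (le_of_eq ?_)
  field_simp
  ring

lemma norm_gradHeat_add_sub_le {a h : ℝ} (ha : 0 < a) (hh : 0 < h) (f : L1) :
    ‖gradHeat (a + h) f - gradHeat a f‖ ≤ √h * (2 / a * ‖f‖) := by
  have ha2 : 0 < a / 2 := by positivity
  have e1 : gradHeat (a + h) f = heat (a / 2 + h) (gradHeat (a / 2) f) := by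
    rw [← heat_gradHeat (by positivity) ha2]; ring_nf
  have e2 : gradHeat a f = heat (a / 2) (gradHeat (a / 2) f) := by
    rw [← heat_gradHeat ha2 ha2]; ring_nf
  rw [e1, e2]
  refine (norm_heat_add_sub_le ha2 hh _).trans ?_
  have := norm_gradHeat_le ha2 f
  calc √h * ((√(a / 2))⁻¹ * ‖gradHeat (a / 2) f‖)
      ≤ √h * ((√(a / 2))⁻¹ * ((√(a / 2))⁻¹ * ‖f‖)) := by gcongr
    _ = √h * (2 / a * ‖f‖) := by
        rw [← mul_assoc (√(a / 2))⁻¹, ← mul_inv, Real.mul_self_sqrt ha2.le, inv_div]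

/-- A map with an antitone, locally bounded `1/2`-Hölder modulus is continuous on `(0,∞)`. -/
lemma continuousOn_of_sqrt_modulus {X : Type*} [NormedAddCommGroup X] {G : ℝ → X} {M : ℝ → ℝ}
    (hM : AntitoneOn M (Ioi 0))
    (hG : ∀ a > 0, ∀ h > 0, ‖G (a + h) - G a‖ ≤ √h * M a) : ContinuousOn G (Ioi 0) := by
  intro a ha
  have ha : 0 < a := ha
  refine ContinuousAt.continuousWithinAt ?_
  rw [ContinuousAt, tendsto_iff_norm_sub_tendsto_zero]
  have hlim : Tendsto (fun b => √|b - a| * M (a / 2)) (𝓝 a) (𝓝 0) := by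
    have : ContinuousAt (fun b => √|b - a| * M (a / 2)) a := by fun_prop
    simpa [ContinuousAt] using this
  refine squeeze_zero' (Eventually.of_forall fun _ => norm_nonneg _) ?_ hlim
  have ha2 : a / 2 ∈ Ioi (0 : ℝ) := by simp [ha]
  filter_upwards [lt_mem_nhds (show a / 2 < a by linarith)] with b hb
  rcases lt_trichotomy b a with h | h | h
  · have := hG b (by linarith) (a - b) (by linarith)
    rw [add_sub_cancel, norm_sub_rev] at this
    rw [abs_sub_comm, abs_of_pos (by linarith)]
    refine this.trans (mul_le_mul_of_nonneg_left ?_ (Real.sqrt_nonneg _))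
    exact hM ha2 (show 0 < b by linarith) hb.le
  · simp [h]
  · have := hG a ha (b - a) (by linarith)
    rw [add_sub_cancel] at this
    rw [abs_of_pos (by linarith)]
    refine this.trans (mul_le_mul_of_nonneg_left ?_ (Real.sqrt_nonneg _))
    exact hM ha2 ha (by linarith)

lemma continuousOn_hessHeat : ContinuousOn hessHeat (Ioi 0) := by
  refine continuousOn_of_sqrt_modulus (M := fun a => (√(a / 2))⁻¹ * (4 / a)) ?_ ?_
  · intro a ha b hb hab
    have ha : 0 < a := ha
    have hb : 0 < b := hb
    simp only
    gcongr
  · intro a ha h hh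
    refine ContinuousLinearMap.opNorm_le_bound _ (by positivity) fun f => ?_
    refine (norm_hessHeat_add_sub_le ha hh f).trans (le_of_eq (by ring))

lemma continuousOn_gradHeat : ContinuousOn gradHeat (Ioi 0) := by
  refine continuousOn_of_sqrt_modulus (M := fun a => 2 / a) ?_ ?_
  · intro a ha b hb hab
    have ha : 0 < a := ha
    have hb : 0 < b := hb
    simp only
    gcongr
  · intro a ha h hh
    refine ContinuousLinearMap.opNorm_le_bound _ (by positivity) fun f => ?_
    refine (norm_gradHeat_add_sub_le ha hh f).trans (le_of_eq (by ring))

/-! ### Smoothing of fractional Sobolev data -/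

/-- The Gaussian is centred, so f may be subtracted inside the integral; only then can the
fractional regularity of f be used. -/
lemma gradHeat_eq_sub (a : ℝ) (f : L1) :
    gradHeat a f = ∫ y, (y / a) • (translate y f - f) ∂(gauss a) := by
  simp only [smul_sub]
  rw [integral_sub (integrable_smul_translate a f)
    (((integrable_id_gauss a).div_const a).smul_const f), integral_smul_const, integral_div,
    integral_id_gaussianReal, zero_div, zero_smul, sub_zero, gradHeat_apply]

/-- Since s ≤ 2, x^s ≤ 1 + x², and this is at most 9(1 + x/2 + x²/8) ≤ 9 exp(x/2). -/
lemma rpow_mul_exp_neg_le {x s : ℝ} (hx : 0 ≤ x) (hs0 : 0 ≤ s) (hs : s ≤ 2) :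
    x ^ s * Real.exp (-(x / 2)) ≤ 9 := by
  rw [Real.exp_neg, ← div_eq_mul_inv, div_le_iff₀ (Real.exp_pos _)]
  have h1 : x ^ s ≤ 1 + x ^ 2 := by
    rcases le_total x 1 with h | h
    · have := Real.rpow_le_one hx h hs0
      nlinarith [sq_nonneg x]
    · have := Real.rpow_le_rpow_of_exponent_le h hs
      rw [Real.rpow_two] at this
      linarith
  have h2 := Real.quadratic_le_exp_of_nonneg (show 0 ≤ x / 2 by linarith)
  nlinarith

/-- With x = y²/a, the boundedness of x^(1+γ) exp(-x/2) trades the Gaussian for the homogeneous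
Gagliardo kernel |y|^(-(1+2γ)); scaling leaves the power a^(γ-1/2). -/
lemma gradHeat_kernel_le {a γ : ℝ} (ha : 0 < a) (h0 : 0 ≤ γ) (hγ : γ ≤ 1) {y : ℝ} (hy : y ≠ 0) :
    gaussianPDFReal 0 a.toNNReal y * |y / a| ≤
      9 * a ^ (γ - 1 / 2) * |y| ^ (-(1 + 2 * γ)) := by
  have hy' : 0 < |y| := abs_pos.2 hy
  have hx := rpow_mul_exp_neg_le (show 0 ≤ y ^ 2 / a by positivity) (show 0 ≤ 1 + γ by linarith)
    (by linarith)
  have e1 : (y ^ 2 / a) ^ (1 + γ) = |y| ^ (2 + 2 * γ) * a ^ (-(1 + γ)) := by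
    rw [Real.div_rpow (by positivity) ha.le, ← sq_abs, ← Real.rpow_two, ← Real.rpow_mul hy'.le,
      Real.rpow_neg ha.le, div_eq_mul_inv]
    ring_nf
  have e2 : (√(2 * Real.pi * a))⁻¹ ≤ a ^ (-(1 / 2) : ℝ) := by
    rw [Real.rpow_neg ha.le, ← Real.sqrt_eq_rpow]
    gcongr
    nlinarith [Real.pi_gt_three]
  have e3 : gaussianPDFReal 0 a.toNNReal y =
      (√(2 * Real.pi * a))⁻¹ * Real.exp (-(y ^ 2 / a / 2)) := by
    rw [gaussianPDFReal_def]
    simp only [Real.coe_toNNReal _ ha.le, sub_zero]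
    congr 2
    field_simp
  rw [e1] at hx
  rw [e3, abs_div, abs_of_pos ha]
  calc (√(2 * Real.pi * a))⁻¹ * Real.exp (-(y ^ 2 / a / 2)) * (|y| / a)
      ≤ a ^ (-(1 / 2) : ℝ) * Real.exp (-(y ^ 2 / a / 2)) * (|y| / a) := by gcongr
    _ = (|y| ^ (2 + 2 * γ) * a ^ (-(1 + γ)) * Real.exp (-(y ^ 2 / a / 2))) *
          (a ^ (γ - 1 / 2) * |y| ^ (-(1 + 2 * γ))) := by
        have e4 : a ^ (-(1 / 2) : ℝ) = a ^ (-(1 + γ)) * a ^ (γ - 1 / 2) * a := by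
          conv_rhs => rw [← Real.rpow_add ha]
          nth_rewrite 3 [← Real.rpow_one a]
          rw [← Real.rpow_add ha]
          ring_nf
        have e5 : |y| = |y| ^ (2 + 2 * γ) * |y| ^ (-(1 + 2 * γ)) := by
          conv_lhs => rw [← Real.rpow_one |y|]
          rw [← Real.rpow_add hy']
          ring_nf
        rw [e4]
        nth_rewrite 1 [e5]
        field_simp
    _ ≤ 9 * (a ^ (γ - 1 / 2) * |y| ^ (-(1 + 2 * γ))) := by gcongr
    _ = _ := by ring

/-- The gain of regularity of the heat flow on `W^{2γ,1}`. -/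
lemma norm_gradHeat_le_of_sobolev {a γ : ℝ} (ha : 0 < a) (h0 : 0 ≤ γ) (hγ : γ ≤ 1) (u : L1)
    (hu : Integrable fun y : ℝ => |y| ^ (-(1 + 2 * γ)) * ‖translate y u - u‖) :
    ‖gradHeat a u‖ ≤ 9 * a ^ (γ - 1 / 2) * ∫ y : ℝ, |y| ^ (-(1 + 2 * γ)) * ‖translate y u - u‖ := by
  have hne : a.toNNReal ≠ 0 := by simpa using ha
  rw [gradHeat_eq_sub, integral_gaussianReal_eq_integral_smul hne, ← integral_const_mul]
  refine norm_integral_le_of_norm_le (hu.const_mul _) ?_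
  have hz : ∀ᵐ y : ℝ, y ≠ 0 := by simp [ae_iff]
  filter_upwards [hz] with y hy
  rw [norm_smul, norm_smul, ← mul_assoc, Real.norm_of_nonneg (gaussianPDFReal_nonneg _ _ _),
    Real.norm_eq_abs, ← mul_assoc]
  exact mul_le_mul_of_nonneg_right (gradHeat_kernel_le ha h0 hγ hy) (norm_nonneg _)

end IsentropicNS

end

noncomputable section

open Filter Topology

namespace IsentropicNS

/-! ### Weighted Hölder curves and the singular Duhamel integral -/

section Duhamel

variable {E : Type*} [NormedAddCommGroup E]

/-- The curve `F` has time-weighted Hölder norm at most `K` on `(0,T)`. -/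
structure WHolder (α T σ K : ℝ) (F : ℝ → E) : Prop where
  bound : ∀ s, 0 < s → s < T → ‖F s‖ ≤ K * s ^ (-σ)
  holder : ∀ s t, 0 < s → s < t → t < T → ‖F t - F s‖ ≤ K * (s ^ (-(σ + α)) * (t - s) ^ α)

lemma continuousOn_of_holder {F : ℝ → E} {α T : ℝ} {M : ℝ → ℝ} (hα : 0 < α)
    (hM : ∀ a b, 0 < a → a ≤ b → M b ≤ M a)
    (h : ∀ s t, 0 < s → s < t → t < T → ‖F t - F s‖ ≤ M s * (t - s) ^ α) :
    ContinuousOn F (Ioo 0 T) := by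
  intro t ht
  refine ContinuousAt.continuousWithinAt ?_
  rw [ContinuousAt, tendsto_iff_norm_sub_tendsto_zero]
  have hlim : Tendsto (fun b => M (t / 2) * |b - t| ^ α) (𝓝 t) (𝓝 0) := by
    have : ContinuousAt (fun b => M (t / 2) * |b - t| ^ α) t := by
      refine continuousAt_const.mul (ContinuousAt.rpow_const (by fun_prop) (Or.inr hα.le))
    simpa [ContinuousAt, hα.ne'] using this
  refine squeeze_zero' (Eventually.of_forall fun _ => norm_nonneg _) ?_ hlim
  filter_upwards [lt_mem_nhds (show t / 2 < t by linarith [ht.1]), gt_mem_nhds ht.2] with b hb hbT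
  rcases lt_trichotomy b t with h' | h' | h'
  · have := h b t (by linarith [ht.1]) h' ht.2
    rw [norm_sub_rev, abs_sub_comm, abs_of_pos (by linarith)]
    refine this.trans (mul_le_mul_of_nonneg_right ?_ (Real.rpow_nonneg (by linarith) _))
    exact hM _ _ (by linarith [ht.1]) hb.le
  · simp [h', hα.ne']
  · have := h t b ht.1 h' hbT
    rw [abs_of_pos (by linarith)]
    refine this.trans (mul_le_mul_of_nonneg_right ?_ (Real.rpow_nonneg (by linarith) _))
    exact hM _ _ (by linarith [ht.1]) (by linarith [ht.1])

lemma WHolder.continuousOn {α T σ K : ℝ} {F : ℝ → E} (hα : 0 < α) (hσ : 0 ≤ σ) (hK : 0 ≤ K)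
    (hF : WHolder α T σ K F) : ContinuousOn F (Ioo 0 T) := by
  refine continuousOn_of_holder (M := fun s => K * s ^ (-(σ + α))) hα ?_ ?_
  · intro a b ha hab
    exact mul_le_mul_of_nonneg_left (Real.rpow_le_rpow_of_nonpos ha hab (by linarith)) hK
  · intro s t hs hst ht
    rw [mul_assoc]
    exact hF.holder s t hs hst ht

lemma intervalIntegrable_const_sub_rpow {t γ : ℝ} (hγ : -1 < γ) (a b : ℝ) :
    IntervalIntegrable (fun r => (t - r) ^ γ) volume a b := by
  have := (intervalIntegral.intervalIntegrable_rpow' (a := t - a) (b := t - b) hγ).comp_sub_left t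
  simpa using this

lemma integral_const_sub_rpow {t γ : ℝ} (hγ : -1 < γ) (a b : ℝ) :
    ∫ r in a..b, (t - r) ^ γ = ((t - a) ^ (γ + 1) - (t - b) ^ (γ + 1)) / (γ + 1) := by
  rw [intervalIntegral.integral_comp_sub_left (fun r => r ^ γ) t, integral_rpow (Or.inl hγ)]

lemma intervalIntegrable_of_bound {f : ℝ → E} {g : ℝ → ℝ} {a b : ℝ} (hab : a ≤ b)
    (hf : ContinuousOn f (Ioo a b)) (hg : IntervalIntegrable g volume a b)
    (h : ∀ r ∈ Ioo a b, ‖f r‖ ≤ g r) : IntervalIntegrable f volume a b := by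
  rw [intervalIntegrable_iff_integrableOn_Ioo_of_le hab] at hg ⊢
  refine hg.mono' (hf.aestronglyMeasurable measurableSet_Ioo) ?_
  exact (ae_restrict_iff' measurableSet_Ioo).2 (Eventually.of_forall h)

variable [NormedSpace ℝ E]

lemma norm_integral_le_of_bound {f : ℝ → E} {g : ℝ → ℝ} {a b : ℝ} (hab : a ≤ b)
    (hg : IntervalIntegrable g volume a b) (h : ∀ r ∈ Ioo a b, ‖f r‖ ≤ g r) :
    ‖∫ r in a..b, f r‖ ≤ ∫ r in a..b, g r := by
  refine intervalIntegral.norm_integral_le_of_norm_le hab ?_ hg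
  have : ∀ᵐ r : ℝ, r ≠ b := by simp [ae_iff]
  filter_upwards [this] with r hr hr2
  exact h r ⟨hr2.1, lt_of_le_of_ne hr2.2 hr⟩

/-- Splitting the two endpoint singularities of `r^{-β} (t-r)^{-δ}`. -/
lemma rpow_mul_rpow_le {t r β δ : ℝ} (hr : 0 < r) (hrt : r < t) (hβ : 0 ≤ β) (hδ : 0 ≤ δ) :
    r ^ (-β) * (t - r) ^ (-δ) ≤ (t / 2) ^ (-δ) * r ^ (-β) + (t / 2) ^ (-β) * (t - r) ^ (-δ) := by
  have h1 : 0 ≤ r ^ (-β) := Real.rpow_nonneg hr.le _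
  have h2 : 0 ≤ (t - r) ^ (-δ) := Real.rpow_nonneg (by linarith) _
  have h3 : 0 ≤ (t / 2) ^ (-β) := Real.rpow_nonneg (by linarith) _
  have h4 : 0 ≤ (t / 2) ^ (-δ) := Real.rpow_nonneg (by linarith) _
  rcases le_total r (t / 2) with h | h
  · have : (t - r) ^ (-δ) ≤ (t / 2) ^ (-δ) :=
      Real.rpow_le_rpow_of_nonpos (by linarith) (by linarith) (by linarith)
    nlinarith [mul_nonneg h3 h2]
  · have : r ^ (-β) ≤ (t / 2) ^ (-β) :=
      Real.rpow_le_rpow_of_nonpos (by linarith) h (by linarith)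
    nlinarith [mul_nonneg h4 h1]

lemma half_rpow_neg {t β : ℝ} (ht : 0 < t) : (t / 2) ^ (-β) = 2 ^ β * t ^ (-β) := by
  rw [Real.div_rpow ht.le zero_le_two, Real.rpow_neg zero_le_two, div_inv_eq_mul, mul_comm]

lemma two_rpow_le_two {β : ℝ} (hβ : β ≤ 1) : (2 : ℝ) ^ β ≤ 2 := by
  simpa using Real.rpow_le_rpow_of_exponent_le one_le_two hβ

lemma half_rpow_neg_le {t β : ℝ} (ht : 0 < t) (hβ : β ≤ 1) : (t / 2) ^ (-β) ≤ 2 * t ^ (-β) := by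
  rw [half_rpow_neg ht]
  exact mul_le_mul_of_nonneg_right (two_rpow_le_two hβ) (Real.rpow_nonneg ht.le _)

lemma intervalIntegrable_neg_rpow {β : ℝ} (hβ : β < 1) (a b : ℝ) :
    IntervalIntegrable (fun r : ℝ => r ^ (-β)) volume a b :=
  intervalIntegral.intervalIntegrable_rpow' (by linarith)

lemma intervalIntegrable_beta {t β α : ℝ} (hβ : β < 1) (hα : 0 < α) :
    IntervalIntegrable (fun r => (t / 2) ^ (-(1 - α)) * r ^ (-β) +
      (t / 2) ^ (-β) * (t - r) ^ (-(1 - α))) volume 0 t :=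
  ((intervalIntegrable_neg_rpow hβ 0 t).const_mul _).add
    ((intervalIntegrable_const_sub_rpow (by linarith) 0 t).const_mul _)

/-- An elementary substitute for the Beta integral of r^(-β) (t-r)^(α-1): after the splitting at t/2
each endpoint singularity is integrated explicitly, and homogeneity gives t^(α-β). -/
lemma integral_beta_le {t β α : ℝ} (ht : 0 < t) (hβ : β < 1) (hα : 0 < α) :
    ∫ r in (0 : ℝ)..t, ((t / 2) ^ (-(1 - α)) * r ^ (-β) + (t / 2) ^ (-β) * (t - r) ^ (-(1 - α))) ≤
      2 * (1 / (1 - β) + 1 / α) * t ^ (α - β) := by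
  rw [intervalIntegral.integral_add ((intervalIntegrable_neg_rpow hβ 0 t).const_mul _)
    ((intervalIntegrable_const_sub_rpow (by linarith) 0 t).const_mul _),
    intervalIntegral.integral_const_mul, intervalIntegral.integral_const_mul,
    integral_const_sub_rpow (by linarith), integral_rpow (Or.inl (by linarith))]
  have hβ' : 0 < 1 - β := by linarith
  have e1 : -β + 1 = 1 - β := by ring
  have e2 : -(1 - α) + 1 = α := by ring
  rw [e1, e2, sub_self, sub_zero, Real.zero_rpow hβ'.ne', Real.zero_rpow hα.ne', sub_zero, sub_zero]
  have h1 : (t / 2) ^ (-(1 - α)) ≤ 2 * t ^ (-(1 - α)) := half_rpow_neg_le ht (by linarith)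
  have h2 : (t / 2) ^ (-β) ≤ 2 * t ^ (-β) := half_rpow_neg_le ht hβ.le
  have p1 : t ^ (-(1 - α)) * t ^ (1 - β) = t ^ (α - β) := by rw [← Real.rpow_add ht]; ring_nf
  have p2 : t ^ (-β) * t ^ α = t ^ (α - β) := by rw [← Real.rpow_add ht]; ring_nf
  calc (t / 2) ^ (-(1 - α)) * (t ^ (1 - β) / (1 - β)) + (t / 2) ^ (-β) * (t ^ α / α)
      ≤ 2 * t ^ (-(1 - α)) * (t ^ (1 - β) / (1 - β)) + 2 * t ^ (-β) * (t ^ α / α) := by gcongr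
    _ = 2 * ((t ^ (-(1 - α)) * t ^ (1 - β)) / (1 - β) + (t ^ (-β) * t ^ α) / α) := by ring
    _ = _ := by rw [p1, p2]; ring

/-- The operators `A(t)`, `e(t)` behave like `∂ₓ² e^{tΔ}`, `e^{tΔ}`. -/
structure ParabolicPair (c κ : ℝ) (A e : ℝ → E →L[ℝ] E) : Prop where
  c_nonneg : 0 ≤ c
  κ_nonneg : 0 ≤ κ
  continuousOn : ContinuousOn A (Ioi 0)
  norm_le : ∀ t > 0, ∀ f, ‖A t f‖ ≤ c * t ^ (-1 : ℝ) * ‖f‖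
  norm_sub_le : ∀ t > 0, ∀ h > 0, ∀ f,
    ‖A (t + h) f - A t f‖ ≤ c * (h ^ (1 / 2 : ℝ) * t ^ (-(3 / 2) : ℝ)) * ‖f‖
  norm_e_le : ∀ t > 0, ∀ f, ‖e t f‖ ≤ ‖f‖
  norm_e_sub_le : ∀ t > 0, ∀ h > 0, ∀ f,
    ‖e (t + h) f - e t f‖ ≤ h ^ (1 / 2 : ℝ) * t ^ (-(1 / 2) : ℝ) * ‖f‖
  integral_eq : ∀ a b, 0 < a → a ≤ b → ∀ f, ∫ r in a..b, A r f = κ • (e b f - e a f)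

/-- The regularised form of the singular Duhamel integral `∫₀ᵗ A(t-r) F(r) dr`. -/
def duhamel (κ : ℝ) (A e : ℝ → E →L[ℝ] E) (F : ℝ → E) (t : ℝ) : E :=
  -- Formally ∫₀ᵗ A(t-r) F(t) dr = κ (e(t) F(t) - F(t)), by `integral_eq` with e(0) the identity.
  -- Subtracting F(t) makes the remaining integrand of order (t-r)^(α-1), and the subtracted part is
  -- added back in closed form.
  (∫ r in (0 : ℝ)..t, A (t - r) (F r - F t)) + κ • (e t (F t) - F t)

variable {α T σ K c κ : ℝ} {A e : ℝ → E →L[ℝ] E} {F : ℝ → E}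

lemma ParabolicPair.continuousOn_integrand (hP : ParabolicPair c κ A e)
    (hF : ContinuousOn F (Ioo 0 T)) {t p : ℝ} (htT : p ≤ T) (hpt : p ≤ t) (x : E) :
    ContinuousOn (fun r => A (t - r) (F r - x)) (Ioo 0 p) := by
  refine ContinuousOn.clm_apply (hP.continuousOn.comp (by fun_prop) fun r hr => ?_)
    ((hF.mono (Ioo_subset_Ioo_right htT)).sub continuousOn_const)
  have := hr.2
  simp only [mem_Ioi, sub_pos]
  linarith

lemma ParabolicPair.integrand_le (hP : ParabolicPair c κ A e) (hF : WHolder α T σ K F)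
    {r t : ℝ} (hr : 0 < r) (hrt : r < t) (htT : t < T) :
    ‖A (t - r) (F r - F t)‖ ≤ c * K * (r ^ (-(σ + α)) * (t - r) ^ (-(1 - α))) := by
  refine (hP.norm_le _ (by linarith) _).trans ?_
  have h1 := hF.holder r t hr hrt htT
  rw [norm_sub_rev] at h1
  have h2 : (t - r) ^ (-(1 - α)) = (t - r) ^ (-1 : ℝ) * (t - r) ^ α := by
    rw [← Real.rpow_add (by linarith)]; ring_nf
  have h3 : 0 ≤ c * (t - r) ^ (-1 : ℝ) :=
    mul_nonneg hP.c_nonneg (Real.rpow_nonneg (by linarith) _)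
  calc c * (t - r) ^ (-1 : ℝ) * ‖F r - F t‖
      ≤ c * (t - r) ^ (-1 : ℝ) * (K * (r ^ (-(σ + α)) * (t - r) ^ α)) := by gcongr
    _ = _ := by rw [h2]; ring

lemma ParabolicPair.intervalIntegrable (hP : ParabolicPair c κ A e) (hF : WHolder α T σ K F)
    (hα : 0 < α) (hσ : 0 ≤ σ) (hσα : σ + α < 1) (hK : 0 ≤ K) {t : ℝ} (ht : 0 < t)
    (htT : t < T) : IntervalIntegrable (fun r => A (t - r) (F r - F t)) volume 0 t := by
  refine intervalIntegrable_of_bound ht.le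
    (hP.continuousOn_integrand (hF.continuousOn hα hσ hK) htT.le le_rfl _)
    ((intervalIntegrable_beta (β := σ + α) (α := α) hσα hα).const_mul (c * K)) fun r hr => ?_
  refine (hP.integrand_le hF hr.1 hr.2 htT).trans ?_
  exact mul_le_mul_of_nonneg_left (rpow_mul_rpow_le hr.1 hr.2 (by linarith) (by linarith))
    (mul_nonneg hP.c_nonneg hK)

lemma ParabolicPair.norm_duhamel_le (hP : ParabolicPair c κ A e) (hF : WHolder α T σ K F)
    (hα : 0 < α) (hσ : 0 ≤ σ) (hσα : σ + α < 1) (hK : 0 ≤ K) {t : ℝ} (ht : 0 < t)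
    (htT : t < T) :
    ‖duhamel κ A e F t‖ ≤ (c * (2 * (1 / (1 - (σ + α)) + 1 / α)) + 2 * κ) * K * t ^ (-σ) := by
  have h1 : ‖∫ r in (0 : ℝ)..t, A (t - r) (F r - F t)‖ ≤
      c * K * (2 * (1 / (1 - (σ + α)) + 1 / α) * t ^ (α - (σ + α))) := by
    refine (norm_integral_le_of_bound ht.le
      ((intervalIntegrable_beta (β := σ + α) (α := α) hσα hα).const_mul (c * K))
      fun r hr => ?_).trans ?_
    · refine (hP.integrand_le hF hr.1 hr.2 htT).trans ?_
      exact mul_le_mul_of_nonneg_left (rpow_mul_rpow_le hr.1 hr.2 (by linarith) (by linarith))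
        (mul_nonneg hP.c_nonneg hK)
    · rw [intervalIntegral.integral_const_mul]
      exact mul_le_mul_of_nonneg_left (integral_beta_le ht hσα hα)
        (mul_nonneg hP.c_nonneg hK)
  have h2 : ‖κ • (e t (F t) - F t)‖ ≤ κ * (2 * (K * t ^ (-σ))) := by
    rw [norm_smul, Real.norm_of_nonneg hP.κ_nonneg]
    refine mul_le_mul_of_nonneg_left ?_ hP.κ_nonneg
    have := hF.bound t ht htT
    linarith [_root_.norm_sub_le (e t (F t)) (F t), hP.norm_e_le t ht (F t)]
  have e1 : α - (σ + α) = -σ := by ring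
  rw [e1] at h1
  refine (norm_add_le _ _).trans ((add_le_add h1 h2).trans (le_of_eq (by ring)))

/-- Both integrals are split at p. Near the endpoint each keeps its own subtraction; on [0,p] both
are recentred at F(s), so that only the difference of the kernels remains. The cost of recentring,
∫₀ᵖ A(t-r)(F(s) - F(t)) dr, is evaluated by `integral_eq` and merges with the boundary terms. -/
lemma ParabolicPair.duhamel_sub_eq (hP : ParabolicPair c κ A e) (hF : WHolder α T σ K F)
    (hα : 0 < α) (hσ : 0 ≤ σ) (hσα : σ + α < 1) (hK : 0 ≤ K) {p s t : ℝ}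
    (hp : 0 < p) (hps : p < s) (hst : s < t) (htT : t < T) :
    duhamel κ A e F t - duhamel κ A e F s =
      (∫ r in p..t, A (t - r) (F r - F t)) - (∫ r in p..s, A (s - r) (F r - F s)) +
      (∫ r in (0 : ℝ)..p, (A (t - r) (F r - F s) - A (s - r) (F r - F s))) +
      κ • ((e t (F s) - e s (F s)) + ((F s - F t) - e (t - p) (F s - F t))) := by
  have hc := hF.continuousOn hα hσ hK
  have it := hP.intervalIntegrable hF hα hσ hσα hK (by linarith : 0 < t) htT
  have is := hP.intervalIntegrable hF hα hσ hσα hK (by linarith : 0 < s) (by linarith)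
  have st1 : uIcc 0 p ⊆ uIcc 0 t := by
    rw [uIcc_of_le hp.le, uIcc_of_le (by linarith)]; exact Icc_subset_Icc_right (by linarith)
  have st2 : uIcc p t ⊆ uIcc 0 t := by
    rw [uIcc_of_le (by linarith), uIcc_of_le (by linarith)]; exact Icc_subset_Icc_left hp.le
  have ss1 : uIcc 0 p ⊆ uIcc 0 s := by
    rw [uIcc_of_le hp.le, uIcc_of_le (by linarith)]; exact Icc_subset_Icc_right (by linarith)
  have ss2 : uIcc p s ⊆ uIcc 0 s := by
    rw [uIcc_of_le (by linarith), uIcc_of_le (by linarith)]; exact Icc_subset_Icc_left hp.le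
  have et := intervalIntegral.integral_add_adjacent_intervals (it.mono_set st1) (it.mono_set st2)
  have es := intervalIntegral.integral_add_adjacent_intervals (is.mono_set ss1) (is.mono_set ss2)
  have icst : IntervalIntegrable (fun r => A (t - r) (F s - F t)) volume 0 p := by
    refine ContinuousOn.intervalIntegrable ?_
    refine ContinuousOn.clm_apply (hP.continuousOn.comp (by fun_prop) fun r hr => ?_)
      continuousOn_const
    rw [uIcc_of_le hp.le] at hr
    have := hr.2
    simp only [mem_Ioi, sub_pos]
    linarith
  have e1 : ∫ r in (0 : ℝ)..p, A (t - r) (F s - F t) =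
      κ • (e t (F s - F t) - e (t - p) (F s - F t)) := by
    rw [← hP.integral_eq (t - p) t (by linarith) (by linarith),
      intervalIntegral.integral_comp_sub_left (fun r => A r (F s - F t)) t, sub_zero]
  have e2 : ∫ r in (0 : ℝ)..p, (A (t - r) (F r - F s) - A (s - r) (F r - F s)) =
      (∫ r in (0 : ℝ)..p, A (t - r) (F r - F t)) - (∫ r in (0 : ℝ)..p, A (t - r) (F s - F t)) -
      ∫ r in (0 : ℝ)..p, A (s - r) (F r - F s) := by
    rw [← intervalIntegral.integral_sub (it.mono_set st1) icst,
      ← intervalIntegral.integral_sub ((it.mono_set st1).sub icst) (is.mono_set ss1)]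
    refine intervalIntegral.integral_congr fun r _ => ?_
    simp only [map_sub]
    abel
  rw [e2, e1, duhamel, duhamel, ← et, ← es]
  simp only [map_sub, smul_add, smul_sub]
  abel

/-- The constant in the Hölder estimate for the Duhamel integral. -/
def duhamelConst (c κ α σ : ℝ) : ℝ :=
  c * (12 / α + 12 / (1 - (σ + α)) + 2 / (1 / 2 - α)) + 8 * κ

lemma rpow_half_mul_le {h s : ℝ} (hh : 0 < h) (hhs : h ≤ s) {α : ℝ} (hα : α ≤ 1 / 2) :
    h ^ (1 / 2 : ℝ) * s ^ (α - 1 / 2) ≤ h ^ α := by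
  have hs : 0 < s := hh.trans_le hhs
  have h1 : s ^ (α - 1 / 2) ≤ h ^ (α - 1 / 2) :=
    Real.rpow_le_rpow_of_nonpos hh hhs (by linarith)
  calc h ^ (1 / 2 : ℝ) * s ^ (α - 1 / 2) ≤ h ^ (1 / 2 : ℝ) * h ^ (α - 1 / 2) := by gcongr
    _ = h ^ α := by rw [← Real.rpow_add hh]; ring_nf

/-- For r ≥ s/2 the weight r^(-(σ+α)) is comparable with s^(-(σ+α)), and the Hölder bound on F alone
makes the kernel integrable. -/
lemma ParabolicPair.norm_near_le (hP : ParabolicPair c κ A e) (hF : WHolder α T σ K F)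
    (hα : 0 < α) (hσ : 0 ≤ σ) (hσα : σ + α < 1) (hK : 0 ≤ K) {p s t : ℝ}
    (hs : 0 < s) (hp : s / 2 ≤ p) (hpt : p < t) (htT : t < T) :
    ‖∫ r in p..t, A (t - r) (F r - F t)‖ ≤
      c * K * (2 * s ^ (-(σ + α)) * ((t - p) ^ α / α)) := by
  have hp0 : 0 < p := by linarith
  refine (norm_integral_le_of_bound (g := fun r => c * K * (2 * s ^ (-(σ + α)) *
    (t - r) ^ (-(1 - α)))) hpt.le ?_ fun r hr => ?_).trans (le_of_eq ?_)
  · exact ((intervalIntegrable_const_sub_rpow (by linarith) p t).const_mul _).const_mul _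
  · refine (hP.integrand_le hF (hp0.trans hr.1) hr.2 htT).trans ?_
    have h1 : r ^ (-(σ + α)) ≤ 2 * s ^ (-(σ + α)) :=
      (Real.rpow_le_rpow_of_nonpos (by linarith) (hp.trans hr.1.le) (by linarith)).trans
        (half_rpow_neg_le hs hσα.le)
    have h2 : 0 ≤ (t - r) ^ (-(1 - α)) := Real.rpow_nonneg (by linarith [hr.2]) _
    have h3 := mul_nonneg hP.c_nonneg hK
    gcongr
  · rw [intervalIntegral.integral_const_mul, intervalIntegral.integral_const_mul,
      integral_const_sub_rpow (by linarith), sub_self]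
    have e2 : -(1 - α) + 1 = α := by ring
    rw [e2, Real.zero_rpow hα.ne', sub_zero]

/-- At distance at least h from s the kernel difference gains h^(1/2) (s-r)^(-3/2). Together with
the Hölder factor (s-r)^α this integrates to h^(1/2) h^(α-1/2) = h^α, which needs α < 1/2. The
singularity at r = 0 is integrated separately. -/
lemma ParabolicPair.norm_far_le (hP : ParabolicPair c κ A e) (hF : WHolder α T σ K F)
    (hα : 0 < α) (hα1 : α < 1 / 2) (hσ : 0 ≤ σ) (hσα : σ + α < 1) (hK : 0 ≤ K) {s h : ℝ}
    (hh : 0 < h) (hhs : h ≤ s / 2) (hsT : s < T) :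
    ‖∫ r in (0 : ℝ)..(s - h), (A (s + h - r) (F r - F s) - A (s - r) (F r - F s))‖ ≤
      c * K * ((4 / (1 - (σ + α)) + 2 / (1 / 2 - α)) * (s ^ (-(σ + α)) * h ^ α)) := by
  have hs : 0 < s := by linarith
  have hp : 0 ≤ s - h := by linarith
  have hβ' : 0 < 1 - (σ + α) := by linarith
  have hα' : 0 < 1 / 2 - α := by linarith
  have i1 := intervalIntegrable_neg_rpow hσα 0 (s - h)
  have i2 : IntervalIntegrable (fun r => (s - r) ^ (-(3 / 2 - α))) volume 0 (s - h) := by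
    refine ContinuousOn.intervalIntegrable fun r hr => ?_
    rw [uIcc_of_le hp] at hr
    have : s - r ≠ 0 := by have := hr.2; linarith
    exact (ContinuousAt.rpow_const (by fun_prop) (Or.inl this)).continuousWithinAt
  refine (norm_integral_le_of_bound (g := fun r => c * K * h ^ (1 / 2 : ℝ) *
    ((s / 2) ^ (-(3 / 2 - α)) * r ^ (-(σ + α)) + (s / 2) ^ (-(σ + α)) *
    (s - r) ^ (-(3 / 2 - α)))) hp ?_ fun r hr => ?_).trans ?_
  · exact ((i1.const_mul _).add (i2.const_mul _)).const_mul _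
  · have hr1 := hr.1
    have hr2 := hr.2
    have e1 : s + h - r = (s - r) + h := by ring
    rw [e1]
    refine (hP.norm_sub_le _ (by linarith) h hh _).trans ?_
    have h1 := hF.holder r s hr1 (by linarith) hsT
    rw [norm_sub_rev] at h1
    have h2 : (s - r) ^ (-(3 / 2 - α)) = (s - r) ^ (-(3 / 2) : ℝ) * (s - r) ^ α := by
      rw [← Real.rpow_add (by linarith)]; ring_nf
    have h3 : 0 ≤ c * (h ^ (1 / 2 : ℝ) * (s - r) ^ (-(3 / 2) : ℝ)) :=
      mul_nonneg hP.c_nonneg (mul_nonneg (by positivity) (Real.rpow_nonneg (by linarith) _))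
    calc c * (h ^ (1 / 2 : ℝ) * (s - r) ^ (-(3 / 2) : ℝ)) * ‖F r - F s‖
        ≤ c * (h ^ (1 / 2 : ℝ) * (s - r) ^ (-(3 / 2) : ℝ)) *
          (K * (r ^ (-(σ + α)) * (s - r) ^ α)) := by gcongr
      _ = c * K * h ^ (1 / 2 : ℝ) * (r ^ (-(σ + α)) * (s - r) ^ (-(3 / 2 - α))) := by
          rw [h2]; ring
      _ ≤ _ := by
          have := mul_nonneg (mul_nonneg hP.c_nonneg hK) (Real.rpow_nonneg hh.le (1 / 2 : ℝ))
          exact mul_le_mul_of_nonneg_left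
            (rpow_mul_rpow_le hr1 (by linarith) (by linarith) (by linarith)) this
  · rw [intervalIntegral.integral_const_mul, intervalIntegral.integral_add (i1.const_mul _)
      (i2.const_mul _), intervalIntegral.integral_const_mul, intervalIntegral.integral_const_mul,
      mul_assoc (c * K)]
    refine mul_le_mul_of_nonneg_left ?_ (mul_nonneg hP.c_nonneg hK)
    have j1 : ∫ r in (0 : ℝ)..(s - h), r ^ (-(σ + α)) ≤ s ^ (1 - (σ + α)) / (1 - (σ + α)) := by
      rw [integral_rpow (Or.inl (by linarith))]
      have e1 : -(σ + α) + 1 = 1 - (σ + α) := by ring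
      rw [e1, Real.zero_rpow hβ'.ne', sub_zero]
      gcongr
      linarith
    have j2 : ∫ r in (0 : ℝ)..(s - h), (s - r) ^ (-(3 / 2 - α)) ≤
        h ^ (α - 1 / 2) / (1 / 2 - α) := by
      rw [intervalIntegral.integral_comp_sub_left (fun r => r ^ (-(3 / 2 - α))) s, sub_zero,
        sub_sub_cancel, integral_rpow]
      · have e1 : -(3 / 2 - α) + 1 = -(1 / 2 - α) := by ring
        have e2 : α - 1 / 2 = -(1 / 2 - α) := by ring
        rw [e1, e2, div_neg, ← neg_div, neg_sub]
        gcongr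
        linarith [Real.rpow_nonneg hs.le (-(1 / 2 - α))]
      · right
        refine ⟨by linarith, ?_⟩
        rw [uIcc_of_le (by linarith)]
        exact fun h0 => absurd h0.1 (not_le.2 hh)
    have k1 : (s / 2) ^ (-(3 / 2 - α)) ≤ 4 * s ^ (-(3 / 2 - α)) := by
      rw [half_rpow_neg hs]
      refine mul_le_mul_of_nonneg_right ?_ (Real.rpow_nonneg hs.le _)
      have := Real.rpow_le_rpow_of_exponent_le one_le_two (show 3 / 2 - α ≤ 2 by linarith)
      rw [Real.rpow_two] at this
      linarith
    have k2 : (s / 2) ^ (-(σ + α)) ≤ 2 * s ^ (-(σ + α)) := half_rpow_neg_le hs hσα.le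
    have m1 : s ^ (-(3 / 2 - α)) * s ^ (1 - (σ + α)) = s ^ (α - 1 / 2) * s ^ (-(σ + α)) := by
      rw [← Real.rpow_add hs, ← Real.rpow_add hs]; ring_nf
    have m2 : h ^ (1 / 2 : ℝ) * h ^ (α - 1 / 2) = h ^ α := by
      rw [← Real.rpow_add hh]; ring_nf
    have m3 := rpow_half_mul_le hh (by linarith : h ≤ s) hα1.le
    calc h ^ (1 / 2 : ℝ) * ((s / 2) ^ (-(3 / 2 - α)) * (∫ r in (0 : ℝ)..(s - h), r ^ (-(σ + α))) +
          (s / 2) ^ (-(σ + α)) * ∫ r in (0 : ℝ)..(s - h), (s - r) ^ (-(3 / 2 - α)))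
        ≤ h ^ (1 / 2 : ℝ) * (4 * s ^ (-(3 / 2 - α)) * (s ^ (1 - (σ + α)) / (1 - (σ + α))) +
          2 * s ^ (-(σ + α)) * (h ^ (α - 1 / 2) / (1 / 2 - α))) := by
          gcongr
          exact intervalIntegral.integral_nonneg hp fun r hr => Real.rpow_nonneg hr.1 _
          exact intervalIntegral.integral_nonneg hp fun r hr =>
            Real.rpow_nonneg (by linarith [hr.2]) _
      _ = 4 / (1 - (σ + α)) * (h ^ (1 / 2 : ℝ) * (s ^ (-(3 / 2 - α)) * s ^ (1 - (σ + α)))) +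
          2 / (1 / 2 - α) * (s ^ (-(σ + α)) * (h ^ (1 / 2 : ℝ) * h ^ (α - 1 / 2))) := by ring
      _ = 4 / (1 - (σ + α)) * ((h ^ (1 / 2 : ℝ) * s ^ (α - 1 / 2)) * s ^ (-(σ + α))) +
          2 / (1 / 2 - α) * (s ^ (-(σ + α)) * h ^ α) := by rw [m1, m2]; ring
      _ ≤ 4 / (1 - (σ + α)) * (h ^ α * s ^ (-(σ + α))) +
          2 / (1 / 2 - α) * (s ^ (-(σ + α)) * h ^ α) := by gcongr
      _ = _ := by ring

/-- The Duhamel integral maps weighted Hölder curves to weighted Hölder curves. -/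
theorem ParabolicPair.wHolder_duhamel (hP : ParabolicPair c κ A e) (hF : WHolder α T σ K F)
    (hα : 0 < α) (hα1 : α < 1 / 2) (hσ : 0 ≤ σ) (hσα : σ + α < 1) (hK : 0 ≤ K) :
    WHolder α T σ (duhamelConst c κ α σ * K) (duhamel κ A e F) := by
  have hβ' : 0 < 1 - (σ + α) := by linarith
  have hα' : 0 < 1 / 2 - α := by linarith
  have hc := hP.c_nonneg
  have hκ := hP.κ_nonneg
  have q1 : 0 ≤ c / α := by positivity
  have q2 : 0 ≤ c / (1 - (σ + α)) := by positivity
  have q3 : 0 ≤ c / (1 / 2 - α) := by positivity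
  -- The coefficients dominate both cases below: short steps cost 6, 4, 2 and 3 in this order, long
  -- steps 8, 8, 0 and 8.
  have hC : duhamelConst c κ α σ = 12 * (c / α) + 12 * (c / (1 - (σ + α))) +
      2 * (c / (1 / 2 - α)) + 8 * κ := by rw [duhamelConst]; ring
  have hsup : ∀ t, 0 < t → t < T → ‖duhamel κ A e F t‖ ≤
      (2 * (c / (1 - (σ + α))) + 2 * (c / α) + 2 * κ) * K * t ^ (-σ) := fun t ht htT =>
    (hP.norm_duhamel_le hF hα hσ hσα hK ht htT).trans (le_of_eq (by ring))
  refine ⟨fun t ht htT => (hsup t ht htT).trans ?_, fun s t hs hst htT => ?_⟩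
  · rw [hC]
    refine mul_le_mul_of_nonneg_right (mul_le_mul_of_nonneg_right ?_ hK) (Real.rpow_nonneg ht.le _)
    linarith
  set h := t - s with hh
  have hh0 : 0 < h := by simp only [hh]; linarith
  have hts : t = s + h := by simp [hh]
  have hX : 0 ≤ s ^ (-(σ + α)) * h ^ α := by positivity
  -- For h ≤ s/2 the times are compared through the splitting at p = s - h, which is at least s/2.
  -- For h > s/2 the bounds on the two values suffice, because s^α ≤ 2 h^α.
  rcases le_or_gt h (s / 2) with hhs | hhs
  · rw [hP.duhamel_sub_eq hF hα hσ hσα hK (p := s - h) (by linarith) (by linarith)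
      hst htT]
    have b1 := hP.norm_near_le hF hα hσ hσα hK hs (p := s - h) (by linarith)
      (by linarith : s - h < t) htT
    have b2 := hP.norm_near_le hF hα hσ hσα hK hs (p := s - h) (by linarith)
      (by linarith : s - h < s) (by linarith)
    have b3 := hP.norm_far_le hF hα hα1 hσ hσα hK hh0 hhs (by linarith)
    rw [← hts] at b3
    have e1 : t - (s - h) = 2 * h := by rw [hts]; ring
    have e2 : s - (s - h) = h := by ring
    rw [e1] at b1 ⊢
    rw [e2] at b2
    have b1' : (2 * h) ^ α ≤ 2 * h ^ α := by
      rw [Real.mul_rpow zero_le_two hh0.le]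
      exact mul_le_mul_of_nonneg_right (two_rpow_le_two (by linarith)) (by positivity)
    have b1'' : ‖∫ r in (s - h)..t, A (t - r) (F r - F t)‖ ≤
        4 * (c / α) * K * (s ^ (-(σ + α)) * h ^ α) := by
      refine b1.trans ?_
      calc c * K * (2 * s ^ (-(σ + α)) * ((2 * h) ^ α / α))
          ≤ c * K * (2 * s ^ (-(σ + α)) * ((2 * h ^ α) / α)) := by gcongr
        _ = _ := by ring
    have b4 : ‖e t (F s) - e s (F s)‖ ≤ K * (s ^ (-(σ + α)) * h ^ α) := by
      have := hP.norm_e_sub_le s hs h hh0 (F s)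
      rw [← hts] at this
      refine this.trans ?_
      have m1 : s ^ (-(1 / 2) : ℝ) * s ^ (-σ) = s ^ (α - 1 / 2) * s ^ (-(σ + α)) := by
        rw [← Real.rpow_add hs, ← Real.rpow_add hs]; ring_nf
      calc h ^ (1 / 2 : ℝ) * s ^ (-(1 / 2) : ℝ) * ‖F s‖
          ≤ h ^ (1 / 2 : ℝ) * s ^ (-(1 / 2) : ℝ) * (K * s ^ (-σ)) := by
            gcongr
            exact hF.bound s hs (by linarith)
        _ = K * (h ^ (1 / 2 : ℝ) * (s ^ (-(1 / 2) : ℝ) * s ^ (-σ))) := by ring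
        _ = K * ((h ^ (1 / 2 : ℝ) * s ^ (α - 1 / 2)) * s ^ (-(σ + α))) := by rw [m1]; ring
        _ ≤ K * (h ^ α * s ^ (-(σ + α))) := by
            gcongr
            exact rpow_half_mul_le hh0 (by linarith) hα1.le
        _ = _ := by ring
    have b5 : ‖(F s - F t) - e (2 * h) (F s - F t)‖ ≤ 2 * (K * (s ^ (-(σ + α)) * h ^ α)) := by
      have h1 := hF.holder s t hs hst htT
      rw [norm_sub_rev] at h1
      have h2 := hP.norm_e_le (2 * h) (by linarith) (F s - F t)
      linarith [_root_.norm_sub_le (F s - F t) (e (2 * h) (F s - F t))]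
    have b6 : ‖κ • ((e t (F s) - e s (F s)) + ((F s - F t) - e (2 * h) (F s - F t)))‖ ≤
        3 * κ * K * (s ^ (-(σ + α)) * h ^ α) := by
      rw [norm_smul, Real.norm_of_nonneg hκ]
      calc _ ≤ κ * (3 * (K * (s ^ (-(σ + α)) * h ^ α))) := by
            refine mul_le_mul_of_nonneg_left ((norm_add_le _ _).trans ?_) hκ
            linarith
        _ = _ := by ring
    have hsum := (norm_add_le _ _).trans (add_le_add ((norm_add_le _ _).trans
      (add_le_add ((_root_.norm_sub_le _ _).trans (add_le_add b1'' b2)) b3)) b6)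
    refine hsum.trans ?_
    rw [hC]
    have r1 : 0 ≤ (c / α) * K * (s ^ (-(σ + α)) * h ^ α) := by positivity
    have r2 : 0 ≤ (c / (1 - (σ + α))) * K * (s ^ (-(σ + α)) * h ^ α) := by positivity
    have r3 : 0 ≤ κ * K * (s ^ (-(σ + α)) * h ^ α) := by positivity
    have e3 : c * K * (2 * s ^ (-(σ + α)) * (h ^ α / α)) =
      2 * ((c / α) * K * (s ^ (-(σ + α)) * h ^ α)) := by ring
    have e4 : c * K * ((4 / (1 - (σ + α)) + 2 / (1 / 2 - α)) * (s ^ (-(σ + α)) * h ^ α)) =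
      4 * ((c / (1 - (σ + α))) * K * (s ^ (-(σ + α)) * h ^ α)) +
      2 * ((c / (1 / 2 - α)) * K * (s ^ (-(σ + α)) * h ^ α)) := by ring
    rw [e3, e4]
    nlinarith
  · have h1 := hsup s hs (by linarith)
    have h2 := hsup t (by linarith) htT
    have h3 : t ^ (-σ) ≤ s ^ (-σ) := Real.rpow_le_rpow_of_nonpos hs hst.le (by linarith)
    have h4 : s ^ (-σ) ≤ 2 * (s ^ (-(σ + α)) * h ^ α) := by
      have m1 : s ^ (-σ) = s ^ (-(σ + α)) * s ^ α := by rw [← Real.rpow_add hs]; ring_nf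
      have m2 : s ^ α ≤ 2 * h ^ α := by
        calc s ^ α ≤ (2 * h) ^ α := by gcongr; linarith
          _ ≤ 2 * h ^ α := by
            rw [Real.mul_rpow zero_le_two hh0.le]
            exact mul_le_mul_of_nonneg_right (two_rpow_le_two (by linarith)) (by positivity)
      rw [m1]
      nlinarith [Real.rpow_pos_of_pos hs (-(σ + α))]
    set D := (2 * (c / (1 - (σ + α))) + 2 * (c / α) + 2 * κ) * K with hD
    have hD0 : 0 ≤ D := by positivity
    calc ‖duhamel κ A e F t - duhamel κ A e F s‖ ≤ D * t ^ (-σ) + D * s ^ (-σ) :=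
          (_root_.norm_sub_le _ _).trans (add_le_add h2 h1)
      _ ≤ D * (2 * (s ^ (-(σ + α)) * h ^ α)) + D * (2 * (s ^ (-(σ + α)) * h ^ α)) := by
          gcongr
          exact h3.trans h4
      _ = (4 * D) * (s ^ (-(σ + α)) * h ^ α) := by ring
      _ ≤ _ := by
          refine mul_le_mul_of_nonneg_right ?_ hX
          rw [hC, hD]
          have : 0 ≤ K * (c / α) := by positivity
          have : 0 ≤ K * (c / (1 - (σ + α))) := by positivity
          have : 0 ≤ K * (c / (1 / 2 - α)) := by positivity
          nlinarith

end Duhamel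

lemma WHolder.intervalIntegrable {E : Type*} [NormedAddCommGroup E] {α T σ K : ℝ} {F : ℝ → E}
    (hF : WHolder α T σ K F) (hα : 0 < α) (hσ : 0 ≤ σ) (hσ1 : σ < 1)
    (hK : 0 ≤ K) {s t : ℝ} (hs : 0 ≤ s) (hst : s ≤ t) (htT : t ≤ T) :
    IntervalIntegrable F volume s t := by
  refine intervalIntegrable_of_bound hst ((hF.continuousOn hα hσ hK).mono
    (Ioo_subset_Ioo hs htT)) ((intervalIntegrable_neg_rpow hσ1 s t).const_mul K) fun r hr => ?_
  exact hF.bound r (hs.trans_lt hr.1) (hr.2.trans_le htT)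

end IsentropicNS

end

noncomputable section

open Filter Topology

namespace IsentropicNS

/-! ### The heat operators at viscosity `μ` and the initial layer -/

lemma sqrt_two_mul_mul_inv {μ s h : ℝ} (hμ : 0 < μ) (hs : 0 < s) (hh : 0 < h) :
    √(2 * μ * h) * (√(2 * μ * s))⁻¹ = h ^ (1 / 2 : ℝ) * s ^ (-(1 / 2) : ℝ) := by
  rw [Real.sqrt_mul (by positivity) h, Real.sqrt_mul (by positivity) s, mul_inv,
    Real.rpow_neg hs.le, ← Real.sqrt_eq_rpow, ← Real.sqrt_eq_rpow]
  have : √(2 * μ) ≠ 0 := by positivity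
  field_simp

lemma hasDerivAt_exp_neg_mul (q c : ℝ) (z : ℂ) (r : ℝ) :
    HasDerivAt (fun r : ℝ => (c * Real.exp (-(q * r)) : ℝ) * z)
      ((-(c * q) * Real.exp (-(q * r)) : ℝ) * z) r := by
  have h1 : HasDerivAt (fun r : ℝ => -(q * r)) (-q) r := by
    exact (((hasDerivAt_id r).const_mul q).neg).congr_deriv (by ring)
  have h2 := ((h1.exp.const_mul c).ofReal_comp).mul_const z
  refine h2.congr_deriv ?_
  push_cast
  ring

lemma continuousOn_hessHeat_mul {μ : ℝ} (hμ : 0 < μ) :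
    ContinuousOn (fun t => hessHeat (2 * μ * t)) (Ioi 0) :=
  continuousOn_hessHeat.comp (by fun_prop) fun t ht => by
    have : 0 < t := ht
    simp only [mem_Ioi]
    positivity

/-- The heat semigroup with viscosity `μ` and its second spatial derivative. -/
theorem parabolicPair_heat {μ : ℝ} (hμ : 0 < μ) :
    ParabolicPair (3 / μ) (1 / μ) (fun t => hessHeat (2 * μ * t)) (fun t => heat (2 * μ * t)) where
  c_nonneg := by positivity
  κ_nonneg := by positivity
  continuousOn := continuousOn_hessHeat_mul hμ
  norm_le t ht f := by
    refine (norm_hessHeat_le (by positivity) f).trans ?_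
    rw [Real.rpow_neg_one]
    refine mul_le_mul_of_nonneg_right ?_ (norm_nonneg _)
    rw [div_mul_eq_mul_div, div_le_div_iff₀ (by positivity) hμ]
    field_simp
    norm_num
  norm_sub_le t ht h hh f := by
    rw [mul_add]
    refine (norm_hessHeat_add_sub_le (by positivity) (by positivity) f).trans ?_
    rw [← mul_assoc, ← mul_assoc]
    refine mul_le_mul_of_nonneg_right ?_ (norm_nonneg _)
    have e1 : 2 * μ * t / 2 = μ * t := by ring
    have e2 : t ^ (-(3 / 2) : ℝ) = t ^ (-(1 / 2) : ℝ) * t⁻¹ := by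
      rw [← Real.rpow_neg_one t, ← Real.rpow_add ht]; norm_num
    have e3 : √(2 * μ * h) * (√(μ * t))⁻¹ = √2 * (h ^ (1 / 2 : ℝ) * t ^ (-(1 / 2) : ℝ)) := by
      rw [Real.rpow_neg ht.le, ← Real.sqrt_eq_rpow, ← Real.sqrt_eq_rpow,
        Real.sqrt_mul (by positivity), Real.sqrt_mul (by positivity), Real.sqrt_mul hμ.le]
      have : √μ ≠ 0 := by positivity
      field_simp
    rw [e1, e3, e2]
    -- The constant 3/μ is fixed here: √2 · 4/(2μ) ≤ 3/μ.
    have e4 : √2 ≤ 3 / 2 := by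
      rw [Real.sqrt_le_left (by norm_num)]; norm_num
    calc √2 * (h ^ (1 / 2 : ℝ) * t ^ (-(1 / 2) : ℝ)) * (4 / (2 * μ * t))
        ≤ 3 / 2 * (h ^ (1 / 2 : ℝ) * t ^ (-(1 / 2) : ℝ)) * (4 / (2 * μ * t)) := by gcongr
      _ = _ := by field_simp; ring
  norm_e_le t _ f := norm_heat_le _ f
  norm_e_sub_le t ht h hh f := by
    rw [mul_add, ← sqrt_two_mul_mul_inv hμ ht hh, mul_assoc (√(2 * μ * h))]
    exact norm_heat_add_sub_le (a := 2 * μ * t) (by positivity) (by positivity) f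
  integral_eq a b ha hab f := by
    have hc : IntervalIntegrable (fun r => hessHeat (2 * μ * r) f) volume a b := by
      refine ContinuousOn.intervalIntegrable ?_
      refine ContinuousOn.clm_apply ((continuousOn_hessHeat_mul hμ).mono fun r hr => ?_)
        continuousOn_const
      rw [uIcc_of_le hab] at hr
      exact lt_of_lt_of_le ha hr.1
    refine ext_fourierAt fun m => ?_
    rw [← ContinuousLinearMap.intervalIntegral_comp_comm _ hc]
    have h1 : ∀ r ∈ uIcc a b, fourierAt m (hessHeat (2 * μ * r) f) =
        ((-(1 / μ * (μ * m ^ 2)) * Real.exp (-(μ * m ^ 2 * r)) : ℝ) : ℂ) * fourierAt m f := by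
      intro r hr
      rw [uIcc_of_le hab] at hr
      have hr0 : 0 < r := ha.trans_le hr.1
      rw [fourierAt_hessHeat (by positivity)]
      have e1 : 2 * μ * r * m ^ 2 / 2 = μ * m ^ 2 * r := by ring
      have e2 : 1 / μ * (μ * m ^ 2) = m ^ 2 := by field_simp
      rw [e1, e2]
      push_cast
      ring
    rw [intervalIntegral.integral_congr h1, intervalIntegral.integral_eq_sub_of_hasDerivAt
      (fun r _ => hasDerivAt_exp_neg_mul (μ * m ^ 2) (1 / μ) (fourierAt m f) r)]
    · have hb : 0 < b := ha.trans_le hab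
      rw [map_smul, map_sub, fourierAt_heat (by positivity), fourierAt_heat (by positivity),
        Complex.real_smul]
      have e1 : ∀ r, 2 * μ * r * m ^ 2 / 2 = μ * m ^ 2 * r := fun r => by ring
      rw [e1, e1]
      push_cast
      ring
    · exact Continuous.intervalIntegrable (by fun_prop) _ _

/-- For h ≤ a the half-power bound is stronger than the claim since h/a ≤ 1 and α ≤ 1/2; for h ≥ a
the trivial bound 2‖f‖ is enough. -/
lemma norm_heat_add_sub_le_rpow {a h α : ℝ} (ha : 0 < a) (hh : 0 < h) (hα0 : 0 ≤ α)
    (hα : α ≤ 1 / 2) (f : L1) : ‖heat (a + h) f - heat a f‖ ≤ 2 * ((h / a) ^ α * ‖f‖) := by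
  rcases le_total h a with hle | hle
  · refine (norm_heat_add_sub_le ha hh f).trans ?_
    rw [← mul_assoc, ← div_eq_mul_inv, ← Real.sqrt_div hh.le, Real.sqrt_eq_rpow]
    have : (h / a) ^ (1 / 2 : ℝ) ≤ (h / a) ^ α :=
      Real.rpow_le_rpow_of_exponent_ge (by positivity) ((div_le_one ha).2 hle) hα
    have h3 : 0 ≤ (h / a) ^ α * ‖f‖ := by positivity
    nlinarith [norm_nonneg f]
  · have h1 : 1 ≤ (h / a) ^ α := Real.one_le_rpow ((one_le_div ha).2 hle) hα0
    have h2 := norm_sub_le (heat (a + h) f) (heat a f)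
    nlinarith [norm_heat_le (a + h) f, norm_heat_le a f, norm_nonneg f]

/-- Every translation difference of the curve `F` is a weighted Hölder curve: the time-weighted
Hölder norm of `F` with values in `BV`. -/
def WHolderBV (α T σ K : ℝ) (F : ℝ → L1) : Prop :=
  ∀ h > 0, WHolder α T σ (K * h) fun t => translate h (F t) - F t

lemma WHolderBV.hasBV {α T σ K : ℝ} {F : ℝ → L1} (hF : WHolderBV α T σ K F) {s : ℝ} (hs : 0 < s)
    (hsT : s < T) : HasBV (K * s ^ (-σ)) (F s) := fun h hh => by
  refine ((hF h hh).bound s hs hsT).trans (le_of_eq (by ring))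

lemma WHolderBV.hasBV_sub {α T σ K : ℝ} {F : ℝ → L1} (hF : WHolderBV α T σ K F) {s t : ℝ}
    (hs : 0 < s) (hst : s < t) (htT : t < T) :
    HasBV (K * (s ^ (-(σ + α)) * (t - s) ^ α)) (F t - F s) := fun h hh => by
  rw [map_sub, sub_sub_sub_comm]
  refine ((hF h hh).holder s t hs hst htT).trans (le_of_eq (by ring))

lemma WHolderBV.of_hasBV {α T σ K : ℝ} {F : ℝ → L1}
    (h1 : ∀ s, 0 < s → s < T → HasBV (K * s ^ (-σ)) (F s))
    (h2 : ∀ s t, 0 < s → s < t → t < T →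
      HasBV (K * (s ^ (-(σ + α)) * (t - s) ^ α)) (F t - F s)) : WHolderBV α T σ K F := by
  refine fun h hh => ⟨fun s hs hsT => (h1 s hs hsT h hh).trans (le_of_eq (by ring)),
    fun s t hs hst htT => ?_⟩
  have := h2 s t hs hst htT h hh
  rw [map_sub, sub_sub_sub_comm] at this
  exact this.trans (le_of_eq (by ring))

/-- The constant in the estimate of the initial layer. -/
def layerConst (μ γ : ℝ) : ℝ :=
  36 * ((2 * μ) ^ (γ - 1 / 2) + μ ^ (γ - 1 / 2) + μ ^ (γ - 1) + (μ / 2) ^ (γ - 1))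

lemma layerConst_pos {μ γ : ℝ} (hμ : 0 < μ) : 0 < layerConst μ γ := by
  rw [layerConst]; positivity

/-! ### The linear flow of the initial velocity -/

section InitialLayer

variable {μ γ α T : ℝ} {u : L1}

/-- The `Ẇ^{2γ,1}` seminorm in terms of translations. -/
def translateNorm (γ : ℝ) (u : L1) : ℝ :=
  ∫ y : ℝ, |y| ^ (-(1 + 2 * γ)) * ‖translate y u - u‖

lemma translateNorm_nonneg (γ : ℝ) (u : L1) : 0 ≤ translateNorm γ u :=
  integral_nonneg fun y => by positivity

lemma norm_hessHeat_le_of_sobolev {a : ℝ} (ha : 0 < a) (h0 : 0 ≤ γ) (hγ : γ ≤ 1)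
    (hu : Integrable fun y : ℝ => |y| ^ (-(1 + 2 * γ)) * ‖translate y u - u‖) :
    ‖hessHeat a u‖ ≤ 9 * (a / 2) ^ (γ - 1) * translateNorm γ u := by
  have ha2 : 0 < a / 2 := by positivity
  refine (norm_gradHeat_le ha2 _).trans ?_
  have h1 := norm_gradHeat_le_of_sobolev ha2 h0 hγ u hu
  have e : (a / 2) ^ (γ - 1) = (√(a / 2))⁻¹ * (a / 2) ^ (γ - 1 / 2) := by
    rw [Real.sqrt_eq_rpow, ← Real.rpow_neg ha2.le, ← Real.rpow_add ha2]; ring_nf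
  calc (√(a / 2))⁻¹ * ‖gradHeat (a / 2) u‖
      ≤ (√(a / 2))⁻¹ * (9 * (a / 2) ^ (γ - 1 / 2) * translateNorm γ u) := by
        gcongr
        exact h1
    _ = _ := by rw [e]; ring

lemma two_mul_div_rpow_le {μ s h α : ℝ} (hμ : 0 < μ) (hs : 0 < s) (hh : 0 < h) (hα : α ≤ 1) :
    (2 * μ * h / (μ * s)) ^ α ≤ 2 * (s ^ (-α) * h ^ α) := by
  have e : 2 * μ * h / (μ * s) = 2 * (h / s) := by field_simp
  rw [e, Real.mul_rpow zero_le_two (by positivity), Real.div_rpow hh.le hs.le, Real.rpow_neg hs.le]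
  have : 0 ≤ h ^ α / s ^ α := by positivity
  calc (2 : ℝ) ^ α * (h ^ α / s ^ α) ≤ 2 * (h ^ α / s ^ α) := by
        gcongr
        exact two_rpow_le_two hα
    _ = _ := by rw [div_eq_inv_mul]

/-- The weight 1/2 - γ is the smoothing rate on W^{2γ,1}. For the Hölder part both times are written
as heat flows of the gradient at parameter μs, half of 2μs; 36 = 2 · 2 · 9 collects the
interpolation, the ratio of times and the kernel bound. -/
lemma wHolder_gradHeat (hμ : 0 < μ) (hα0 : 0 ≤ α) (hα : α ≤ 1 / 2) (h0 : 0 ≤ γ) (hγ : γ ≤ 1)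
    (hu : Integrable fun y : ℝ => |y| ^ (-(1 + 2 * γ)) * ‖translate y u - u‖) :
    WHolder α T (1 / 2 - γ) (layerConst μ γ * translateNorm γ u)
      fun t => gradHeat (2 * μ * t) u := by
  have hS := translateNorm_nonneg γ u
  have p1 : 0 ≤ (2 * μ) ^ (γ - 1 / 2) := by positivity
  have p2 : 0 ≤ μ ^ (γ - 1 / 2) := by positivity
  have p3 : 0 ≤ μ ^ (γ - 1) := by positivity
  have p4 : 0 ≤ (μ / 2) ^ (γ - 1) := by positivity
  refine ⟨fun t ht _ => ?_, fun s t hs hst _ => ?_⟩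
  · refine (norm_gradHeat_le_of_sobolev (by positivity) h0 hγ u hu).trans ?_
    rw [Real.mul_rpow (by positivity) ht.le, neg_sub, ← translateNorm]
    calc 9 * ((2 * μ) ^ (γ - 1 / 2) * t ^ (γ - 1 / 2)) * translateNorm γ u
        = 9 * (2 * μ) ^ (γ - 1 / 2) * (translateNorm γ u * t ^ (γ - 1 / 2)) := by ring
      _ ≤ layerConst μ γ * (translateNorm γ u * t ^ (γ - 1 / 2)) := by
        gcongr
        rw [layerConst]
        linarith
      _ = _ := by ring
  · have hh : 0 < t - s := by linarith
    have e1 : gradHeat (2 * μ * t) u = heat (μ * s + 2 * μ * (t - s)) (gradHeat (μ * s) u) := by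
      rw [← heat_gradHeat (by positivity) (by positivity)]; ring_nf
    have e2 : gradHeat (2 * μ * s) u = heat (μ * s) (gradHeat (μ * s) u) := by
      rw [← heat_gradHeat (by positivity) (by positivity)]; ring_nf
    simp only [e1, e2]
    refine (norm_heat_add_sub_le_rpow (by positivity) (by positivity) hα0 hα _).trans ?_
    have h1 := norm_gradHeat_le_of_sobolev (a := μ * s) (by positivity) h0 hγ u hu
    rw [Real.mul_rpow hμ.le hs.le, ← translateNorm] at h1
    have h2 := two_mul_div_rpow_le hμ hs hh (by linarith : α ≤ 1)
    have e3 : s ^ (-(1 / 2 - γ + α)) = s ^ (-α) * s ^ (γ - 1 / 2) := by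
      rw [← Real.rpow_add hs]; ring_nf
    calc 2 * ((2 * μ * (t - s) / (μ * s)) ^ α * ‖gradHeat (μ * s) u‖)
        ≤ 2 * (2 * (s ^ (-α) * (t - s) ^ α) *
          (9 * (μ ^ (γ - 1 / 2) * s ^ (γ - 1 / 2)) * translateNorm γ u)) := by gcongr
      _ = 36 * μ ^ (γ - 1 / 2) * (translateNorm γ u * (s ^ (-(1 / 2 - γ + α)) * (t - s) ^ α)) := by
        rw [e3]; ring
      _ ≤ layerConst μ γ * (translateNorm γ u * (s ^ (-(1 / 2 - γ + α)) * (t - s) ^ α)) := by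
        gcongr
        rw [layerConst]
        linarith
      _ = _ := by ring

lemma IsFourierDeriv.sub {f f' g g' : L1} (h : IsFourierDeriv f f') (h' : IsFourierDeriv g g') :
    IsFourierDeriv (f - g) (f' - g') := fun m => by
  rw [map_sub, map_sub, h m, h' m]; ring

lemma HasBV.mono {K K' : ℝ} {f : L1} (h : HasBV K f) (hK : K ≤ K') : HasBV K' f := fun y hy =>
  (h y hy).trans (by gcongr)

/-- The variation of a gradient is bounded by the L¹ norm of the second derivative, so the argument
of `wHolder_gradHeat` applies to `hessHeat`, with an extra factor of order t^(-1/2). -/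
lemma wHolderBV_gradHeat (hμ : 0 < μ) (hα0 : 0 ≤ α) (hα : α ≤ 1 / 2) (h0 : 0 ≤ γ) (hγ : γ ≤ 1)
    (hu : Integrable fun y : ℝ => |y| ^ (-(1 + 2 * γ)) * ‖translate y u - u‖) :
    WHolderBV α T (1 - γ) (layerConst μ γ * translateNorm γ u)
      fun t => gradHeat (2 * μ * t) u := by
  have hS := translateNorm_nonneg γ u
  have p1 : 0 ≤ (2 * μ) ^ (γ - 1 / 2) := by positivity
  have p2 : 0 ≤ μ ^ (γ - 1 / 2) := by positivity
  have p3 : 0 ≤ μ ^ (γ - 1) := by positivity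
  have p4 : 0 ≤ (μ / 2) ^ (γ - 1) := by positivity
  refine WHolderBV.of_hasBV (fun t ht _ => ?_) fun s t hs hst _ => ?_
  · refine (isFourierDeriv_gradHeat (by positivity) u).hasBV.mono ?_
    refine (norm_hessHeat_le_of_sobolev (by positivity) h0 hγ hu).trans ?_
    have e1 : 2 * μ * t / 2 = μ * t := by ring
    rw [e1, Real.mul_rpow hμ.le ht.le, neg_sub]
    calc 9 * (μ ^ (γ - 1) * t ^ (γ - 1)) * translateNorm γ u
        = 9 * μ ^ (γ - 1) * (translateNorm γ u * t ^ (γ - 1)) := by ring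
      _ ≤ layerConst μ γ * (translateNorm γ u * t ^ (γ - 1)) := by
        gcongr
        rw [layerConst]
        linarith
      _ = _ := by ring
  · have hh : 0 < t - s := by linarith
    have ht : 0 < t := by linarith
    refine ((isFourierDeriv_gradHeat (a := 2 * μ * t) (by positivity) u).sub
      (isFourierDeriv_gradHeat (a := 2 * μ * s) (by positivity) u)).hasBV.mono ?_
    have e1 : hessHeat (2 * μ * t) u = heat (μ * s + 2 * μ * (t - s)) (hessHeat (μ * s) u) := by
      rw [← heat_hessHeat (by positivity) (by positivity)]; ring_nf
    have e2 : hessHeat (2 * μ * s) u = heat (μ * s) (hessHeat (μ * s) u) := by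
      rw [← heat_hessHeat (by positivity) (by positivity)]; ring_nf
    rw [e1, e2]
    refine (norm_heat_add_sub_le_rpow (by positivity) (by positivity) hα0 hα _).trans ?_
    have h1 := norm_hessHeat_le_of_sobolev (a := μ * s) (by positivity) h0 hγ hu
    rw [mul_div_right_comm, Real.mul_rpow (by positivity) hs.le] at h1
    have h2 := two_mul_div_rpow_le hμ hs hh (by linarith : α ≤ 1)
    have e3 : s ^ (-(1 - γ + α)) = s ^ (-α) * s ^ (γ - 1) := by
      rw [← Real.rpow_add hs]; ring_nf
    calc 2 * ((2 * μ * (t - s) / (μ * s)) ^ α * ‖hessHeat (μ * s) u‖)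
        ≤ 2 * (2 * (s ^ (-α) * (t - s) ^ α) *
          (9 * ((μ / 2) ^ (γ - 1) * s ^ (γ - 1)) * translateNorm γ u)) := by gcongr
      _ = 36 * (μ / 2) ^ (γ - 1) * (translateNorm γ u * (s ^ (-(1 - γ + α)) * (t - s) ^ α)) := by
        rw [e3]; ring
      _ ≤ layerConst μ γ * (translateNorm γ u * (s ^ (-(1 - γ + α)) * (t - s) ^ α)) := by
        gcongr
        rw [layerConst]
        linarith
      _ = _ := by ring

end InitialLayer

/-! ### The Sobolev norm in terms of translations -/

lemma homSobolevNorm_congr {s : ℝ} {f g : ℝ → ℝ} (h : f =ᵐ[volume] g) :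
    homSobolevNorm s f = homSobolevNorm s g := by
  refine lintegral_congr_ae ?_
  filter_upwards [h] with x hx
  refine lintegral_congr_ae ?_
  filter_upwards [h] with y hy
  rw [hx, hy]

/-- Substituting y ↦ x + y and exchanging the integrals turns the Gagliardo double integral into an
average of translation differences, the form in which the Gaussian averages meet it. -/
lemma homSobolevNorm_eq (γ : ℝ) (u : L1) :
    homSobolevNorm (2 * γ) u =
      ∫⁻ y : ℝ, ENNReal.ofReal (|y| ^ (-(1 + 2 * γ)) * ‖translate y u - u‖) := by
  have hm : Measurable u := (Lp.stronglyMeasurable u).measurable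
  have h1 : homSobolevNorm (2 * γ) u =
      ∫⁻ x, ∫⁻ y, ENNReal.ofReal (|y| ^ (-(1 + 2 * γ)) * |u (x + y) - u x|) := by
    refine lintegral_congr fun x => ?_
    rw [← lintegral_add_left_eq_self _ x]
    refine lintegral_congr fun y => ?_
    rw [abs_sub_comm, sub_add_cancel_left, abs_neg, Real.rpow_neg (abs_nonneg y), div_eq_inv_mul]
  rw [h1, lintegral_lintegral_swap]
  · refine lintegral_congr fun y => ?_
    rw [norm_translate_sub, ← integral_const_mul, ofReal_integral_eq_lintegral_ofReal]
    · exact (integrable_translate_sub y u).abs.const_mul _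
    · exact Eventually.of_forall fun x => by positivity
  · refine Measurable.aemeasurable ?_
    simp only [Function.uncurry_def]
    fun_prop

lemma integrable_translateNorm {γ M : ℝ} {u : L1}
    (h : homSobolevNorm (2 * γ) u ≤ ENNReal.ofReal M) :
    Integrable fun y : ℝ => |y| ^ (-(1 + 2 * γ)) * ‖translate y u - u‖ := by
  rw [homSobolevNorm_eq] at h
  refine ⟨?_, ?_⟩
  · have h1 : Measurable fun y : ℝ => |y| ^ (-(1 + 2 * γ)) := by fun_prop
    have h2 : Continuous fun y : ℝ => ‖translate y u - u‖ :=
      ((continuous_translate u).sub continuous_const).norm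
    exact (h1.mul h2.measurable).aestronglyMeasurable
  · rw [hasFiniteIntegral_iff_ofReal (Eventually.of_forall fun y => by positivity)]
    exact h.trans_lt ENNReal.ofReal_lt_top

lemma translateNorm_le {γ M : ℝ} {u : L1} (hM : 0 ≤ M)
    (h : homSobolevNorm (2 * γ) u ≤ ENNReal.ofReal M) : translateNorm γ u ≤ M := by
  have hi := integrable_translateNorm h
  rw [homSobolevNorm_eq, ← ofReal_integral_eq_lintegral_ofReal hi
    (Eventually.of_forall fun y => by positivity)] at h
  exact (ENNReal.ofReal_le_ofReal_iff hM).1 h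

end IsentropicNS

end

noncomputable section

open Filter Topology

namespace IsentropicNS

/-! ### The Duhamel operator on `L¹` -/

section DuhamelL1

variable {μ α T σ K K' σ' : ℝ} {F G : ℝ → L1}

/-- The singular Duhamel integral of the heat flow with viscosity `μ`. -/
def heatDuhamel (μ : ℝ) (F : ℝ → L1) (t : ℝ) : L1 :=
  duhamel (1 / μ) (fun t => hessHeat (2 * μ * t)) (fun t => heat (2 * μ * t)) F t

/-- Translation difference as a continuous linear map. -/
def translateDiff (h : ℝ) : L1 →L[ℝ] L1 :=
  (translate h).toContinuousLinearMap - ContinuousLinearMap.id ℝ L1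

lemma translateDiff_apply (h : ℝ) (f : L1) : translateDiff h f = translate h f - f := rfl

/-- Since the heat operators commute with translations, the BV theory of the Duhamel integral is the
L¹ theory applied to each translation difference. -/
lemma translateDiff_heatDuhamel (hμ : 0 < μ) (hF : WHolder α T σ K F)
    (hα : 0 < α) (hσ : 0 ≤ σ) (hσα : σ + α < 1) (hK : 0 ≤ K) (h : ℝ) {t : ℝ} (ht : 0 < t)
    (htT : t < T) :
    translateDiff h (heatDuhamel μ F t) = heatDuhamel μ (fun t => translateDiff h (F t)) t := by
  have hP := parabolicPair_heat hμ
  have hi := hP.intervalIntegrable hF hα hσ hσα hK ht htT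
  rw [heatDuhamel, heatDuhamel, duhamel, duhamel, map_add, map_smul,
    ← ContinuousLinearMap.intervalIntegral_comp_comm _ hi]
  congr 1
  · refine intervalIntegral.integral_congr_ae ?_
    have hne : ∀ᵐ r : ℝ, r ≠ t := by simp [ae_iff]
    filter_upwards [hne] with r hr hr2
    rw [uIoc_of_le ht.le] at hr2
    have : 0 < t - r := sub_pos.2 (lt_of_le_of_ne hr2.2 hr)
    simp only [translateDiff_apply, map_sub, hessHeat_translate (by positivity : 0 < 2 * μ * (t - r))]
  · simp only [translateDiff_apply, map_sub, heat_translate (by positivity : 0 < 2 * μ * t)]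

/-- The L¹ hypothesis, with its own exponent and constant, serves only to make the Duhamel integral
converge; it does not enter the resulting constant. -/
lemma WHolderBV.heatDuhamel (hμ : 0 < μ) (hF : WHolder α T σ' K' F) (hFB : WHolderBV α T σ K F)
    (hα : 0 < α) (hα1 : α < 1 / 2) (hσ : 0 ≤ σ) (hσα : σ + α < 1) (hK : 0 ≤ K)
    (hσ' : 0 ≤ σ') (hσα' : σ' + α < 1) (hK' : 0 ≤ K') :
    WHolderBV α T σ (duhamelConst (3 / μ) (1 / μ) α σ * K) (heatDuhamel μ F) := by
  intro h hh
  have h1 := (parabolicPair_heat hμ).wHolder_duhamel (hFB h hh) hα hα1 hσ hσα (by positivity)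
  have h2 : ∀ t, 0 < t → t < T → translate h (IsentropicNS.heatDuhamel μ F t) -
      IsentropicNS.heatDuhamel μ F t = duhamel (1 / μ) (fun t => hessHeat (2 * μ * t))
        (fun t => heat (2 * μ * t)) (fun t => translate h (F t) - F t) t := fun t ht htT =>
    translateDiff_heatDuhamel hμ hF hα hσ' hσα' hK' h ht htT
  rw [mul_assoc]
  refine ⟨fun s hs hsT => ?_, fun s t hs hst htT => ?_⟩
  · rw [h2 s hs hsT]
    exact h1.bound s hs hsT
  · rw [h2 s hs (hst.trans htT), h2 t (hs.trans hst) htT]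
    exact h1.holder s t hs hst htT

lemma heatDuhamel_sub (hμ : 0 < μ) (hF : WHolder α T σ K F) (hG : WHolder α T σ K G)
    (hα : 0 < α) (hσ : 0 ≤ σ) (hσα : σ + α < 1) (hK : 0 ≤ K) {t : ℝ} (ht : 0 < t) (htT : t < T) :
    heatDuhamel μ F t - heatDuhamel μ G t = heatDuhamel μ (fun t => F t - G t) t := by
  have hP := parabolicPair_heat hμ
  have hi := hP.intervalIntegrable hF hα hσ hσα hK ht htT
  have hj := hP.intervalIntegrable hG hα hσ hσα hK ht htT
  rw [heatDuhamel, heatDuhamel, heatDuhamel, duhamel, duhamel, duhamel, add_sub_add_comm,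
    ← intervalIntegral.integral_sub hi hj, ← smul_sub]
  congr 1
  · refine intervalIntegral.integral_congr fun r _ => ?_
    simp only [map_sub]
    abel
  · rw [map_sub]
    congr 1
    abel

/-- At a fixed frequency the symbol m² exp(-μm²(t-r)) is integrable up to r = t, so the subtraction
of F(t) can be undone: its integral cancels the closed-form boundary term exactly. -/
lemma fourierAt_heatDuhamel (hμ : 0 < μ) (hF : WHolder α T σ K F)
    (hα : 0 < α) (hσ : 0 ≤ σ) (hσα : σ + α < 1) (hK : 0 ≤ K) (m : ℝ) {t : ℝ} (ht : 0 < t)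
    (htT : t < T) :
    fourierAt m (heatDuhamel μ F t) =
      -m ^ 2 * ∫ r in (0 : ℝ)..t, (Real.exp (-(μ * m ^ 2 * (t - r))) : ℂ) * fourierAt m (F r) := by
  have hP := parabolicPair_heat hμ
  have hi := hP.intervalIntegrable hF hα hσ hσα hK ht htT
  have hFi := hF.intervalIntegrable hα hσ (by linarith) hK le_rfl ht.le htT.le
  have hg : IntervalIntegrable (fun r => (Real.exp (-(μ * m ^ 2 * (t - r))) : ℂ) *
      fourierAt m (F r)) volume 0 t := by
    refine IntervalIntegrable.continuousOn_mul ?_ (by fun_prop)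
    exact ⟨(fourierAt m).integrable_comp hFi.1, (fourierAt m).integrable_comp hFi.2⟩
  rw [heatDuhamel, duhamel, map_add, map_smul, ← ContinuousLinearMap.intervalIntegral_comp_comm _ hi]
  have h1 : ∫ r in (0 : ℝ)..t, fourierAt m (hessHeat (2 * μ * (t - r)) (F r - F t)) =
      ∫ r in (0 : ℝ)..t, ((-m ^ 2 : ℂ) * ((Real.exp (-(μ * m ^ 2 * (t - r))) : ℂ) *
        fourierAt m (F r)) + (m ^ 2 * Real.exp (-(μ * m ^ 2 * (t - r))) : ℝ) *
        fourierAt m (F t)) := by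
    refine intervalIntegral.integral_congr_ae ?_
    have hne : ∀ᵐ r : ℝ, r ≠ t := by simp [ae_iff]
    filter_upwards [hne] with r hr hr2
    rw [uIoc_of_le ht.le] at hr2
    have : 0 < t - r := sub_pos.2 (lt_of_le_of_ne hr2.2 hr)
    rw [fourierAt_hessHeat (by positivity), map_sub]
    have e1 : 2 * μ * (t - r) * m ^ 2 / 2 = μ * m ^ 2 * (t - r) := by ring
    rw [e1]
    push_cast
    ring
  have h2 : ∫ r in (0 : ℝ)..t, ((m ^ 2 * Real.exp (-(μ * m ^ 2 * (t - r))) : ℝ) : ℂ) *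
      fourierAt m (F t) = ((1 / μ) * (1 - Real.exp (-(μ * m ^ 2 * t))) : ℝ) * fourierAt m (F t) := by
    rw [intervalIntegral.integral_comp_sub_left
      (fun r => ((m ^ 2 * Real.exp (-(μ * m ^ 2 * r)) : ℝ) : ℂ) * fourierAt m (F t)) t]
    have e2 : ∀ r : ℝ, ((m ^ 2 * Real.exp (-(μ * m ^ 2 * r)) : ℝ) : ℂ) * fourierAt m (F t) =
        ((-(-(1 / μ) * (μ * m ^ 2)) * Real.exp (-(μ * m ^ 2 * r)) : ℝ) : ℂ) * fourierAt m (F t) := by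
      intro r
      have : -(-(1 / μ) * (μ * m ^ 2)) = m ^ 2 := by field_simp
      rw [this]
    simp only [e2]
    rw [intervalIntegral.integral_eq_sub_of_hasDerivAt
      (fun r _ => hasDerivAt_exp_neg_mul (μ * m ^ 2) (-(1 / μ)) (fourierAt m (F t)) r)]
    · simp only [sub_self, sub_zero, mul_zero, neg_zero, Real.exp_zero]
      push_cast
      ring
    · exact Continuous.intervalIntegrable (by fun_prop) _ _
  rw [h1, intervalIntegral.integral_add (hg.const_mul _)
    (Continuous.intervalIntegrable (by fun_prop) _ _), h2, intervalIntegral.integral_const_mul,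
    map_sub, fourierAt_heat (by positivity), Complex.real_smul]
  have e1 : 2 * μ * t * m ^ 2 / 2 = μ * m ^ 2 * t := by ring
  rw [e1]
  push_cast
  ring

end DuhamelL1

/-! ### Nonlinear functions of small density perturbations -/

/-- The interval `[-1/2, 1/2]` of admissible density perturbations. -/
abbrev smallInterval : Set ℝ := Icc (-(1 / 2)) (1 / 2)

/-- A bounded continuous function vanishing at `0` that is `C^{1,1}` on `[-1/2,1/2]`, in the form
of difference estimates. -/
structure SmoothNonlinearity (L : ℝ) (g : ℝ → ℝ) : Prop where
  nonneg : 0 ≤ L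
  continuous : Continuous g
  bound : ∀ z, |g z| ≤ L * |z|
  bound' : ∀ z, |g z| ≤ L
  lip : ∀ a ∈ smallInterval, ∀ b ∈ smallInterval, |g a - g b| ≤ L * |a - b|
  -- Increments in time of translation differences, and increments in time of differences of two
  -- solutions, are mixed second differences; this is where two derivatives of g are needed.
  four : ∀ a ∈ smallInterval, ∀ b ∈ smallInterval, ∀ c ∈ smallInterval, ∀ d ∈ smallInterval,
    |g a - g b - g c + g d| ≤ L * |(a - b) - (c - d)| + L * |c - d| * (|a - c| + |b - d|)

lemma SmoothNonlinearity.mono {L L' : ℝ} {g : ℝ → ℝ} (h : SmoothNonlinearity L g) (hL : L ≤ L') :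
    SmoothNonlinearity L' g where
  nonneg := h.nonneg.trans hL
  continuous := h.continuous
  bound z := (h.bound z).trans (by gcongr)
  bound' z := (h.bound' z).trans hL
  lip a ha b hb := (h.lip a ha b hb).trans (by gcongr)
  four a ha b hb c hc d hd := (h.four a ha b hb c hc d hd).trans (by gcongr)

/-- Projection of the real line to `[-1/2, 1/2]`. -/
def clamp (z : ℝ) : ℝ := max (-(1 / 2)) (min z (1 / 2))

lemma clamp_mem (z : ℝ) : clamp z ∈ smallInterval :=
  ⟨le_max_left _ _, max_le (by norm_num) (min_le_right _ _)⟩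

lemma clamp_of_mem {z : ℝ} (hz : z ∈ smallInterval) : clamp z = z := by
  rw [clamp, min_eq_left hz.2, max_eq_right hz.1]

lemma abs_clamp_le (z : ℝ) : |clamp z| ≤ |z| := by
  rw [clamp]
  rcases le_total z (1 / 2) with h | h
  · rw [min_eq_left h]
    rcases le_total (-(1 / 2)) z with h' | h'
    · rw [max_eq_right h']
    · rw [max_eq_left h', abs_neg, abs_of_pos (by norm_num), abs_of_nonpos (by linarith)]
      linarith
  · rw [min_eq_right h, max_eq_right (by norm_num), abs_of_pos (by norm_num),
      abs_of_pos (by linarith)]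
    exact h

lemma continuous_clamp : Continuous clamp := by unfold clamp; fun_prop

/-- The clamp makes the global bounds hold without changing g on the interval; the local estimates
are mean value inequalities for g and g', whose derivatives are bounded by compactness. -/
lemma exists_smoothNonlinearity {g g' g'' : ℝ → ℝ} (h0 : g 0 = 0)
    (hg : ∀ z ∈ smallInterval, HasDerivAt g (g' z) z)
    (hg' : ∀ z ∈ smallInterval, HasDerivAt g' (g'' z) z) (hg'' : ContinuousOn g'' smallInterval) :
    ∃ L, SmoothNonlinearity L (fun z => g (clamp z)) := by
  have hconv : Convex ℝ smallInterval := convex_Icc _ _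
  obtain ⟨L₁, hL₁⟩ := isCompact_Icc.exists_bound_of_continuousOn
    (fun z hz => (hg' z hz).continuousAt.continuousWithinAt : ContinuousOn g' smallInterval)
  obtain ⟨L₂, hL₂⟩ := isCompact_Icc.exists_bound_of_continuousOn hg''
  have hm0 : (0 : ℝ) ∈ smallInterval := ⟨by norm_num, by norm_num⟩
  have p1 : 0 ≤ L₁ := (norm_nonneg _).trans (hL₁ 0 hm0)
  have p2 : 0 ≤ L₂ := (norm_nonneg _).trans (hL₂ 0 hm0)
  have lip : ∀ a ∈ smallInterval, ∀ b ∈ smallInterval, |g a - g b| ≤ L₁ * |a - b| :=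
    fun a ha b hb => hconv.norm_image_sub_le_of_norm_hasDerivWithin_le
      (fun z hz => (hg z hz).hasDerivWithinAt) hL₁ hb ha
  have lip' : ∀ a ∈ smallInterval, ∀ b ∈ smallInterval, |g' a - g' b| ≤ L₂ * |a - b| :=
    fun a ha b hb => hconv.norm_image_sub_le_of_norm_hasDerivWithin_le
      (fun z hz => (hg' z hz).hasDerivWithinAt) hL₂ hb ha
  refine ⟨L₁ + L₂, by positivity, ?_, fun z => ?_, fun z => ?_, ?_, ?_⟩
  · refine ContinuousOn.comp_continuous (s := smallInterval)
      (fun z hz => (hg z hz).continuousAt.continuousWithinAt) continuous_clamp clamp_mem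
  · have := lip _ (clamp_mem z) 0 hm0
    rw [h0, sub_zero, sub_zero] at this
    have h2 := abs_clamp_le z
    calc |g (clamp z)| ≤ L₁ * |clamp z| := this
      _ ≤ (L₁ + L₂) * |z| := by gcongr; linarith
  · have := lip _ (clamp_mem z) 0 hm0
    rw [h0, sub_zero, sub_zero] at this
    have h2 : |clamp z| ≤ 1 / 2 := abs_le.2 (clamp_mem z)
    nlinarith
  · intro a ha b hb
    rw [clamp_of_mem ha, clamp_of_mem hb]
    refine (lip a ha b hb).trans ?_
    gcongr
    linarith
  · intro a ha b hb c hc d hd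
    rw [clamp_of_mem ha, clamp_of_mem hb, clamp_of_mem hc, clamp_of_mem hd]
    have mem : ∀ x ∈ smallInterval, ∀ y ∈ smallInterval, ∀ θ ∈ Icc (0 : ℝ) 1,
        y + θ * (x - y) ∈ smallInterval := fun x hx y hy θ hθ => by
      have := hconv hy hx (sub_nonneg.2 hθ.2) hθ.1 (by ring)
      simp only [smul_eq_mul] at this
      convert this using 1
      ring
    have hd' : ∀ x ∈ smallInterval, ∀ y ∈ smallInterval, ∀ θ ∈ Icc (0 : ℝ) 1,
        HasDerivAt (fun θ => g (y + θ * (x - y))) (g' (y + θ * (x - y)) * (x - y)) θ :=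
      fun x hx y hy θ hθ => by
        have h1 : HasDerivAt (fun θ => y + θ * (x - y)) (x - y) θ := by
          simpa using ((hasDerivAt_id θ).mul_const (x - y)).const_add y
        exact (hg _ (mem x hx y hy θ hθ)).comp θ h1
    -- The four-point estimate is the mean value inequality for the difference of g along the
    -- segments from b to a and from d to c.
    have key := (convex_Icc (0 : ℝ) 1).norm_image_sub_le_of_norm_hasDerivWithin_le
      (f := fun θ => g (b + θ * (a - b)) - g (d + θ * (c - d)))
      (C := (L₁ + L₂) * |(a - b) - (c - d)| + (L₁ + L₂) * |c - d| * (|a - c| + |b - d|))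
      (fun θ hθ => ((hd' a ha b hb θ hθ).sub (hd' c hc d hd θ hθ)).hasDerivWithinAt)
      (fun θ hθ => ?_) (left_mem_Icc.2 zero_le_one) (right_mem_Icc.2 zero_le_one)
    · simp only [one_mul, zero_mul, add_zero, add_sub_cancel, sub_zero, norm_one, mul_one] at key
      rw [Real.norm_eq_abs] at key
      refine le_trans (le_of_eq ?_) key
      congr 1
      ring
    · set p := b + θ * (a - b) with hp
      set q := d + θ * (c - d) with hq
      have hpm := mem a ha b hb θ hθ
      have hqm := mem c hc d hd θ hθ
      have e : g' p * (a - b) - g' q * (c - d) =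
          g' p * ((a - b) - (c - d)) + (g' p - g' q) * (c - d) := by ring
      have hpq : |p - q| ≤ |a - c| + |b - d| := by
        have : p - q = (1 - θ) * (b - d) + θ * (a - c) := by rw [hp, hq]; ring
        rw [this]
        refine (abs_add_le _ _).trans ?_
        rw [abs_mul, abs_mul, abs_of_nonneg hθ.1, abs_of_nonneg (sub_nonneg.2 hθ.2)]
        nlinarith [hθ.1, hθ.2, abs_nonneg (b - d), abs_nonneg (a - c)]
      rw [Real.norm_eq_abs, e]
      refine (abs_add_le _ _).trans ?_
      rw [abs_mul, abs_mul]
      have h1 : |g' p| ≤ L₁ := hL₁ p hpm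
      have h2 := lip' p hpm q hqm
      have h3 : |g' p - g' q| ≤ L₂ * (|a - c| + |b - d|) := h2.trans (by gcongr)
      calc |g' p| * |(a - b) - (c - d)| + |g' p - g' q| * |c - d|
          ≤ L₁ * |(a - b) - (c - d)| + L₂ * (|a - c| + |b - d|) * |c - d| := by gcongr
        _ ≤ (L₁ + L₂) * |(a - b) - (c - d)| + (L₁ + L₂) * (|a - c| + |b - d|) * |c - d| := by
          gcongr <;> linarith
        _ = _ := by ring

/-- The viscous nonlinearity `μ (1/(1+z) - 1)`. -/
def viscousPart (μ z : ℝ) : ℝ := μ * ((1 + z)⁻¹ - 1)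

/-- The pressure nonlinearity `A - A (1+z)^{-ν}`. -/
def pressurePart (A ν z : ℝ) : ℝ := A - A * (1 + z) ^ (-ν)

lemma exists_smoothNonlinearity_viscousPart (μ : ℝ) :
    ∃ L, SmoothNonlinearity L (fun z => viscousPart μ (clamp z)) := by
  have hp : ∀ z ∈ smallInterval, 1 + z ≠ 0 := fun z hz => by have := hz.1; linarith
  have h1 : ∀ z : ℝ, HasDerivAt (fun z : ℝ => 1 + z) 1 z := fun z => (hasDerivAt_id z).const_add 1
  refine exists_smoothNonlinearity (g' := fun z => -(μ * ((1 + z) ^ 2)⁻¹))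
    (g'' := fun z => 2 * μ * ((1 + z) ^ 3)⁻¹) (by simp [viscousPart]) (fun z hz => ?_)
    (fun z hz => ?_) ?_
  · refine (((h1 z).inv (hp z hz)).sub_const 1).const_mul μ |>.congr_deriv ?_
    ring
  · have h2 := hp z hz
    refine ((((h1 z).pow 2).inv (pow_ne_zero 2 h2)).const_mul μ).neg.congr_deriv ?_
    simp only [Pi.pow_apply]
    field_simp
    ring
  · intro z hz
    have := pow_ne_zero 3 (hp z hz)
    exact ContinuousAt.continuousWithinAt (by fun_prop (disch := exact this))

lemma exists_smoothNonlinearity_pressurePart (A ν : ℝ) :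
    ∃ L, SmoothNonlinearity L (fun z => pressurePart A ν (clamp z)) := by
  have hp : ∀ z ∈ smallInterval, 0 < 1 + z := fun z hz => by have := hz.1; linarith
  have h1 : ∀ z : ℝ, HasDerivAt (fun z : ℝ => 1 + z) 1 z := fun z => (hasDerivAt_id z).const_add 1
  refine exists_smoothNonlinearity (g' := fun z => A * ν * (1 + z) ^ (-ν - 1))
    (g'' := fun z => A * ν * (-ν - 1) * (1 + z) ^ (-ν - 1 - 1)) (by simp [pressurePart])
    (fun z hz => ?_) (fun z hz => ?_) ?_
  · refine (((h1 z).rpow_const (Or.inl (hp z hz).ne')).const_mul A).const_sub A |>.congr_deriv ?_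
    ring
  · refine ((h1 z).rpow_const (p := -ν - 1) (Or.inl (hp z hz).ne')).const_mul (A * ν)
      |>.congr_deriv ?_
    ring
  · intro z hz
    exact ContinuousAt.continuousWithinAt (continuousAt_const.mul
      (ContinuousAt.rpow_const (by fun_prop) (Or.inl (hp z hz).ne')))

end IsentropicNS

end

noncomputable section

open Filter Topology

namespace IsentropicNS

/-! ### The nonlinearity on `L¹` -/

lemma norm_le_of_ae_le {f f₁ f₂ f₃ f₄ f₅ : L1} {c₁ c₂ c₃ c₄ c₅ : ℝ}
    (h : ∀ᵐ x, |f x| ≤ c₁ * |f₁ x| + c₂ * |f₂ x| + c₃ * |f₃ x| + c₄ * |f₄ x| + c₅ * |f₅ x|) :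
    ‖f‖ ≤ c₁ * ‖f₁‖ + c₂ * ‖f₂‖ + c₃ * ‖f₃‖ + c₄ * ‖f₄‖ + c₅ * ‖f₅‖ := by
  have i : ∀ (c : ℝ) (g : L1), Integrable fun x => c * |g x| := fun c g =>
    (integrable_coe g).abs.const_mul c
  have hi := ((((i c₁ f₁).add (i c₂ f₂)).add (i c₃ f₃)).add (i c₄ f₄)).add (i c₅ f₅)
  simp only [norm_eq_integral]
  refine (integral_mono_ae (integrable_coe f).abs hi h).trans (le_of_eq ?_)
  have e₄ := integral_add ((((i c₁ f₁).add (i c₂ f₂)).add (i c₃ f₃)).add (i c₄ f₄)) (i c₅ f₅)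
  have e₃ := integral_add (((i c₁ f₁).add (i c₂ f₂)).add (i c₃ f₃)) (i c₄ f₄)
  have e₂ := integral_add ((i c₁ f₁).add (i c₂ f₂)) (i c₃ f₃)
  have e₁ := integral_add (i c₁ f₁) (i c₂ f₂)
  simp only [Pi.add_apply] at e₄ e₃ e₂
  simp only [Pi.add_apply]
  rw [e₄, e₃, e₂, e₁]
  simp only [integral_const_mul]

lemma norm_le_of_ae_le₃ {f f₁ f₂ f₃ : L1} {c₁ c₂ c₃ : ℝ}
    (h : ∀ᵐ x, |f x| ≤ c₁ * |f₁ x| + c₂ * |f₂ x| + c₃ * |f₃ x|) :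
    ‖f‖ ≤ c₁ * ‖f₁‖ + c₂ * ‖f₂‖ + c₃ * ‖f₃‖ := by
  have := norm_le_of_ae_le (f := f) (f₁ := f₁) (f₂ := f₂) (f₃ := f₃) (f₄ := f) (f₅ := f)
    (c₁ := c₁) (c₂ := c₂) (c₃ := c₃) (c₄ := 0) (c₅ := 0) (by simpa using h)
  simpa using this

section Nonlinearity

variable {L : ℝ} {φ ψ : ℝ → ℝ}

lemma SmoothNonlinearity.integrable (hφ : SmoothNonlinearity L φ) (hψ : SmoothNonlinearity L ψ)
    (V W : L1) : Integrable fun x => φ (V x) * W x + ψ (V x) := by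
  have hV := (integrable_coe V).aestronglyMeasurable
  refine Integrable.add ?_ ?_
  · exact (integrable_coe W).bdd_mul (c := L) (hφ.continuous.comp_aestronglyMeasurable hV)
      (Eventually.of_forall fun x => hφ.bound' _)
  · exact ((integrable_coe V).abs.const_mul L).mono' (hψ.continuous.comp_aestronglyMeasurable hV)
      (Eventually.of_forall fun x => hψ.bound _)

/-- The class in `L¹` of the function `φ(V) W + ψ(V)`. -/
def nonlin (φ ψ : ℝ → ℝ) (V W : L1) : L1 :=
  open Classical in
  if h : Integrable (fun x => φ (V x) * W x + ψ (V x)) volume then h.toL1 _ else 0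

lemma SmoothNonlinearity.nonlin_ae (hφ : SmoothNonlinearity L φ) (hψ : SmoothNonlinearity L ψ)
    (V W : L1) : nonlin φ ψ V W =ᵐ[volume] fun x => φ (V x) * W x + ψ (V x) := by
  have h := hφ.integrable hψ V W
  rw [nonlin, dif_pos h]
  exact h.coeFn_toL1

lemma SmoothNonlinearity.translate_nonlin (hφ : SmoothNonlinearity L φ)
    (hψ : SmoothNonlinearity L ψ) (h : ℝ) (V W : L1) :
    translate h (nonlin φ ψ V W) = nonlin φ ψ (translate h V) (translate h W) := by
  apply Lp.ext
  filter_upwards [translate_ae h (nonlin φ ψ V W), ae_comp_add h (hφ.nonlin_ae hψ V W),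
    hφ.nonlin_ae hψ (translate h V) (translate h W), translate_ae h V, translate_ae h W]
    with x h1 h2 h3 h4 h5
  rw [h1, h2, h3, h4, h5]

lemma ae_translate_abs_le {m : ℝ} (h : ℝ) {V : L1} (hV : ∀ᵐ x, |V x| ≤ m) :
    ∀ᵐ x, |translate h V x| ≤ m := by
  filter_upwards [translate_ae h V, ae_comp_add h hV] with x h1 h2
  rwa [h1]

lemma ae_mem_smallInterval {V : L1} (hV : ∀ᵐ x, |V x| ≤ 1 / 2) : ∀ᵐ x, V x ∈ smallInterval := by
  filter_upwards [hV] with x hx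
  exact abs_le.1 hx

variable {V V' Va Vb Vc Vd W W' Wa Wb Wc Wd : L1} {m n p q : ℝ}

lemma SmoothNonlinearity.norm_nonlin_le (hφ : SmoothNonlinearity L φ)
    (hψ : SmoothNonlinearity L ψ) (hm : ∀ᵐ x, |V x| ≤ m) :
    ‖nonlin φ ψ V W‖ ≤ L * m * ‖W‖ + L * ‖V‖ := by
  have hL := hφ.nonneg
  refine (norm_le_of_ae_le₃ (f₁ := W) (f₂ := V) (f₃ := 0) (c₁ := L * m) (c₂ := L) (c₃ := 0)
    ?_).trans (le_of_eq (by simp))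
  filter_upwards [hφ.nonlin_ae hψ V W, hm] with x h1 h2
  rw [h1]
  have h3 : |φ (V x)| ≤ L * m := (hφ.bound _).trans (by gcongr)
  calc |φ (V x) * W x + ψ (V x)| ≤ |φ (V x)| * |W x| + |ψ (V x)| := by
        rw [← abs_mul]; exact abs_add_le _ _
    _ ≤ L * m * |W x| + L * |V x| := by
        gcongr
        exact hψ.bound _
    _ = _ := by ring

/-- The sup norm is placed on W' and the L¹ norm on V - V'. This suits spatial increments and pairs
of solutions, where the L¹ difference of densities compensates the singular sup bound of the
gradient. -/
lemma SmoothNonlinearity.norm_nonlin_sub_le (hφ : SmoothNonlinearity L φ)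
    (hψ : SmoothNonlinearity L ψ) (hV : ∀ᵐ x, |V x| ≤ 1 / 2) (hV' : ∀ᵐ x, |V' x| ≤ 1 / 2)
    (hm : ∀ᵐ x, |V x| ≤ m) (hn : ∀ᵐ x, |W' x| ≤ n) :
    ‖nonlin φ ψ V W - nonlin φ ψ V' W'‖ ≤ L * m * ‖W - W'‖ + L * (n + 1) * ‖V - V'‖ := by
  have hL := hφ.nonneg
  refine (norm_le_of_ae_le₃ (f₁ := W - W') (f₂ := V - V') (f₃ := 0) (c₁ := L * m)
    (c₂ := L * (n + 1)) (c₃ := 0) ?_).trans (le_of_eq (by simp))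
  filter_upwards [hφ.nonlin_ae hψ V W, hφ.nonlin_ae hψ V' W', hm, hn, ae_mem_smallInterval hV,
    ae_mem_smallInterval hV', Lp.coeFn_sub (nonlin φ ψ V W) (nonlin φ ψ V' W'),
    Lp.coeFn_sub W W', Lp.coeFn_sub V V'] with x h1 h2 h3 h4 h5 h6 h7 h8 h9
  rw [h7, h8, h9, Pi.sub_apply, Pi.sub_apply, Pi.sub_apply, h1, h2]
  have e1 : φ (V x) * W x + ψ (V x) - (φ (V' x) * W' x + ψ (V' x)) =
      φ (V x) * (W x - W' x) + (φ (V x) - φ (V' x)) * W' x + (ψ (V x) - ψ (V' x)) := by ring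
  rw [e1]
  refine (abs_add_three _ _ _).trans ?_
  rw [abs_mul, abs_mul]
  have b1 : |φ (V x)| ≤ L * m := (hφ.bound _).trans (by gcongr)
  have b2 := hφ.lip _ h5 _ h6
  have b3 := hψ.lip _ h5 _ h6
  have hn0 : 0 ≤ n := (abs_nonneg _).trans h4
  calc |φ (V x)| * |W x - W' x| + |φ (V x) - φ (V' x)| * |W' x| + |ψ (V x) - ψ (V' x)|
      ≤ L * m * |W x - W' x| + L * |V x - V' x| * n + L * |V x - V' x| := by gcongr
    _ = _ := by ring

/-- For increments in time the sup norm is placed on V - V' and the L¹ norm on W, since the sup norm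
of W blows up like s^(-(1-γ)), too fast for the L¹ weight 1/2 - γ. -/
lemma SmoothNonlinearity.norm_nonlin_sub_le' (hφ : SmoothNonlinearity L φ)
    (hψ : SmoothNonlinearity L ψ) (hV : ∀ᵐ x, |V x| ≤ 1 / 2) (hV' : ∀ᵐ x, |V' x| ≤ 1 / 2)
    (hm : ∀ᵐ x, |V' x| ≤ m) (hp : ∀ᵐ x, |(V - V' : L1) x| ≤ p) :
    ‖nonlin φ ψ V W - nonlin φ ψ V' W'‖ ≤ L * p * ‖W‖ + L * m * ‖W - W'‖ + L * ‖V - V'‖ := by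
  have hL := hφ.nonneg
  refine norm_le_of_ae_le₃ (f₁ := W) (f₂ := W - W') (f₃ := V - V') ?_
  filter_upwards [hφ.nonlin_ae hψ V W, hφ.nonlin_ae hψ V' W', hm, hp, ae_mem_smallInterval hV,
    ae_mem_smallInterval hV', Lp.coeFn_sub (nonlin φ ψ V W) (nonlin φ ψ V' W'),
    Lp.coeFn_sub W W', Lp.coeFn_sub V V'] with x h1 h2 h3 h4 h5 h6 h7 h8 h9
  rw [h9, Pi.sub_apply] at h4
  rw [h7, h8, h9, Pi.sub_apply, Pi.sub_apply, Pi.sub_apply, h1, h2]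
  have e1 : φ (V x) * W x + ψ (V x) - (φ (V' x) * W' x + ψ (V' x)) =
      (φ (V x) - φ (V' x)) * W x + φ (V' x) * (W x - W' x) + (ψ (V x) - ψ (V' x)) := by ring
  rw [e1]
  refine (abs_add_three _ _ _).trans ?_
  rw [abs_mul, abs_mul]
  have b1 : |φ (V' x)| ≤ L * m := (hφ.bound _).trans (by gcongr)
  have b2 : |φ (V x) - φ (V' x)| ≤ L * p := (hφ.lip _ h5 _ h6).trans (by gcongr)
  have b3 := hψ.lip _ h5 _ h6
  gcongr

/-- The mixed difference is decomposed so that every term is small in both directions of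
differencing. The pairs (a,b), (c,d) are translated and original function at two times in the BV
bound, and two solutions at two times in the contraction. -/
lemma SmoothNonlinearity.norm_nonlin_four_le (hφ : SmoothNonlinearity L φ)
    (hψ : SmoothNonlinearity L ψ) (hVa : ∀ᵐ x, |Va x| ≤ 1 / 2) (hVb : ∀ᵐ x, |Vb x| ≤ 1 / 2)
    (hVc : ∀ᵐ x, |Vc x| ≤ 1 / 2) (hVd : ∀ᵐ x, |Vd x| ≤ 1 / 2)
    (hp : ∀ᵐ x, |(Va - Vc : L1) x| ≤ p) (hp' : ∀ᵐ x, |(Vb - Vd : L1) x| ≤ p)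
    (hm : ∀ᵐ x, |Vc x| ≤ m) (hn : ∀ᵐ x, |Wb x| ≤ n) (hq : ∀ᵐ x, |(Wb - Wd : L1) x| ≤ q) :
    ‖(nonlin φ ψ Va Wa - nonlin φ ψ Vb Wb) - (nonlin φ ψ Vc Wc - nonlin φ ψ Vd Wd)‖ ≤
      L * p * ‖Wa - Wb‖ + L * m * ‖(Wa - Wb) - (Wc - Wd)‖ +
      L * (n + 1) * ‖(Va - Vb) - (Vc - Vd)‖ + L * (2 * p * (n + 1) + q) * ‖Vc - Vd‖ := by
  have hL := hφ.nonneg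
  refine (norm_le_of_ae_le (f₁ := Wa - Wb) (f₂ := (Wa - Wb) - (Wc - Wd))
    (f₃ := (Va - Vb) - (Vc - Vd)) (f₄ := Vc - Vd) (f₅ := 0) (c₁ := L * p) (c₂ := L * m)
    (c₃ := L * (n + 1)) (c₄ := L * (2 * p * (n + 1) + q)) (c₅ := 0) ?_).trans (le_of_eq (by simp))
  filter_upwards [hφ.nonlin_ae hψ Va Wa, hφ.nonlin_ae hψ Vb Wb, hφ.nonlin_ae hψ Vc Wc,
    hφ.nonlin_ae hψ Vd Wd, hp, hp', hm, hn, hq, ae_mem_smallInterval hVa,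
    ae_mem_smallInterval hVb, ae_mem_smallInterval hVc, ae_mem_smallInterval hVd,
    Lp.coeFn_sub (nonlin φ ψ Va Wa - nonlin φ ψ Vb Wb) (nonlin φ ψ Vc Wc - nonlin φ ψ Vd Wd),
    Lp.coeFn_sub (nonlin φ ψ Va Wa) (nonlin φ ψ Vb Wb),
    Lp.coeFn_sub (nonlin φ ψ Vc Wc) (nonlin φ ψ Vd Wd), Lp.coeFn_sub Wa Wb, Lp.coeFn_sub Wc Wd,
    Lp.coeFn_sub (Wa - Wb) (Wc - Wd), Lp.coeFn_sub Va Vb, Lp.coeFn_sub Vc Vd,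
    Lp.coeFn_sub (Va - Vb) (Vc - Vd), Lp.coeFn_sub Va Vc, Lp.coeFn_sub Vb Vd, Lp.coeFn_sub Wb Wd]
    with x ha hb hc hd hp hp' hm hn hq ma mb mc md k1 k2 k3 k4 k5 k6 k7 k8 k9 k10 k11 k12
  simp only [k1, k2, k3, k4, k5, k6, k7, k8, k9, k10, k11, k12, Pi.sub_apply] at hp hp' hq ⊢
  rw [ha, hb, hc, hd]
  generalize Va x = a at *
  generalize Vb x = b at *
  generalize Vc x = c at *
  generalize Vd x = d at *
  generalize Wa x = A at *
  generalize Wb x = B at *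
  generalize Wc x = C at *
  generalize Wd x = D at *
  have e1 : φ a * A + ψ a - (φ b * B + ψ b) - (φ c * C + ψ c - (φ d * D + ψ d)) =
      (φ a - φ c) * (A - B) + φ c * ((A - B) - (C - D)) + (φ a - φ b - φ c + φ d) * B +
      (φ c - φ d) * (B - D) + (ψ a - ψ b - ψ c + ψ d) := by ring
  have b1 : |φ a - φ c| ≤ L * p := (hφ.lip a ma c mc).trans (by gcongr)
  have b2 : |φ c| ≤ L * m := (hφ.bound c).trans (by gcongr)
  have b3 : |φ a - φ b - φ c + φ d| ≤ L * |(a - b) - (c - d)| + L * |c - d| * (p + p) :=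
    (hφ.four a ma b mb c mc d md).trans (by gcongr)
  have b4 := hφ.lip c mc d md
  have b5 : |ψ a - ψ b - ψ c + ψ d| ≤ L * |(a - b) - (c - d)| + L * |c - d| * (p + p) :=
    (hψ.four a ma b mb c mc d md).trans (by gcongr)
  have hp0 : 0 ≤ p := (abs_nonneg _).trans hp
  rw [e1]
  refine (abs_add_le _ _).trans ((add_le_add_left ((abs_add_le _ _).trans (add_le_add_left
    (abs_add_three _ _ _) _)) _).trans ?_)
  simp only [abs_mul]
  calc |φ a - φ c| * |A - B| + |φ c| * |A - B - (C - D)| + |φ a - φ b - φ c + φ d| * |B| +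
        |φ c - φ d| * |B - D| + |ψ a - ψ b - ψ c + ψ d|
      ≤ L * p * |A - B| + L * m * |A - B - (C - D)| +
        (L * |(a - b) - (c - d)| + L * |c - d| * (p + p)) * n + L * |c - d| * q +
        (L * |(a - b) - (c - d)| + L * |c - d| * (p + p)) := by gcongr
    _ = _ := by ring

end Nonlinearity

end IsentropicNS

end

noncomputable section

open Filter Topology

namespace IsentropicNS

/-! ### Estimates for curves in `L¹ ∩ BV` -/

section WHolderAlgebra

variable {E : Type*} [NormedAddCommGroup E] {α T σ K K' : ℝ} {F G : ℝ → E}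

lemma WHolder.mono (hF : WHolder α T σ K F) (h : K ≤ K') : WHolder α T σ K' F where
  bound s hs hsT := (hF.bound s hs hsT).trans (by gcongr)
  holder s t hs hst htT := (hF.holder s t hs hst htT).trans (by
    have : 0 < t - s := by linarith
    gcongr)

lemma WHolder.congr (hF : WHolder α T σ K F) (h : ∀ t, 0 < t → t < T → F t = G t) :
    WHolder α T σ K G where
  bound s hs hsT := by rw [← h s hs hsT]; exact hF.bound s hs hsT
  holder s t hs hst htT := by
    rw [← h s hs (hst.trans htT), ← h t (hs.trans hst) htT]; exact hF.holder s t hs hst htT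

lemma WHolder.add (hF : WHolder α T σ K F) (hG : WHolder α T σ K' G) :
    WHolder α T σ (K + K') fun t => F t + G t where
  bound s hs hsT := (norm_add_le _ _).trans
    ((add_le_add (hF.bound s hs hsT) (hG.bound s hs hsT)).trans (le_of_eq (by ring)))
  holder s t hs hst htT := by
    rw [add_sub_add_comm]
    exact (norm_add_le _ _).trans
      ((add_le_add (hF.holder s t hs hst htT) (hG.holder s t hs hst htT)).trans (le_of_eq (by ring)))

end WHolderAlgebra

lemma WHolderBV.mono {α T σ K K' : ℝ} {F : ℝ → L1} (hF : WHolderBV α T σ K F) (h : K ≤ K') :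
    WHolderBV α T σ K' F := fun y hy => (hF y hy).mono (by gcongr)

lemma WHolderBV.congr {α T σ K : ℝ} {F G : ℝ → L1} (hF : WHolderBV α T σ K F)
    (h : ∀ t, 0 < t → t < T → F t = G t) : WHolderBV α T σ K G := fun y hy =>
  (hF y hy).congr fun t ht htT => by rw [h t ht htT]

lemma WHolderBV.add {α T σ K K' : ℝ} {F G : ℝ → L1} (hF : WHolderBV α T σ K F)
    (hG : WHolderBV α T σ K' G) : WHolderBV α T σ (K + K') fun t => F t + G t := fun y hy => by
  have := ((hF y hy).add (hG y hy)).mono (le_of_eq (add_mul K K' y).symm)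
  refine this.congr fun t _ _ => ?_
  simp only [map_add]
  abel

section Primitive

variable {E : Type*} [NormedAddCommGroup E] [NormedSpace ℝ E] {α T σ K M : ℝ} {Y : ℝ → E}

/-- Subadditivity of the power 1 - σ bounds t^(1-σ) - s^(1-σ) by (t-s)^(1-σ). -/
lemma norm_primitive_le (hY : WHolder α T σ K Y) (hσ1 : σ < 1) (hσ : 0 ≤ σ) (hK : 0 ≤ K)
    {s t : ℝ} (hs : 0 ≤ s) (hst : s ≤ t) (htT : t ≤ T) :
    ‖∫ r in s..t, Y r‖ ≤ K / (1 - σ) * (t - s) ^ (1 - σ) := by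
  refine (norm_integral_le_of_bound hst ((intervalIntegrable_neg_rpow hσ1 s t).const_mul K)
    fun r hr => hY.bound r (hs.trans_lt hr.1) (hr.2.trans_le htT)).trans ?_
  rw [intervalIntegral.integral_const_mul, integral_rpow (Or.inl (by linarith))]
  have e1 : -σ + 1 = 1 - σ := by ring
  have h1 : t ^ (1 - σ) ≤ (t - s) ^ (1 - σ) + s ^ (1 - σ) := by
    have := Real.rpow_add_le_add_rpow (sub_nonneg.2 hst) hs (by linarith : 0 ≤ 1 - σ) (by linarith)
    rwa [sub_add_cancel] at this
  have h2 : 0 < 1 - σ := by linarith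
  rw [e1, div_mul_eq_mul_div, mul_div_assoc]
  gcongr
  linarith

lemma rpow_mul_rpow_le_of_le {s h T a b : ℝ} (hs : 0 ≤ s) (hh : 0 ≤ h) (hsT : s ≤ T) (hhT : h ≤ T)
    (hT : 0 < T) (ha : 0 ≤ a) (hb : 0 ≤ b) : s ^ a * h ^ b ≤ T ^ (a + b) := by
  rw [Real.rpow_add hT]
  gcongr

/-- Integration in time removes the weight and yields Hölder exponent 1 - σ, of which α is kept and
the surplus goes into T^(1-σ). For the BV weight σ = 1 - γ the requirement is α ≤ γ. -/
lemma wHolder_primitive (hY : WHolder α T σ K Y) (hα : 0 < α) (hσ1 : α ≤ 1 - σ) (hσ : 0 ≤ σ)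
    (hK : 0 ≤ K) {X₀ : E} (hX : ‖X₀‖ ≤ M) :
    WHolder α T 0 (M + K / (1 - σ) * T ^ (1 - σ)) fun t => X₀ + ∫ r in (0 : ℝ)..t, Y r := by
  have h2 : 0 < 1 - σ := by linarith
  have hM : 0 ≤ M := (norm_nonneg _).trans hX
  refine ⟨fun t ht htT => ?_, fun s t hs hst htT => ?_⟩
  · have h1 := norm_primitive_le hY (by linarith) hσ hK le_rfl ht.le htT.le
    rw [sub_zero] at h1
    rw [neg_zero, Real.rpow_zero, mul_one]
    refine (norm_add_le _ _).trans (add_le_add hX (h1.trans ?_))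
    gcongr
  · have hh : 0 < t - s := by linarith
    have hT : 0 < T := by linarith
    have h1 := norm_primitive_le hY (by linarith) hσ hK hs.le hst.le htT.le
    have ht := hY.intervalIntegrable hα hσ (by linarith) hK le_rfl (hs.trans hst).le htT.le
    have hs' := hY.intervalIntegrable hα hσ (by linarith) hK le_rfl hs.le (hst.trans htT).le
    rw [add_sub_add_left_eq_sub, intervalIntegral.integral_interval_sub_left ht hs', zero_add]
    refine h1.trans ?_
    have e1 : (t - s) ^ (1 - σ) = s ^ (-α) * (t - s) ^ α * (s ^ α * (t - s) ^ (1 - σ - α)) := by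
      have i1 : s ^ (-α) * s ^ α = 1 := by rw [← Real.rpow_add hs]; simp
      have i2 : (t - s) ^ (1 - σ) = (t - s) ^ α * (t - s) ^ (1 - σ - α) := by
        rw [← Real.rpow_add hh]; ring_nf
      rw [i2]
      linear_combination -(t - s) ^ α * (t - s) ^ (1 - σ - α) * i1
    have h3 := rpow_mul_rpow_le_of_le hs.le hh.le (by linarith : s ≤ T) (by linarith) hT hα.le
      (by linarith : 0 ≤ 1 - σ - α)
    have e2 : α + (1 - σ - α) = 1 - σ := by ring
    rw [e2] at h3
    calc K / (1 - σ) * (t - s) ^ (1 - σ)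
        = K / (1 - σ) * (s ^ α * (t - s) ^ (1 - σ - α)) * (s ^ (-α) * (t - s) ^ α) := by
          rw [e1]; ring
      _ ≤ K / (1 - σ) * T ^ (1 - σ) * (s ^ (-α) * (t - s) ^ α) := by gcongr
      _ ≤ _ := by
          gcongr
          linarith

end Primitive

/-- Admissible exponents and time horizon. -/
structure Admissible (α γ T : ℝ) : Prop where
  α_pos : 0 < α
  α_lt : α < γ
  γ_le : γ ≤ 1 / 100
  T_pos : 0 < T
  T_le : T ≤ 1

/-- The ball of radius `K` for the velocity gradient. -/
structure InBall (α γ T K : ℝ) (W : ℝ → L1) : Prop where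
  l1 : WHolder α T (1 / 2 - γ) K W
  bv : WHolderBV α T (1 - γ) K W

/-- The ball of radius `b` for the density perturbation. -/
structure InDensityBall (α T b : ℝ) (V : ℝ → L1) : Prop where
  l1 : WHolder α T 0 b V
  bv : WHolderBV α T 0 b V

/-! ### Nonlinear estimates in the solution spaces -/

section Curves

variable {α γ T K b M D L : ℝ} {V V₁ V₂ W W₁ W₂ : ℝ → L1} {V₀ : L1} {φ ψ : ℝ → ℝ}

lemma InDensityBall.abs_le (hV : InDensityBall α T b V) {t : ℝ} (ht : 0 < t) (htT : t < T) :
    ∀ᵐ x, |V t x| ≤ b := by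
  have := (hV.bv.hasBV ht htT).ae_abs_le
  simpa using this

lemma InDensityBall.abs_sub_le (hV : InDensityBall α T b V) {s t : ℝ} (hs : 0 < s) (hst : s < t)
    (htT : t < T) : ∀ᵐ x, |(V t - V s : L1) x| ≤ b * (s ^ (-α) * (t - s) ^ α) := by
  have := (hV.bv.hasBV_sub hs hst htT).ae_abs_le
  rwa [zero_add] at this

/-- The density perturbation transported by the velocity gradient `W`. -/
def density (V₀ : L1) (W : ℝ → L1) (t : ℝ) : L1 := V₀ + ∫ r in (0 : ℝ)..t, W r

/-- Translation differences commute with the time integral, so BV is again an L¹ estimate. Its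
weight 1 - γ gives T^γ, which also dominates the power T^(1/2+γ) of the L¹ part because T ≤ 1. -/
lemma InBall.inDensityBall (hp : Admissible α γ T) (hW : InBall α γ T K W) (hK : 0 ≤ K)
    (h0 : ‖V₀‖ ≤ M) (h1 : HasBV M V₀) :
    InDensityBall α T (M + K / γ * T ^ γ) (density V₀ W) := by
  obtain ⟨hα, hαγ, hγ, hT, hT1⟩ := hp
  have hγ0 : 0 < γ := hα.trans hαγ
  refine ⟨(wHolder_primitive hW.l1 hα (by linarith) (by linarith) hK h0).mono ?_, fun h hh => ?_⟩
  · have e : 1 - (1 / 2 - γ) = 1 / 2 + γ := by ring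
    rw [e]
    have h2 : T ^ (1 / 2 + γ) ≤ T ^ γ := Real.rpow_le_rpow_of_exponent_ge hT hT1 (by linarith)
    gcongr
    linarith
  · have h2 := (wHolder_primitive (hW.bv h hh) hα (by linarith) (by linarith) (by positivity)
      (h1 h hh)).mono (K' := (M + K / γ * T ^ γ) * h) (le_of_eq (by
        rw [sub_sub_cancel]; ring))
    refine h2.congr fun t ht htT => ?_
    have hi := hW.l1.intervalIntegrable hα (by linarith) (by linarith) hK le_rfl ht.le htT.le
    have h3 := ContinuousLinearMap.intervalIntegral_comp_comm (translateDiff h) hi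
    simp only [translateDiff_apply] at h3
    rw [h3, density, map_add]
    abel

/-- A singularity weaker by at least 1/2 - γ than the permitted one leaves the small factor
T^(1/2-γ). -/
lemma rpow_neg_mul_le (hp : Admissible α γ T) {s a c : ℝ} (hs : 0 < s) (hsT : s < T)
    (hac : 1 / 2 - γ ≤ a - c) : s ^ (-c) ≤ T ^ (1 / 2 - γ) * s ^ (-a) := by
  have hγ := hp.γ_le
  have e : s ^ (-c) = s ^ (a - c) * s ^ (-a) := by rw [← Real.rpow_add hs]; ring_nf
  rw [e]
  gcongr
  calc s ^ (a - c) ≤ T ^ (a - c) := by gcongr; linarith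
    _ ≤ T ^ (1 / 2 - γ) := Real.rpow_le_rpow_of_exponent_ge hp.T_pos hp.T_le hac

/-- Terms from φ(V) W are quadratic and carry b K. Terms from ψ(V) are linear in V, but V has no
weight at t = 0, so `rpow_neg_mul_le` supplies T^(1/2-γ). -/
lemma nonlin_inBall (hp : Admissible α γ T) (hφ : SmoothNonlinearity L φ)
    (hψ : SmoothNonlinearity L ψ) (hV : InDensityBall α T b V) (hW : InBall α γ T K W)
    (hb : b ≤ 1 / 2) (hb0 : 0 ≤ b) (hK : 0 ≤ K) :
    InBall α γ T (L * (5 * b * K + 2 * b * T ^ (1 / 2 - γ))) fun t => nonlin φ ψ (V t) (W t) := by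
  have hp' := hp
  obtain ⟨hα, hαγ, hγ, hT, hT1⟩ := hp'
  have hL := hφ.nonneg
  have hτ : 0 ≤ T ^ (1 / 2 - γ) := by positivity
  set τ := T ^ (1 / 2 - γ) with hτdef
  have hsm : ∀ t, 0 < t → t < T → ∀ᵐ x, |V t x| ≤ 1 / 2 := fun t ht htT =>
    (hV.abs_le ht htT).mono fun x hx => hx.trans hb
  have hWsup : ∀ t, 0 < t → t < T → ∀ᵐ x, |W t x| ≤ K * t ^ (-(1 - γ)) := fun t ht htT =>
    (hW.bv.hasBV ht htT).ae_abs_le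
  have hVn : ∀ t, 0 < t → t < T → ‖V t‖ ≤ b := fun t ht htT => by
    simpa using hV.l1.bound t ht htT
  have hVh : ∀ h > 0, ∀ t, 0 < t → t < T → ‖translate h (V t) - V t‖ ≤ b * h :=
    fun h hh t ht htT => by simpa using (hV.bv h hh).bound t ht htT
  refine ⟨⟨fun s hs hsT => ?_, fun s t hs hst htT => ?_⟩, fun h hh =>
    ⟨fun s hs hsT => ?_, fun s t hs hst htT => ?_⟩⟩
  · refine (hφ.norm_nonlin_le hψ (hV.abs_le hs hsT)).trans ?_
    have h1 := hW.l1.bound s hs hsT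
    have h2 := hVn s hs hsT
    have h3 := rpow_neg_mul_le hp hs hsT (a := 1 / 2 - γ) (c := 0) (by linarith)
    rw [neg_zero, Real.rpow_zero] at h3
    set S := s ^ (-(1 / 2 - γ))
    have hS : 0 ≤ S := by positivity
    calc L * b * ‖W s‖ + L * ‖V s‖ ≤ L * b * (K * S) + L * (b * (τ * S)) := by
          gcongr
          exact h2.trans (by nlinarith)
      _ ≤ _ := by
        have : 0 ≤ L * b * K * S := by positivity
        have : 0 ≤ L * b * τ * S := by positivity
        nlinarith
  · have ht : 0 < t := hs.trans hst
    have hsT : s < T := hst.trans htT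
    have hh : 0 < t - s := by linarith
    refine (hφ.norm_nonlin_sub_le' hψ (hsm t ht htT) (hsm s hs hsT) (hV.abs_le hs hsT)
      (hV.abs_sub_le hs hst htT)).trans ?_
    have h1 := hW.l1.bound t ht htT
    have h1' : t ^ (-(1 / 2 - γ)) ≤ s ^ (-(1 / 2 - γ)) :=
      Real.rpow_le_rpow_of_nonpos hs hst.le (by linarith)
    have h2 := hW.l1.holder s t hs hst htT
    have h3 := hV.l1.holder s t hs hst htT
    have h4 := rpow_neg_mul_le hp hs hsT (a := 1 / 2 - γ + α) (c := α) (by linarith)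
    have e1 : s ^ (-(1 / 2 - γ + α)) = s ^ (-(1 / 2 - γ)) * s ^ (-α) := by
      rw [← Real.rpow_add hs]; ring_nf
    rw [zero_add] at h3
    rw [e1] at h2 h4 ⊢
    set S := s ^ (-(1 / 2 - γ))
    set X := s ^ (-α)
    set H := (t - s) ^ α
    have hS : 0 ≤ S := by positivity
    have hX : 0 ≤ X := by positivity
    have hH : 0 ≤ H := by positivity
    calc L * (b * (X * H)) * ‖W t‖ + L * b * ‖W t - W s‖ + L * ‖V t - V s‖
        ≤ L * (b * (X * H)) * (K * S) + L * b * (K * (S * X * H)) +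
          L * (b * ((τ * (S * X)) * H)) := by
          gcongr
          · exact h1.trans (by gcongr)
          · exact h3.trans (by gcongr)
      _ ≤ _ := by
        have : 0 ≤ L * b * K * (S * X * H) := by positivity
        have : 0 ≤ L * b * τ * (S * X * H) := by positivity
        nlinarith
  · simp only [hφ.translate_nonlin hψ]
    refine (hφ.norm_nonlin_sub_le hψ (ae_translate_abs_le h (hsm s hs hsT)) (hsm s hs hsT)
      (ae_translate_abs_le h (hV.abs_le hs hsT)) (hWsup s hs hsT)).trans ?_
    have h1 := (hW.bv h hh).bound s hs hsT
    have h2 := hVh h hh s hs hsT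
    have h3 := rpow_neg_mul_le hp hs hsT (a := 1 - γ) (c := 0) (by linarith)
    rw [neg_zero, Real.rpow_zero] at h3
    set S := s ^ (-(1 - γ))
    have hS : 0 ≤ S := by positivity
    calc L * b * ‖translate h (W s) - W s‖ + L * (K * S + 1) * ‖translate h (V s) - V s‖
        ≤ L * b * (K * h * S) + L * (K * S + τ * S) * (b * h) := by gcongr
      _ ≤ _ := by
        have : 0 ≤ L * b * K * h * S := by positivity
        have : 0 ≤ L * b * τ * h * S := by positivity
        nlinarith
  · have ht : 0 < t := hs.trans hst
    have hsT : s < T := hst.trans htT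
    have hts : 0 < t - s := by linarith
    simp only [hφ.translate_nonlin hψ]
    have hsub : ∀ᵐ x, |(translate h (V t) - translate h (V s) : L1) x| ≤
        b * (s ^ (-α) * (t - s) ^ α) := by
      rw [← map_sub]
      exact ae_translate_abs_le h (hV.abs_sub_le hs hst htT)
    have hWt : ∀ᵐ x, |W t x| ≤ K * s ^ (-(1 - γ)) := (hWsup t ht htT).mono fun x hx =>
      hx.trans (mul_le_mul_of_nonneg_left
        (Real.rpow_le_rpow_of_nonpos hs hst.le (by linarith)) hK)
    refine (hφ.norm_nonlin_four_le hψ (ae_translate_abs_le h (hsm t ht htT)) (hsm t ht htT)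
      (ae_translate_abs_le h (hsm s hs hsT)) (hsm s hs hsT) hsub (hV.abs_sub_le hs hst htT)
      (ae_translate_abs_le h (hV.abs_le hs hsT)) hWt
      ((hW.bv.hasBV_sub hs hst htT).ae_abs_le)).trans ?_
    have h1 := (hW.bv h hh).bound t ht htT
    have h1' : t ^ (-(1 - γ)) ≤ s ^ (-(1 - γ)) :=
      Real.rpow_le_rpow_of_nonpos hs hst.le (by linarith)
    have h2 := (hW.bv h hh).holder s t hs hst htT
    have h3 := (hV.bv h hh).holder s t hs hst htT
    have h4 := hVh h hh s hs hsT
    have h5 := rpow_neg_mul_le hp hs hsT (a := 1 - γ + α) (c := α) (by linarith)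
    have e1 : s ^ (-(1 - γ + α)) = s ^ (-(1 - γ)) * s ^ (-α) := by
      rw [← Real.rpow_add hs]; ring_nf
    rw [zero_add] at h3
    rw [e1] at h2 h5 ⊢
    set S := s ^ (-(1 - γ))
    set X := s ^ (-α)
    set H := (t - s) ^ α
    have hS : 0 ≤ S := by positivity
    have hX : 0 ≤ X := by positivity
    have hH : 0 ≤ H := by positivity
    calc _ ≤ L * (b * (X * H)) * (K * h * S) + L * b * (K * h * (S * X * H)) +
          L * (K * S + 1) * (b * h * (X * H)) +
          L * (2 * (b * (X * H)) * (K * S + 1) + K * (S * X * H)) * (b * h) := by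
          gcongr
          exact h1.trans (by gcongr)
      _ = L * (b * K * h * (S * X * H)) * (4 + 2 * b) +
          L * b * h * H * (X * (1 + 2 * b)) := by ring
      _ ≤ L * (b * K * h * (S * X * H)) * (4 + 1) + L * b * h * H * ((τ * (S * X)) * (1 + 1)) := by
          gcongr <;> linarith
      _ = _ := by ring

/-- The densities share V₀, so their difference is the primitive of W₁ - W₂ and vanishes like
t^(1/2+γ) in L¹. This absorbs the blow-up t^(-(1-γ)) of the sup norm of W₂, and no BV norm of W₁ -
W₂ is needed. -/
lemma nonlin_contraction (hp : Admissible α γ T) (hφ : SmoothNonlinearity L φ)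
    (hψ : SmoothNonlinearity L ψ) (hV₁ : InDensityBall α T b (density V₀ W₁))
    (hV₂ : InDensityBall α T b (density V₀ W₂)) (hW₁ : InBall α γ T K W₁)
    (hW₂ : InBall α γ T K W₂) (hb : b ≤ 1 / 2) (hb0 : 0 ≤ b) (hK : 0 ≤ K) (hD : 0 ≤ D)
    (hdW : WHolder α T (1 / 2 - γ) D fun t => W₁ t - W₂ t) :
    WHolder α T (1 / 2 - γ) (L * (2 * b + 6 * K + 4 * T ^ (1 / 2 - γ)) * D) fun t =>
      nonlin φ ψ (density V₀ W₁ t) (W₁ t) - nonlin φ ψ (density V₀ W₂ t) (W₂ t) := by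
  have hp' := hp
  obtain ⟨hα, hαγ, hγ, hT, hT1⟩ := hp'
  have hγ0 : 0 < γ := hα.trans hαγ
  have hL := hφ.nonneg
  have hτ : 0 ≤ T ^ (1 / 2 - γ) := by positivity
  set τ := T ^ (1 / 2 - γ) with hτdef
  have hsm : ∀ {V}, InDensityBall α T b V → ∀ t, 0 < t → t < T → ∀ᵐ x, |V t x| ≤ 1 / 2 :=
    fun hV t ht htT => (hV.abs_le ht htT).mono fun x hx => hx.trans hb
  have hWsup : ∀ t, 0 < t → t < T → ∀ᵐ x, |W₂ t x| ≤ K * t ^ (-(1 - γ)) := fun t ht htT =>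
    (hW₂.bv.hasBV ht htT).ae_abs_le
  have hi : ∀ {W}, InBall α γ T K W → ∀ t, 0 < t → t < T → IntervalIntegrable W volume 0 t :=
    fun hW t ht htT => hW.l1.intervalIntegrable hα (by linarith) (by linarith) hK le_rfl ht.le htT.le
  have hdV : ∀ t, 0 < t → t < T → density V₀ W₁ t - density V₀ W₂ t =
      ∫ r in (0 : ℝ)..t, (W₁ r - W₂ r) := fun t ht htT => by
    rw [density, density, add_sub_add_left_eq_sub,
      intervalIntegral.integral_sub (hi hW₁ t ht htT) (hi hW₂ t ht htT)]
  have eσ : 1 - (1 / 2 - γ) = 1 / 2 + γ := by ring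
  have hdV1 : ∀ t, 0 < t → t < T → ‖density V₀ W₁ t - density V₀ W₂ t‖ ≤
      2 * D * t ^ (1 / 2 + γ) := fun t ht htT => by
    rw [hdV t ht htT]
    refine (norm_primitive_le hdW (by linarith) (by linarith) hD le_rfl ht.le htT.le).trans ?_
    rw [eσ, sub_zero]
    gcongr
    rw [div_le_iff₀ (by linarith)]
    nlinarith
  have hdV2 : ∀ s t, 0 < s → s < t → t < T → ‖(density V₀ W₁ t - density V₀ W₂ t) -
      (density V₀ W₁ s - density V₀ W₂ s)‖ ≤ 2 * D * (t - s) ^ (1 / 2 + γ) :=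
    fun s t hs hst htT => by
    have hti := (hi hW₁ t (hs.trans hst) htT).sub (hi hW₂ t (hs.trans hst) htT)
    have hsi := (hi hW₁ s hs (hst.trans htT)).sub (hi hW₂ s hs (hst.trans htT))
    rw [hdV t (hs.trans hst) htT, hdV s hs (hst.trans htT),
      intervalIntegral.integral_interval_sub_left hti hsi]
    refine (norm_primitive_le hdW (by linarith) (by linarith) hD hs.le hst.le htT.le).trans ?_
    rw [eσ]
    have : 0 < t - s := by linarith
    gcongr
    rw [div_le_iff₀ (by linarith)]
    nlinarith
  refine ⟨fun s hs hsT => ?_, fun s t hs hst htT => ?_⟩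
  · refine (hφ.norm_nonlin_sub_le hψ (hsm hV₁ s hs hsT) (hsm hV₂ s hs hsT) (hV₁.abs_le hs hsT)
      (hWsup s hs hsT)).trans ?_
    have h1 := hdW.bound s hs hsT
    have h2 := hdV1 s hs hsT
    have hs1 : s ≤ 1 := by linarith
    have e1 : s ^ (-(1 - γ)) * s ^ (1 / 2 + γ) ≤ s ^ (-(1 / 2 - γ)) := by
      rw [← Real.rpow_add hs]
      exact Real.rpow_le_rpow_of_exponent_ge hs hs1 (by linarith)
    have e2 : s ^ (1 / 2 + γ) ≤ τ * s ^ (-(1 / 2 - γ)) := by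
      have := rpow_neg_mul_le hp hs hsT (a := 1 / 2 - γ) (c := -(1 / 2 + γ)) (by linarith)
      rwa [neg_neg] at this
    set S := s ^ (-(1 / 2 - γ))
    have hS : 0 ≤ S := by positivity
    calc L * b * ‖W₁ s - W₂ s‖ + L * (K * s ^ (-(1 - γ)) + 1) *
          ‖density V₀ W₁ s - density V₀ W₂ s‖
        ≤ L * b * (D * S) + L * (K * s ^ (-(1 - γ)) + 1) * (2 * D * s ^ (1 / 2 + γ)) := by gcongr
      _ = L * b * (D * S) + 2 * L * D * K * (s ^ (-(1 - γ)) * s ^ (1 / 2 + γ)) +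
          2 * L * D * s ^ (1 / 2 + γ) := by ring
      _ ≤ L * b * (D * S) + 2 * L * D * K * S + 2 * L * D * (τ * S) := by gcongr
      _ ≤ _ := by
        have : 0 ≤ L * b * (D * S) := by positivity
        have : 0 ≤ L * D * K * S := by positivity
        have : 0 ≤ L * D * (τ * S) := by positivity
        nlinarith
  · have ht : 0 < t := hs.trans hst
    have hsT : s < T := hst.trans htT
    have hts : 0 < t - s := by linarith
    have hs1 : s ≤ 1 := by linarith
    refine (hφ.norm_nonlin_four_le hψ (hsm hV₁ t ht htT) (hsm hV₂ t ht htT) (hsm hV₁ s hs hsT)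
      (hsm hV₂ s hs hsT) (hV₁.abs_sub_le hs hst htT) (hV₂.abs_sub_le hs hst htT)
      (hV₁.abs_le hs hsT) (hWsup t ht htT) ((hW₂.bv.hasBV_sub hs hst htT).ae_abs_le)).trans ?_
    have h1 := hdW.bound t ht htT
    have h1' : t ^ (-(1 / 2 - γ)) ≤ s ^ (-(1 / 2 - γ)) :=
      Real.rpow_le_rpow_of_nonpos hs hst.le (by linarith)
    have h2 := hdW.holder s t hs hst htT
    have h3 := hdV2 s t hs hst htT
    have h4 := hdV1 s hs hsT
    have hP := norm_nonneg ((density V₀ W₁ t - density V₀ W₂ t) -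
      (density V₀ W₁ s - density V₀ W₂ s))
    have hQ := norm_nonneg (density V₀ W₁ s - density V₀ W₂ s)
    have e1 : s ^ (-(1 / 2 - γ + α)) = s ^ (-(1 / 2 - γ)) * s ^ (-α) := by
      rw [← Real.rpow_add hs]; ring_nf
    have e1' : s ^ (-(1 - γ + α)) = s ^ (-(1 - γ)) * s ^ (-α) := by
      rw [← Real.rpow_add hs]; ring_nf
    have e2 : s ^ (-(1 - γ)) * s ^ (1 / 2 + γ) ≤ s ^ (-(1 / 2 - γ)) := by
      rw [← Real.rpow_add hs]
      exact Real.rpow_le_rpow_of_exponent_ge hs hs1 (by linarith)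
    have e3 : s ^ (1 / 2 + γ) ≤ τ * s ^ (-(1 / 2 - γ)) := by
      have := rpow_neg_mul_le hp hs hsT (a := 1 / 2 - γ) (c := -(1 / 2 + γ)) (by linarith)
      rwa [neg_neg] at this
    have e4 : (t - s) ^ (1 / 2 + γ) = (t - s) ^ (1 / 2 + γ - α) * (t - s) ^ α := by
      rw [← Real.rpow_add hts]; ring_nf
    -- Only α of the Hölder exponent 1/2 + γ is needed in the conclusion; the surplus absorbs the
    -- singular sup bound of W₂ at time t.
    have e5 : t ^ (-(1 - γ)) * (t - s) ^ (1 / 2 + γ - α) ≤ s ^ (-(1 / 2 - γ)) * s ^ (-α) := by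
      calc t ^ (-(1 - γ)) * (t - s) ^ (1 / 2 + γ - α)
          ≤ t ^ (-(1 - γ)) * t ^ (1 / 2 + γ - α) := by gcongr <;> linarith
        _ = t ^ (-(1 - γ) + (1 / 2 + γ - α)) := by rw [← Real.rpow_add ht]
        _ ≤ s ^ (-(1 - γ) + (1 / 2 + γ - α)) :=
          Real.rpow_le_rpow_of_nonpos hs hst.le (by linarith)
        _ ≤ s ^ (-(1 / 2 - γ) + -α) :=
          Real.rpow_le_rpow_of_exponent_ge hs hs1 (by linarith)
        _ = _ := by rw [← Real.rpow_add hs]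
    have e6 : (t - s) ^ (1 / 2 + γ - α) ≤ τ * (s ^ (-(1 / 2 - γ)) * s ^ (-α)) := by
      have k1 : (t - s) ^ (1 / 2 + γ - α) ≤ 1 := Real.rpow_le_one hts.le (by linarith) (by linarith)
      have k2 : s ^ (-α) ≤ τ * (s ^ (-(1 / 2 - γ)) * s ^ (-α)) := by
        have := rpow_neg_mul_le hp hs hsT (a := 1 / 2 - γ + α) (c := α) (by linarith)
        rwa [e1] at this
      exact k1.trans ((Real.one_le_rpow_of_pos_of_le_one_of_nonpos hs hs1 (by linarith)).trans k2)
    have e7 : t ^ (-(1 - γ)) ≤ s ^ (-(1 - γ)) :=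
      Real.rpow_le_rpow_of_nonpos hs hst.le (by linarith)
    rw [e1] at h2 ⊢
    rw [e1']
    rw [e4] at h3
    set S := s ^ (-(1 / 2 - γ))
    set S' := s ^ (-(1 - γ))
    set R := t ^ (-(1 - γ))
    set X := s ^ (-α)
    set H := (t - s) ^ α
    set P := (t - s) ^ (1 / 2 + γ - α)
    set Q := s ^ (1 / 2 + γ)
    have hS : 0 ≤ S := by positivity
    have hS' : 0 ≤ S' := by positivity
    have hR : 0 ≤ R := by positivity
    have hX : 0 ≤ X := by positivity
    have hH : 0 ≤ H := by positivity
    have hPp : 0 ≤ P := by positivity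
    have hQp : 0 ≤ Q := by positivity
    calc _ ≤ L * (b * (X * H)) * (D * S) + L * b * (D * (S * X * H)) +
          L * (K * R + 1) * (2 * D * (P * H)) +
          L * (2 * (b * (X * H)) * (K * R + 1) + K * (S' * X * H)) * (2 * D * Q) := by
          gcongr
          exact h1.trans (by gcongr)
      _ = 2 * L * b * D * (S * X * H) + 2 * L * K * D * H * (R * P) + 2 * L * D * H * P +
          4 * L * b * K * D * (X * H) * (R * Q) + 4 * L * b * D * (X * H) * Q +
          2 * L * K * D * (X * H) * (S' * Q) := by ring
      _ ≤ 2 * L * b * D * (S * X * H) + 2 * L * K * D * H * (S * X) +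
          2 * L * D * H * (τ * (S * X)) +
          4 * L * (1 / 2) * K * D * (X * H) * S + 4 * L * (1 / 2) * D * (X * H) * (τ * S) +
          2 * L * K * D * (X * H) * S := by
          have : R * Q ≤ S := (mul_le_mul_of_nonneg_right e7 hQp).trans e2
          gcongr
      _ = _ := by ring

end Curves

end IsentropicNS

end

noncomputable section

open Filter Topology

namespace IsentropicNS

/-! ### The fixed point of the mild formulation -/

lemma WHolder.of_tendsto {E : Type*} [NormedAddCommGroup E] {α T σ K : ℝ} {F : ℕ → ℝ → E}
    {G : ℝ → E} (hF : ∀ᶠ n in atTop, WHolder α T σ K (F n))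
    (h : ∀ t, 0 < t → t < T → Tendsto (fun n => F n t) atTop (𝓝 (G t))) : WHolder α T σ K G where
  bound s hs hsT := le_of_tendsto (h s hs hsT).norm (hF.mono fun _ hn => hn.bound s hs hsT)
  holder s t hs hst htT :=
    le_of_tendsto ((h t (hs.trans hst) htT).sub (h s hs (hst.trans htT))).norm
      (hF.mono fun _ hn => hn.holder s t hs hst htT)

lemma WHolder.neg {E : Type*} [NormedAddCommGroup E] {α T σ K : ℝ} {F : ℝ → E}
    (hF : WHolder α T σ K F) : WHolder α T σ K fun t => -F t where
  bound s hs hsT := by rw [norm_neg]; exact hF.bound s hs hsT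
  holder s t hs hst htT := by
    rw [neg_sub_neg, norm_sub_rev]; exact hF.holder s t hs hst htT

lemma WHolder.sub {E : Type*} [NormedAddCommGroup E] {α T σ K K' : ℝ} {F G : ℝ → E}
    (hF : WHolder α T σ K F) (hG : WHolder α T σ K' G) :
    WHolder α T σ (K + K') fun t => F t - G t := by
  simpa only [sub_eq_add_neg] using hF.add hG.neg

/-- The right-hand side of the mild formulation for the velocity gradient. -/
def mildMap (μ : ℝ) (φ ψ : ℝ → ℝ) (V₀ u₀ : L1) (W : ℝ → L1) (t : ℝ) : L1 :=
  gradHeat (2 * μ * t) u₀ + heatDuhamel μ (fun r => nonlin φ ψ (density V₀ W r) (W r)) t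

/-- Initial data of size `M`. -/
structure DataBound (γ M : ℝ) (V₀ u₀ : L1) : Prop where
  norm_le : ‖V₀‖ ≤ M
  hasBV : HasBV M V₀
  integrable : Integrable fun y : ℝ => |y| ^ (-(1 + 2 * γ)) * ‖translate y u₀ - u₀‖
  translateNorm_le : translateNorm γ u₀ ≤ M

/-- A common bound for the Duhamel constants. -/
def solverConst (α γ μ : ℝ) : ℝ :=
  max (duhamelConst (3 / μ) (1 / μ) α (1 / 2 - γ)) (duhamelConst (3 / μ) (1 / μ) α (1 - γ))

section Solver

variable {α γ T μ L K b M D : ℝ} {φ ψ : ℝ → ℝ} {V₀ u₀ : L1} {W W₁ W₂ : ℝ → L1}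

lemma duhamelConst_nonneg {c κ α σ : ℝ} (hc : 0 ≤ c) (hκ : 0 ≤ κ) (hα : 0 < α) (hα1 : α < 1 / 2)
    (hσ : σ + α < 1) : 0 ≤ duhamelConst c κ α σ := by
  have h1 : 0 < 1 - (σ + α) := by linarith
  have h2 : 0 < 1 / 2 - α := by linarith
  unfold duhamelConst
  positivity

lemma solverConst_nonneg (hp : Admissible α γ T) (hμ : 0 < μ) : 0 ≤ solverConst α γ μ := by
  obtain ⟨hα, hαγ, hγ, hT, hT1⟩ := hp
  exact (duhamelConst_nonneg (by positivity) (by positivity) hα (by linarith)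
    (by linarith)).trans (le_max_left _ _)

lemma mildMap_inBall (hp : Admissible α γ T) (hμ : 0 < μ) (hφ : SmoothNonlinearity L φ)
    (hψ : SmoothNonlinearity L ψ) (hd : DataBound γ M V₀ u₀) (hK : 0 ≤ K)
    (hbK : M + K / γ * T ^ γ ≤ b) (hb : b ≤ 1 / 2)
    (hstab : layerConst μ γ * M +
      solverConst α γ μ * (L * (5 * b * K + 2 * b * T ^ (1 / 2 - γ))) ≤ K)
    (hW : InBall α γ T K W) : InBall α γ T K (mildMap μ φ ψ V₀ u₀ W) := by
  have hp' := hp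
  obtain ⟨hα, hαγ, hγ, hT, hT1⟩ := hp'
  have hγ0 : 0 < γ := hα.trans hαγ
  have hM : 0 ≤ M := (norm_nonneg _).trans hd.norm_le
  have hb0 : 0 ≤ b := le_trans (by positivity) hbK
  have hL := hφ.nonneg
  have hV := hW.inDensityBall hp hK hd.norm_le hd.hasBV
  have hV' : InDensityBall α T b (density V₀ W) := ⟨hV.l1.mono hbK, hV.bv.mono hbK⟩
  have hF := nonlin_inBall hp hφ hψ hV' hW hb hb0 hK
  set N := L * (5 * b * K + 2 * b * T ^ (1 / 2 - γ)) with hN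
  have hN0 : 0 ≤ N := by positivity
  have hlayer : layerConst μ γ * translateNorm γ u₀ ≤ layerConst μ γ * M :=
    mul_le_mul_of_nonneg_left hd.translateNorm_le (layerConst_pos hμ).le
  have h1 := wHolder_gradHeat (T := T) hμ hα.le (by linarith) hγ0.le (by linarith) hd.integrable
  have h2 := wHolderBV_gradHeat (T := T) hμ hα.le (by linarith) hγ0.le (by linarith) hd.integrable
  have h3 := (parabolicPair_heat hμ).wHolder_duhamel hF.l1 hα (by linarith) (by linarith)
    (by linarith) hN0
  have h4 := WHolderBV.heatDuhamel hμ hF.l1 hF.bv hα (by linarith) (by linarith) (by linarith)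
    hN0 (by linarith) (by linarith) hN0
  refine ⟨(h1.add h3).mono (le_trans (add_le_add hlayer ?_) hstab),
    (h2.add h4).mono (le_trans (add_le_add hlayer ?_) hstab)⟩
  · exact mul_le_mul_of_nonneg_right (le_max_left _ _) hN0
  · exact mul_le_mul_of_nonneg_right (le_max_right _ _) hN0

lemma mildMap_contraction (hp : Admissible α γ T) (hμ : 0 < μ) (hφ : SmoothNonlinearity L φ)
    (hψ : SmoothNonlinearity L ψ) (hd : DataBound γ M V₀ u₀) (hK : 0 ≤ K)
    (hbK : M + K / γ * T ^ γ ≤ b) (hb : b ≤ 1 / 2)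
    (hcontr : solverConst α γ μ * (L * (2 * b + 6 * K + 4 * T ^ (1 / 2 - γ))) ≤ 1 / 2)
    (hW₁ : InBall α γ T K W₁) (hW₂ : InBall α γ T K W₂) (hD : 0 ≤ D)
    (hdW : WHolder α T (1 / 2 - γ) D fun t => W₁ t - W₂ t) :
    WHolder α T (1 / 2 - γ) (D / 2) fun t =>
      mildMap μ φ ψ V₀ u₀ W₁ t - mildMap μ φ ψ V₀ u₀ W₂ t := by
  have hp' := hp
  obtain ⟨hα, hαγ, hγ, hT, hT1⟩ := hp'
  have hγ0 : 0 < γ := hα.trans hαγ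
  have hM : 0 ≤ M := (norm_nonneg _).trans hd.norm_le
  have hb0 : 0 ≤ b := le_trans (by positivity) hbK
  have hL := hφ.nonneg
  have hV : ∀ {W}, InBall α γ T K W → InDensityBall α T b (density V₀ W) := fun hW => by
    have hV := hW.inDensityBall hp hK hd.norm_le hd.hasBV
    exact ⟨hV.l1.mono hbK, hV.bv.mono hbK⟩
  have hF := fun {W} (hW : InBall α γ T K W) => nonlin_inBall hp hφ hψ (hV hW) hW hb hb0 hK
  have hN0 : 0 ≤ L * (5 * b * K + 2 * b * T ^ (1 / 2 - γ)) := by positivity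
  have hN1 : 0 ≤ L * (2 * b + 6 * K + 4 * T ^ (1 / 2 - γ)) * D := by positivity
  have h1 := nonlin_contraction hp hφ hψ (hV hW₁) (hV hW₂) hW₁ hW₂ hb hb0 hK hD hdW
  have h2 := (parabolicPair_heat hμ).wHolder_duhamel h1 hα (by linarith) (by linarith)
    (by linarith) hN1
  refine (h2.congr fun t ht htT => ?_).mono ?_
  · rw [mildMap, mildMap, add_sub_add_left_eq_sub, heatDuhamel_sub hμ (hF hW₁).l1 (hF hW₂).l1 hα
      (by linarith) (by linarith) hN0 ht htT]
    rfl
  · calc _ ≤ solverConst α γ μ * (L * (2 * b + 6 * K + 4 * T ^ (1 / 2 - γ)) * D) :=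
          mul_le_mul_of_nonneg_right (le_max_left _ _) hN1
      _ = solverConst α γ μ * (L * (2 * b + 6 * K + 4 * T ^ (1 / 2 - γ))) * D := by ring
      _ ≤ 1 / 2 * D := by gcongr
      _ = D / 2 := by ring

lemma wHolder_zero {α T σ K : ℝ} (hK : 0 ≤ K) : WHolder α T σ K fun _ => (0 : L1) where
  bound s hs hsT := by simp only [norm_zero]; positivity
  holder s t hs hst htT := by
    have : 0 < t - s := by linarith
    simp only [sub_zero, norm_zero]
    positivity

/-- Existence of a mild solution by Picard iteration. -/
theorem exists_mildSolution (hp : Admissible α γ T) (hμ : 0 < μ) (hφ : SmoothNonlinearity L φ)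
    (hψ : SmoothNonlinearity L ψ) (hd : DataBound γ M V₀ u₀) (hK : 0 ≤ K)
    (hbK : M + K / γ * T ^ γ ≤ b) (hb : b ≤ 1 / 2)
    (hstab : layerConst μ γ * M +
      solverConst α γ μ * (L * (5 * b * K + 2 * b * T ^ (1 / 2 - γ))) ≤ K)
    (hcontr : solverConst α γ μ * (L * (2 * b + 6 * K + 4 * T ^ (1 / 2 - γ))) ≤ 1 / 2) :
    ∃ W, InBall α γ T K W ∧ ∀ t, 0 < t → t < T → W t = mildMap μ φ ψ V₀ u₀ W t := by
  set P := mildMap μ φ ψ V₀ u₀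
  set w : ℕ → ℝ → L1 := fun n => P^[n] fun _ => 0 with hw
  have hsucc : ∀ n, w (n + 1) = P (w n) := fun n => Function.iterate_succ_apply' _ _ _
  have hball : ∀ n, InBall α γ T K (w n) := fun n => by
    induction n with
    | zero =>
      refine ⟨wHolder_zero hK, fun h hh => ?_⟩
      simpa [hw] using wHolder_zero (by positivity : 0 ≤ K * h)
    | succ n ih => rw [hsucc]; exact mildMap_inBall hp hμ hφ hψ hd hK hbK hb hstab ih
  have hstep : ∀ n, WHolder α T (1 / 2 - γ) (K / 2 ^ n) fun t => w (n + 1) t - w n t := fun n => by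
    induction n with
    | zero => simpa [hw] using (hball 1).l1
    | succ n ih =>
      have := mildMap_contraction hp hμ hφ hψ hd hK hbK hb hcontr (hball (n + 1)) (hball n)
        (by positivity) ih
      rw [hsucc (n + 1), pow_succ, ← div_div]
      simpa only [hsucc n] using this
  -- The constant is the exact partial sum of K/2^j over n ≤ j < n + k; being at most 2K/2^n, it is
  -- uniform in k.
  have hdist : ∀ n k, WHolder α T (1 / 2 - γ) (2 * K / 2 ^ n - 2 * K / 2 ^ (n + k))
      fun t => w (n + k) t - w n t := fun n k => by
    induction k with
    | zero => simpa using wHolder_zero (α := α) (T := T) (σ := 1 / 2 - γ) le_rfl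
    | succ k ih =>
      refine ((ih.add (hstep (n + k))).congr (G := fun t => w (n + (k + 1)) t - w n t)
        fun t _ _ => ?_).mono (le_of_eq ?_)
      · rw [add_assoc]; abel
      · rw [← add_assoc, pow_succ]
        field_simp
        ring
  have hcau : ∀ t, ∃ l, 0 < t → t < T → Tendsto (fun n => w n t) atTop (𝓝 l) := fun t => by
    by_cases ht : 0 < t ∧ t < T
    · have hc : CauchySeq fun n => w n t := by
        refine cauchySeq_of_le_geometric_two (C := 2 * (K * t ^ (-(1 / 2 - γ)))) fun n => ?_
        rw [dist_eq_norm, norm_sub_rev]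
        refine ((hstep n).bound t ht.1 ht.2).trans (le_of_eq (by ring))
      obtain ⟨l, hl⟩ := cauchySeq_tendsto_of_complete hc
      exact ⟨l, fun _ _ => hl⟩
    · exact ⟨0, fun h1 h2 => absurd ⟨h1, h2⟩ ht⟩
  choose W hW using hcau
  -- Convergence is measured in L¹ at each time only, yet the BV bounds pass to the limit because
  -- they are L¹ bounds for translation differences.
  have hWball : InBall α γ T K W := by
    refine ⟨.of_tendsto (Eventually.of_forall fun n => (hball n).l1) hW, fun h hh =>
      .of_tendsto (Eventually.of_forall fun n => (hball n).bv h hh) fun t ht htT => ?_⟩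
    exact (((translate h).continuous.tendsto _).comp (hW t ht htT)).sub (hW t ht htT)
  have hdW : ∀ n, WHolder α T (1 / 2 - γ) (2 * K / 2 ^ n) fun t => W t - w n t := fun n => by
    refine .of_tendsto (Eventually.of_forall fun k => (hdist n k).mono ?_) fun t ht htT => ?_
    · have : 0 ≤ 2 * K / 2 ^ (n + k) := by positivity
      linarith
    · simp only [add_comm n]
      exact ((tendsto_add_atTop_iff_nat n).2 (hW t ht htT)).sub_const _
  refine ⟨W, hWball, fun t ht htT => ?_⟩
  -- The contraction between W and the iterates gives convergence of the images to P W, while the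
  -- same images converge to W.
  have h1 : Tendsto (fun n => P W t - w (n + 1) t) atTop (𝓝 0) := by
    refine squeeze_zero_norm (a := fun n : ℕ => K * t ^ (-(1 / 2 - γ)) * (1 / 2) ^ n)
      (fun n => ?_) ?_
    · have h := mildMap_contraction hp hμ hφ hψ hd hK hbK hb hcontr hWball (hball n)
        (by positivity) (hdW n)
      have := h.bound t ht htT
      rw [hsucc]
      refine this.trans (le_of_eq ?_)
      rw [one_div, inv_pow]
      ring
    · simpa using (tendsto_pow_atTop_nhds_zero_of_lt_one (by norm_num : (0 : ℝ) ≤ 1 / 2)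
        (by norm_num)).const_mul (K * t ^ (-(1 / 2 - γ)))
  have h2 := ((tendsto_add_atTop_iff_nat 1).2 (hW t ht htT)).const_sub (P W t)
  exact (sub_eq_zero.1 (tendsto_nhds_unique h2 h1)).symm

/-- Uniqueness of mild solutions. -/
theorem mildSolution_unique (hp : Admissible α γ T) (hμ : 0 < μ) (hφ : SmoothNonlinearity L φ)
    (hψ : SmoothNonlinearity L ψ) (hd : DataBound γ M V₀ u₀) (hK : 0 ≤ K)
    (hbK : M + K / γ * T ^ γ ≤ b) (hb : b ≤ 1 / 2)
    (hcontr : solverConst α γ μ * (L * (2 * b + 6 * K + 4 * T ^ (1 / 2 - γ))) ≤ 1 / 2)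
    (hW₁ : InBall α γ T K W₁) (hW₂ : InBall α γ T K W₂)
    (h₁ : ∀ t, 0 < t → t < T → W₁ t = mildMap μ φ ψ V₀ u₀ W₁ t)
    (h₂ : ∀ t, 0 < t → t < T → W₂ t = mildMap μ φ ψ V₀ u₀ W₂ t) {t : ℝ} (ht : 0 < t)
    (htT : t < T) : W₁ t = W₂ t := by
  have h : ∀ n : ℕ, WHolder α T (1 / 2 - γ) ((K + K) / 2 ^ n) fun t => W₁ t - W₂ t := fun n => by
    induction n with
    | zero => simpa using hW₁.l1.sub hW₂.l1
    | succ n ih =>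
      rw [pow_succ, ← div_div]
      refine (mildMap_contraction hp hμ hφ hψ hd hK hbK hb hcontr hW₁ hW₂ (by positivity)
        ih).congr fun t ht htT => ?_
      rw [← h₁ t ht htT, ← h₂ t ht htT]
  have h1 : Tendsto (fun _ : ℕ => W₁ t - W₂ t) atTop (𝓝 0) := by
    refine squeeze_zero_norm (a := fun n : ℕ => (K + K) * t ^ (-(1 / 2 - γ)) * (1 / 2) ^ n)
      (fun n => ?_) ?_
    · refine ((h n).bound t ht htT).trans (le_of_eq ?_)
      rw [one_div, inv_pow]
      ring
    · simpa using (tendsto_pow_atTop_nhds_zero_of_lt_one (by norm_num : (0 : ℝ) ≤ 1 / 2)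
        (by norm_num)).const_mul ((K + K) * t ^ (-(1 / 2 - γ)))
  exact sub_eq_zero.1 (tendsto_nhds_unique tendsto_const_nhds h1)

end Solver

end IsentropicNS

end

noncomputable section

open Filter Topology

namespace IsentropicNS

/-! ### From the mild formulation to the integrated equations -/

/-- Curves on `(0,T)` that are continuous and integrable up to the end points. -/
structure IntegrableCurve {E : Type*} [NormedAddCommGroup E] (T : ℝ) (Y : ℝ → E) : Prop where
  continuousOn : ContinuousOn Y (Ioo 0 T)
  intervalIntegrable : IntervalIntegrable Y volume 0 T

section Primitive

variable {E E' : Type*} [NormedAddCommGroup E] [NormedAddCommGroup E'] {T : ℝ} {Y Z : ℝ → E}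

lemma WHolder.integrableCurve {α σ K : ℝ} (hF : WHolder α T σ K Y) (hα : 0 < α)
    (hσ : 0 ≤ σ) (hσ1 : σ < 1) (hK : 0 ≤ K) (hT : 0 ≤ T) : IntegrableCurve T Y :=
  ⟨hF.continuousOn hα hσ hK, hF.intervalIntegrable hα hσ hσ1 hK le_rfl hT le_rfl⟩

lemma IntegrableCurve.add (hY : IntegrableCurve T Y) (hZ : IntegrableCurve T Z) :
    IntegrableCurve T fun t => Y t + Z t :=
  ⟨hY.continuousOn.add hZ.continuousOn, hY.intervalIntegrable.add hZ.intervalIntegrable⟩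

lemma IntegrableCurve.mono (hY : IntegrableCurve T Y) {t : ℝ} (ht : 0 ≤ t) (htT : t ≤ T) :
    IntervalIntegrable Y volume 0 t :=
  hY.intervalIntegrable.mono_set (by
    rw [uIcc_of_le ht, uIcc_of_le (ht.trans htT)]; exact Icc_subset_Icc_right htT)

lemma IntegrableCurve.comp [NormedSpace ℝ E] [NormedSpace ℝ E'] (ℓ : E →L[ℝ] E')
    (hY : IntegrableCurve T Y) : IntegrableCurve T fun t => ℓ (Y t) :=
  ⟨ℓ.continuous.comp_continuousOn hY.continuousOn,
    ⟨ℓ.integrable_comp hY.intervalIntegrable.1, ℓ.integrable_comp hY.intervalIntegrable.2⟩⟩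

variable [NormedSpace ℝ E] [NormedSpace ℝ E']

lemma IntegrableCurve.continuousOn_primitive (hY : IntegrableCurve T Y) (hT : 0 ≤ T) (X₀ : E) :
    ContinuousOn (fun t => X₀ + ∫ r in (0 : ℝ)..t, Y r) (Icc 0 T) := by
  have := intervalIntegral.continuousOn_primitive_interval' hY.intervalIntegrable left_mem_uIcc
  rw [uIcc_of_le hT] at this
  exact continuousOn_const.add this

lemma IntegrableCurve.hasDerivAt_primitive [CompleteSpace E] (hY : IntegrableCurve T Y) (X₀ : E)
    {t : ℝ} (ht : t ∈ Ioo 0 T) : HasDerivAt (fun t => X₀ + ∫ r in (0 : ℝ)..t, Y r) (Y t) t :=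
  (intervalIntegral.integral_hasDerivAt_right (hY.mono ht.1.le ht.2.le)
    (hY.continuousOn.stronglyMeasurableAtFilter isOpen_Ioo t ht)
    (hY.continuousOn.continuousAt (isOpen_Ioo.mem_nhds ht))).const_add X₀

end Primitive

/-! ### Scalar linear equations with damping -/

section LinearODE

variable {T q : ℝ} {c : ℂ} {g w : ℝ → ℂ}

lemma hasDerivAt_cexp_mul (q t : ℝ) :
    HasDerivAt (fun r : ℝ => Complex.exp (q * r)) (q * Complex.exp (q * t)) t := by
  have h := ((hasDerivAt_id (t : ℂ)).const_mul (q : ℂ)).cexp.comp_ofReal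
  simp only [mul_one, id] at h
  rwa [mul_comm] at h

lemma IntegrableCurve.cexp_mul (hg : IntegrableCurve T g) (q : ℝ) :
    IntegrableCurve T fun r => Complex.exp (q * r) * g r := by
  have hc : Continuous fun r : ℝ => Complex.exp (q * r) := by fun_prop
  exact ⟨hc.continuousOn.mul hg.continuousOn,
    hg.intervalIntegrable.continuousOn_mul hc.continuousOn⟩

lemma integral_exp_neg_sub_mul (q t : ℝ) (g : ℝ → ℂ) :
    ∫ r in (0 : ℝ)..t, (Real.exp (-(q * (t - r))) : ℂ) * g r =
      Complex.exp (-(q * t)) * ∫ r in (0 : ℝ)..t, Complex.exp (q * r) * g r := by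
  rw [← intervalIntegral.integral_const_mul]
  refine intervalIntegral.integral_congr fun r _ => ?_
  rw [← mul_assoc, ← Complex.exp_add]
  push_cast
  ring_nf

/-- Variation of constants. -/
lemma eq_duhamel_of_integral_eq (hg : IntegrableCurve T g) (hw : IntegrableCurve T w)
    (h : ∀ t, 0 < t → t < T → w t = c + ∫ r in (0 : ℝ)..t, (g r - q * w r)) {t : ℝ} (ht : 0 < t)
    (htT : t < T) : w t = Complex.exp (-(q * t)) * c +
      ∫ r in (0 : ℝ)..t, (Real.exp (-(q * (t - r))) : ℂ) * g r := by
  have hT : 0 < T := ht.trans htT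
  have hY : IntegrableCurve T fun r => g r - q * w r :=
    ⟨hg.continuousOn.sub (continuousOn_const.mul hw.continuousOn),
      hg.intervalIntegrable.sub (hw.intervalIntegrable.const_mul _)⟩
  set y : ℝ → ℂ := fun t => c + ∫ r in (0 : ℝ)..t, (g r - q * w r) with hy
  have hyc := (hY.continuousOn_primitive hT.le c).mono (Icc_subset_Icc_right htT.le)
  have hc : Continuous fun r : ℝ => Complex.exp (q * r) := by fun_prop
  have hFTC := intervalIntegral.integral_eq_sub_of_hasDerivAt_of_le ht.le
    (f := fun r => Complex.exp (q * r) * y r) (f' := fun r => Complex.exp (q * r) * g r)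
    (hc.continuousOn.mul hyc) (fun r hr => by
      have h1 := (hasDerivAt_cexp_mul q r).mul
        (hY.hasDerivAt_primitive c ⟨hr.1, hr.2.trans htT⟩)
      refine h1.congr_deriv ?_
      rw [h r hr.1 (hr.2.trans htT)]
      ring) ((hg.cexp_mul q).mono ht.le htT.le)
  rw [integral_exp_neg_sub_mul, hFTC, h t ht htT]
  simp only [hy, intervalIntegral.integral_same, Complex.ofReal_zero, mul_zero, Complex.exp_zero]
  have e : Complex.exp (-(q * t)) * Complex.exp (q * t) = 1 := by
    rw [← Complex.exp_add]; simp
  linear_combination (-(c + ∫ r in (0 : ℝ)..t, (g r - q * w r))) * e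

lemma duhamel_integral_eq (hg : IntegrableCurve T g)
    (h : ∀ t, 0 < t → t < T → w t = Complex.exp (-(q * t)) * c +
      ∫ r in (0 : ℝ)..t, (Real.exp (-(q * (t - r))) : ℂ) * g r) {t : ℝ} (ht : 0 < t)
    (htT : t < T) : w t = c + ∫ r in (0 : ℝ)..t, (g r - q * w r) := by
  have hT : 0 < T := ht.trans htT
  have hE := hg.cexp_mul q
  set y : ℝ → ℂ := fun t => Complex.exp (-(q * t)) *
    (c + ∫ r in (0 : ℝ)..t, Complex.exp (q * r) * g r) with hy
  have hwy : ∀ t, 0 < t → t < T → w t = y t := fun t ht htT => by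
    rw [h t ht htT, integral_exp_neg_sub_mul, hy]
    ring
  have hc : Continuous fun r : ℝ => Complex.exp (-(q * r)) := by fun_prop
  have hyc : ContinuousOn y (Icc 0 t) :=
    hc.continuousOn.mul ((hE.continuousOn_primitive hT.le c).mono (Icc_subset_Icc_right htT.le))
  have hFTC := intervalIntegral.integral_eq_sub_of_hasDerivAt_of_le ht.le
    (f := y) (f' := fun r => g r - q * y r) hyc (fun r hr => by
      have h1 := hasDerivAt_cexp_mul (-q) r
      simp only [Complex.ofReal_neg, neg_mul] at h1
      refine (h1.mul (hE.hasDerivAt_primitive c ⟨hr.1, hr.2.trans htT⟩)).congr_deriv ?_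
      have e : Complex.exp (-(q * r)) * Complex.exp (q * r) = 1 := by
        rw [← Complex.exp_add]; simp
      simp only [hy]
      linear_combination g r * e)
      ((hg.mono ht.le htT.le).sub (ContinuousOn.intervalIntegrable (by
        rw [uIcc_of_le ht.le]; exact continuousOn_const.mul hyc)))
  have e2 : ∫ r in (0 : ℝ)..t, (g r - q * w r) = ∫ r in (0 : ℝ)..t, (g r - q * y r) := by
    refine intervalIntegral.integral_congr_ae (Eventually.of_forall fun r hr => ?_)
    rw [uIoc_of_le ht.le] at hr
    rw [hwy r hr.1 (hr.2.trans_lt htT)]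
  rw [e2, hFTC, hwy t ht htT]
  simp [hy]

end LinearODE

/-! ### Mild solutions frequency by frequency -/

section MildFourier

variable {α γ T μ N K M σ : ℝ} {u₀ : L1} {W F : ℝ → L1}

lemma exp_two_mul_half (μ t m : ℝ) :
    (Real.exp (-(2 * μ * t * m ^ 2 / 2)) : ℂ) = Complex.exp (-((μ * m ^ 2 : ℝ) * t)) := by
  push_cast
  ring_nf

/-- The mild formulation is equivalent to the integrated equation for the Fourier transforms. -/
lemma mild_iff_fourierAt (hμ : 0 < μ) (hF : WHolder α T σ N F) (hα : 0 < α) (hσ : 0 ≤ σ)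
    (hσα : σ + α < 1) (hN : 0 ≤ N) (hW : IntegrableCurve T W) :
    (∀ t, 0 < t → t < T → W t = gradHeat (2 * μ * t) u₀ + heatDuhamel μ F t) ↔
    ∀ t, 0 < t → t < T → ∀ m, fourierAt m (W t) = Complex.I * m *
      (fourierAt m u₀ + Complex.I * m *
        fourierAt m (∫ r in (0 : ℝ)..t, (μ • W r + F r))) := by
  rcases le_or_gt T 0 with hT | hT
  · exact ⟨fun _ t h1 h2 => absurd (h1.trans h2) (not_lt.2 hT),
      fun _ t h1 h2 => absurd (h1.trans h2) (not_lt.2 hT)⟩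
  have hFi := hF.integrableCurve hα hσ (by linarith) hN hT.le
  have hG : IntegrableCurve T fun r => μ • W r + F r :=
    (hW.comp (μ • ContinuousLinearMap.id ℝ L1)).add hFi
  -- At frequency m both formulations concern the scalar equation w' = -m² F̂ - μm² w with w(0) = im
  -- û₀, one in variation of constants form, the other integrated in time.
  have hmild : ∀ m t, 0 < t → t < T →
      fourierAt m (gradHeat (2 * μ * t) u₀ + heatDuhamel μ F t) =
        Complex.exp (-((μ * m ^ 2 : ℝ) * t)) * (Complex.I * m * fourierAt m u₀) +
        ∫ r in (0 : ℝ)..t, (Real.exp (-(μ * m ^ 2 * (t - r))) : ℂ) *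
          (-m ^ 2 * fourierAt m (F r)) := fun m t ht htT => by
    rw [map_add, fourierAt_gradHeat (by positivity),
      fourierAt_heatDuhamel hμ hF hα hσ hσα hN m ht htT, exp_two_mul_half,
      ← intervalIntegral.integral_const_mul]
    congr 1
    · ring
    · refine intervalIntegral.integral_congr fun r _ => ?_
      ring
  have hint : ∀ m t, 0 < t → t < T →
      Complex.I * m * (fourierAt m u₀ + Complex.I * m *
        fourierAt m (∫ r in (0 : ℝ)..t, (μ • W r + F r))) =
      Complex.I * m * fourierAt m u₀ + ∫ r in (0 : ℝ)..t, (-m ^ 2 * fourierAt m (F r) -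
        (μ * m ^ 2 : ℝ) * fourierAt m (W r)) := fun m t ht htT => by
    rw [← ContinuousLinearMap.intervalIntegral_comp_comm _ (hG.mono ht.le htT.le), mul_add,
      ← mul_assoc (Complex.I * m) (Complex.I * m), ← intervalIntegral.integral_const_mul]
    congr 1
    refine intervalIntegral.integral_congr fun r _ => ?_
    simp only [map_add, map_smul, Complex.real_smul]
    push_cast
    linear_combination (m ^ 2 * (μ * fourierAt m (W r) + fourierAt m (F r))) * Complex.I_sq
  have hg : ∀ m : ℝ, IntegrableCurve T fun r => (-m ^ 2 : ℂ) * fourierAt m (F r) := fun m =>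
    ⟨continuousOn_const.mul (hFi.comp (fourierAt m)).continuousOn,
      (hFi.comp (fourierAt m)).intervalIntegrable.const_mul _⟩
  constructor
  · intro h t ht htT m
    rw [hint m t ht htT]
    exact duhamel_integral_eq (q := μ * m ^ 2) (w := fun t => fourierAt m (W t)) (hg m) (fun t ht htT => by rw [h t ht htT, hmild m t ht htT]) ht htT
  · intro h t ht htT
    refine ext_fourierAt fun m => ?_
    rw [hmild m t ht htT]
    exact eq_duhamel_of_integral_eq (hg m) (hW.comp (fourierAt m))
      (fun t ht htT => by rw [h t ht htT, hint m t ht htT]) ht htT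

lemma intervalIntegrable_gradHeat (w : L1) :
    IntervalIntegrable (fun r => gradHeat r w) volume 0 1 := by
  refine intervalIntegrable_of_bound zero_le_one ((continuousOn_gradHeat.clm_apply
    continuousOn_const).mono fun r hr => hr.1)
    ((intervalIntegrable_neg_rpow (by norm_num : (1 / 2 : ℝ) < 1) 0 1).mul_const ‖w‖)
    fun r hr => (norm_gradHeat_le hr.1 w).trans (le_of_eq ?_)
  rw [Real.rpow_neg hr.1.le, Real.sqrt_eq_rpow]

/-- The operator `w ↦ ∫₀¹ ∂ₓ e^{r ∂ₓ²/2} w dr`. -/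
def gradHeatIntegral : L1 →L[ℝ] L1 :=
  LinearMap.mkContinuous
    { toFun := fun w => ∫ r in (0 : ℝ)..1, gradHeat r w
      map_add' := fun f g => by
        simp only [map_add]
        exact intervalIntegral.integral_add (intervalIntegrable_gradHeat f)
          (intervalIntegrable_gradHeat g)
      map_smul' := fun c f => by
        simp only [map_smul, intervalIntegral.integral_smul, RingHom.id_apply] } 2 fun w => by
    refine (norm_integral_le_of_bound zero_le_one
      ((intervalIntegrable_neg_rpow (by norm_num : (1 / 2 : ℝ) < 1) 0 1).mul_const ‖w‖)
      fun r hr => (norm_gradHeat_le hr.1 w).trans (le_of_eq ?_)).trans (le_of_eq ?_)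
    · rw [Real.rpow_neg hr.1.le, Real.sqrt_eq_rpow]
    · rw [intervalIntegral.integral_mul_const, integral_rpow (Or.inl (by norm_num))]
      norm_num

lemma gradHeatIntegral_apply (w : L1) :
    gradHeatIntegral w = ∫ r in (0 : ℝ)..1, gradHeat r w := rfl

/-- When ŵ = imz, the integrand -m² exp(-rm²/2) z is an exact r-derivative, so a function with
derivative w is recovered up to its low frequencies without dividing by m. -/
lemma fourierAt_gradHeatIntegral {w : L1} {z : ℂ} {m : ℝ}
    (h : fourierAt m w = Complex.I * m * z) :
    fourierAt m (gradHeatIntegral w) = -2 * (1 - Real.exp (-(m ^ 2 / 2))) * z := by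
  rw [gradHeatIntegral_apply,
    ← ContinuousLinearMap.intervalIntegral_comp_comm _ (intervalIntegrable_gradHeat w)]
  have h1 : ∫ r in (0 : ℝ)..1, fourierAt m (gradHeat r w) =
      ∫ r in (0 : ℝ)..1, ((2 * (-(m ^ 2 / 2)) * Real.exp (-(m ^ 2 / 2 * r)) : ℝ) : ℂ) * z := by
    refine intervalIntegral.integral_congr_ae (Eventually.of_forall fun r hr => ?_)
    rw [uIoc_of_le zero_le_one] at hr
    rw [fourierAt_gradHeat hr.1, h]
    have e : r * m ^ 2 / 2 = m ^ 2 / 2 * r := by ring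
    rw [e]
    push_cast
    linear_combination (m ^ 2 * Complex.exp (-(m ^ 2 / 2 * r)) * z) * Complex.I_sq
  have h2 := intervalIntegral.integral_eq_sub_of_hasDerivAt (a := 0) (b := 1)
    (fun r _ => hasDerivAt_exp_neg_mul (m ^ 2 / 2) 2 z r)
    (Continuous.intervalIntegrable (by fun_prop) _ _)
  rw [h1]
  have e3 : ∀ r : ℝ, ((2 * (-(m ^ 2 / 2)) * Real.exp (-(m ^ 2 / 2 * r)) : ℝ) : ℂ) * z =
      ((-(2 * (m ^ 2 / 2)) * Real.exp (-(m ^ 2 / 2 * r)) : ℝ) : ℂ) * z := fun r => by ring_nf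
  simp only [e3]
  rw [h2]
  simp only [mul_one, mul_zero, neg_zero, Real.exp_zero]
  push_cast
  ring

/-- The element of `L¹` with derivative `w` that differs from `u₀` by the derivative of `h`. -/
def velocity (u₀ h w : L1) : L1 :=
  heat 1 u₀ + gradHeat 1 h - (1 / 2 : ℝ) • gradHeatIntegral w

/-- The symbol is split as exp(-m²/2) + (1 - exp(-m²/2)): the first part is obtained from u₀ and h
by smoothing, the second from the derivative w. Hence the velocity lies in L¹ although integrating w
directly need not stay there. -/
lemma fourierAt_velocity {u₀ h w : L1} {m : ℝ}
    (hw : fourierAt m w = Complex.I * m * (fourierAt m u₀ + Complex.I * m * fourierAt m h)) :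
    fourierAt m (velocity u₀ h w) = fourierAt m u₀ + Complex.I * m * fourierAt m h := by
  rw [velocity, map_sub, map_add, map_smul, fourierAt_gradHeatIntegral hw,
    fourierAt_heat one_pos, fourierAt_gradHeat one_pos, Complex.real_smul, one_mul]
  push_cast
  ring

end MildFourier

end IsentropicNS

end

noncomputable section

open Filter Topology BoundedContinuousFunction

namespace IsentropicNS

/-! ### Jointly measurable representatives of curves in `L¹` -/

/-- The average is continuous in x and Lipschitz in f with constant n + 1; joint continuity makes
averages of a continuous curve jointly measurable in time and space. -/
lemma continuous_avg (n : ℕ) : Continuous fun z : L1 × ℝ => avg z.1 n z.2 := by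
  refine continuous_prod_of_continuous_lipschitzWith _ (n + 1) (fun f => ?_) fun x => ?_
  · have h := intervalIntegral.continuous_primitive
      (fun a b => (integrable_coe f).intervalIntegrable (a := a) (b := b)) 0
    have e : ∀ x, avg f n x = (n + 1) * ((∫ y in (0 : ℝ)..(x + 1 / (n + 1)), f y) -
        ∫ y in (0 : ℝ)..x, f y) := fun x => by
      rw [avg, intervalIntegral.integral_interval_sub_left] <;>
        exact (integrable_coe f).intervalIntegrable
    simp only [e]
    exact continuous_const.mul ((h.comp (by fun_prop)).sub h)
  · refine LipschitzWith.of_dist_le_mul fun f g => ?_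
    have hx : x ≤ x + 1 / ((n : ℝ) + 1) := by
      have : 0 < 1 / ((n : ℝ) + 1) := by positivity
      linarith
    simp only [avg]
    rw [Real.dist_eq, ← mul_sub, abs_mul, abs_of_pos (by positivity : (0 : ℝ) < n + 1),
      ← intervalIntegral.integral_sub (integrable_coe f).intervalIntegrable
        (integrable_coe g).intervalIntegrable, dist_eq_norm]
    push_cast
    gcongr
    rw [intervalIntegral.integral_of_le hx, norm_eq_integral]
    have h1 : ∀ᵐ y, |f y - g y| = |(f - g : L1) y| := by
      filter_upwards [Lp.coeFn_sub f g] with y hy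
      rw [hy, Pi.sub_apply]
    refine (abs_integral_le_integral_abs).trans ?_
    rw [← integral_congr_ae h1]
    exact setIntegral_le_integral ((integrable_coe f).sub (integrable_coe g)).abs
      (Eventually.of_forall fun y => abs_nonneg _)

lemma measurableSet_strip (T : ℝ) : MeasurableSet (strip T) := measurableSet_Ioo.prod .univ

/-- The representative is the pointwise limit of jointly measurable averages, and Lebesgue
differentiation identifies it at every time, not just at almost every time. -/
lemma exists_representative_curve {T : ℝ} {W : ℝ → L1} (hW : ContinuousOn W (Ioo 0 T)) :
    ∃ w : ℝ → ℝ → ℝ, StronglyMeasurable (Function.uncurry w) ∧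
      ∀ t ∈ Ioo 0 T, w t =ᵐ[volume] W t := by
  classical
  set a : ℕ → ℝ × ℝ → ℝ := fun n => (strip T).piecewise (fun z => avg (W z.1) n z.2) 0 with ha
  have ham : ∀ n, StronglyMeasurable (a n) := fun n => by
    refine Measurable.stronglyMeasurable (ContinuousOn.measurable_piecewise ?_
      continuousOn_const (measurableSet_strip T))
    refine (continuous_avg n).comp_continuousOn (ContinuousOn.prodMk ?_ continuousOn_snd)
    exact hW.comp continuousOn_fst fun z hz => hz.1
  have hm := StronglyMeasurable.limUnder (l := atTop) ham
  refine ⟨fun t x => limUnder atTop fun n => a n (t, x), hm, fun t ht => ?_⟩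
  filter_upwards [avg_ae_tendsto (W t)] with x hx
  have e : ∀ n, a n (t, x) = avg (W t) n x := fun n =>
    piecewise_eq_of_mem _ _ _ (show (t, x) ∈ strip T from ⟨ht, mem_univ x⟩)
  simp only [e]
  exact hx.limUnder_eq

lemma integrableOn_strip {T : ℝ} {W : ℝ → L1} (hW : IntegrableCurve T W) (hT : 0 ≤ T)
    {w : ℝ → ℝ → ℝ} (hw : StronglyMeasurable (Function.uncurry w))
    (h : ∀ t ∈ Ioo 0 T, w t =ᵐ[volume] W t) :
    IntegrableOn (fun z : ℝ × ℝ => w z.1 z.2) (strip T) := by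
  have hi := (intervalIntegrable_iff_integrableOn_Ioo_of_le hT).1 hW.intervalIntegrable
  rw [IntegrableOn, strip, Measure.volume_eq_prod, ← Measure.prod_restrict, Measure.restrict_univ]
  refine (integrable_prod_iff hw.aestronglyMeasurable).2 ⟨?_, ?_⟩
  · filter_upwards [ae_restrict_mem measurableSet_Ioo] with t ht
    exact (integrable_coe (W t)).congr (h t ht).symm
  · refine hi.norm.congr ?_
    filter_upwards [ae_restrict_mem measurableSet_Ioo] with t ht
    rw [norm_eq_integral]
    refine integral_congr_ae ?_
    filter_upwards [h t ht] with x hx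
    rw [Function.uncurry_apply_pair, hx, Real.norm_eq_abs]

/-! ### Pairing with test functions -/

lemma integrable_mul_bcf {f : ℝ → ℝ} (hf : Integrable f) (η : ℝ →ᵇ ℝ) :
    Integrable fun x => f x * η x :=
  hf.mul_bdd (c := ‖η‖) η.continuous.aestronglyMeasurable
    (Eventually.of_forall η.norm_coe_le_norm)

/-- The duality between `L¹` and bounded continuous functions. -/
def pairing : L1 →L[ℝ] (ℝ →ᵇ ℝ) →L[ℝ] ℝ :=
  LinearMap.mkContinuous₂ (LinearMap.mk₂ ℝ (fun (f : L1) (η : ℝ →ᵇ ℝ) => ∫ x, f x * η x)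
    (fun f g η => by
      rw [← integral_add (integrable_mul_bcf (integrable_coe f) η)
        (integrable_mul_bcf (integrable_coe g) η)]
      refine integral_congr_ae ?_
      filter_upwards [Lp.coeFn_add f g] with x hx
      rw [hx, Pi.add_apply, add_mul])
    (fun c f η => by
      rw [smul_eq_mul, ← integral_const_mul]
      refine integral_congr_ae ?_
      filter_upwards [Lp.coeFn_smul c f] with x hx
      rw [hx, Pi.smul_apply, smul_eq_mul, mul_assoc])
    (fun f η θ => by
      rw [← integral_add (integrable_mul_bcf (integrable_coe f) η)
        (integrable_mul_bcf (integrable_coe f) θ)]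
      exact integral_congr_ae (Eventually.of_forall fun x => mul_add _ _ _))
    (fun c f η => by
      rw [smul_eq_mul, ← integral_const_mul]
      refine integral_congr_ae (Eventually.of_forall fun x => ?_)
      simp only [BoundedContinuousFunction.coe_smul, smul_eq_mul]
      ring)) 1 fun f η => by
    rw [one_mul, norm_eq_integral, ← integral_mul_const]
    refine norm_integral_le_of_norm_le ((integrable_coe f).abs.mul_const _)
      (Eventually.of_forall fun x => ?_)
    rw [norm_mul, Real.norm_eq_abs]
    exact mul_le_mul_of_nonneg_left (η.norm_coe_le_norm x) (abs_nonneg _)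

lemma pairing_apply (f : L1) (η : ℝ →ᵇ ℝ) : pairing f η = ∫ x, f x * η x := rfl

lemma norm_pairing_le (f : L1) (η : ℝ →ᵇ ℝ) : ‖pairing f η‖ ≤ ‖f‖ * ‖η‖ := by
  rw [norm_eq_integral, ← integral_mul_const, pairing_apply]
  refine norm_integral_le_of_norm_le ((integrable_coe f).abs.mul_const _)
    (Eventually.of_forall fun x => ?_)
  rw [norm_mul, Real.norm_eq_abs]
  exact mul_le_mul_of_nonneg_left (η.norm_coe_le_norm x) (abs_nonneg _)

/-- A continuous function with compact support as a bounded continuous function. -/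
def compactBCF (η : ℝ → ℝ) (hc : Continuous η) (hs : HasCompactSupport η) : ℝ →ᵇ ℝ :=
  BoundedContinuousFunction.ofNormedAddCommGroup η hc _
    (hs.exists_bound_of_continuous hc).choose_spec

@[simp] lemma compactBCF_apply (η : ℝ → ℝ) (hc : Continuous η) (hs : HasCompactSupport η) (x : ℝ) :
    compactBCF η hc hs x = η x := rfl

lemma hasCompactSupport_slice {η : ℝ × ℝ → ℝ} (hs : HasCompactSupport η) (t : ℝ) :
    HasCompactSupport fun x => η (t, x) := by
  refine HasCompactSupport.intro (hs.isCompact.image continuous_snd) fun x hx => ?_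
  by_contra h
  exact hx ⟨(t, x), subset_tsupport _ h, rfl⟩

/-- The time slices of a compactly supported continuous function. -/
def slice (η : ℝ × ℝ → ℝ) (hc : Continuous η) (hs : HasCompactSupport η) (t : ℝ) : ℝ →ᵇ ℝ :=
  compactBCF (fun x => η (t, x)) (by fun_prop) (hasCompactSupport_slice hs t)

lemma continuous_slice (η : ℝ × ℝ → ℝ) (hc : Continuous η) (hs : HasCompactSupport η) :
    Continuous (slice η hc hs) := by
  have hu := Metric.uniformContinuous_iff.1 (hs.uniformContinuous_of_continuous hc)
  refine Metric.continuous_iff.2 fun t ε hε => ?_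
  obtain ⟨δ, hδ, h⟩ := hu (ε / 2) (half_pos hε)
  refine ⟨δ, hδ, fun s hst => lt_of_le_of_lt ?_ (half_lt_self hε)⟩
  refine (BoundedContinuousFunction.dist_le (half_pos hε).le).2 fun x => (h ?_).le
  simpa [Prod.dist_eq, hδ] using hst

/-- The time derivative of a function on space-time. -/
def timeDeriv (φ : ℝ × ℝ → ℝ) (z : ℝ × ℝ) : ℝ := fderiv ℝ φ z (1, 0)

/-- The space derivative of a function on space-time. -/
def spaceDeriv (φ : ℝ × ℝ → ℝ) (z : ℝ × ℝ) : ℝ := fderiv ℝ φ z (0, 1)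

/-! ### Test functions as curves of bounded continuous functions -/

section TestFunction

variable {T : ℝ} {φ : ℝ × ℝ → ℝ}

lemma IsTestFunction.fderiv_apply (hφ : IsTestFunction T φ) (e : ℝ × ℝ) :
    IsTestFunction T fun z => fderiv ℝ φ z e := by
  refine ⟨?_, hφ.2.1.fderiv_apply ℝ e, (tsupport_fderiv_apply_subset ℝ e).trans hφ.2.2⟩
  exact (hφ.1.fderiv_right (m := ∞) (by simp)).clm_apply contDiff_const

lemma IsTestFunction.timeDeriv (hφ : IsTestFunction T φ) : IsTestFunction T (timeDeriv φ) :=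
  hφ.fderiv_apply _

lemma IsTestFunction.spaceDeriv (hφ : IsTestFunction T φ) : IsTestFunction T (spaceDeriv φ) :=
  hφ.fderiv_apply _

lemma IsTestFunction.hasDerivAt_time (hφ : IsTestFunction T φ) (t x : ℝ) :
    HasDerivAt (fun s => φ (s, x)) (IsentropicNS.timeDeriv φ (t, x)) t := by
  have h := (hφ.1.differentiable (by simp) (t, x)).hasFDerivAt
  exact h.comp_hasDerivAt t ((hasDerivAt_id t).prodMk (hasDerivAt_const t x))

lemma IsTestFunction.hasDerivAt_space (hφ : IsTestFunction T φ) (t x : ℝ) :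
    HasDerivAt (fun y => φ (t, y)) (IsentropicNS.spaceDeriv φ (t, x)) x := by
  have h := (hφ.1.differentiable (by simp) (t, x)).hasFDerivAt
  exact h.comp_hasDerivAt x ((hasDerivAt_const x t).prodMk (hasDerivAt_id x))

lemma IsTestFunction.timeDeriv_spaceDeriv (hφ : IsTestFunction T φ) :
    IsentropicNS.timeDeriv (IsentropicNS.spaceDeriv φ) =
      IsentropicNS.spaceDeriv (IsentropicNS.timeDeriv φ) := by
  ext z
  have hd : DifferentiableAt ℝ (fderiv ℝ φ) z :=
    (hφ.1.fderiv_right (m := ∞) (by simp)).differentiable (by simp) z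
  have hs := (hφ.1.contDiffAt (x := z)).isSymmSndFDerivAt (by
    rw [minSmoothness_of_isRCLikeNormedField]; exact WithTop.coe_le_coe.2 le_top)
  have e : ∀ a b : ℝ × ℝ, fderiv ℝ (fun z => fderiv ℝ φ z a) z b =
      fderiv ℝ (fderiv ℝ φ) z b a := fun a b => by
    rw [fderiv_clm_apply hd (differentiableAt_const a)]
    simp
  change fderiv ℝ (fun z => fderiv ℝ φ z (0, 1)) z (1, 0) =
    fderiv ℝ (fun z => fderiv ℝ φ z (1, 0)) z (0, 1)
  rw [e, e]
  exact hs _ _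

/-- The slices of a test function. -/
def IsTestFunction.slice (hφ : IsTestFunction T φ) (t : ℝ) : ℝ →ᵇ ℝ :=
  IsentropicNS.slice φ hφ.1.continuous hφ.2.1 t

@[simp] lemma IsTestFunction.slice_apply (hφ : IsTestFunction T φ) (t x : ℝ) :
    hφ.slice t x = φ (t, x) := rfl

lemma IsTestFunction.continuous_slice (hφ : IsTestFunction T φ) : Continuous hφ.slice :=
  IsentropicNS.continuous_slice _ hφ.1.continuous hφ.2.1

/-- Differentiability in the sup norm: the slices are the primitive of the norm-continuous curve of
slices of the time derivative, as evaluation at each point shows. -/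
lemma IsTestFunction.hasDerivAt_slice (hφ : IsTestFunction T φ) (t : ℝ) :
    HasDerivAt hφ.slice (hφ.timeDeriv.slice t) t := by
  have hc := hφ.timeDeriv.continuous_slice
  have e : hφ.slice = fun t => hφ.slice 0 + ∫ r in (0 : ℝ)..t, hφ.timeDeriv.slice r := by
    ext t x
    have h1 := ContinuousLinearMap.intervalIntegral_comp_comm
      (BoundedContinuousFunction.evalCLM ℝ x : (ℝ →ᵇ ℝ) →L[ℝ] ℝ) (hc.intervalIntegrable (μ := volume) 0 t)
    have h2 := intervalIntegral.integral_eq_sub_of_hasDerivAt (a := 0) (b := t)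
      (fun s _ => hφ.hasDerivAt_time s x)
      ((hφ.timeDeriv.1.continuous.comp (by fun_prop)).intervalIntegrable _ _)
    have h3 : (∫ r in (0 : ℝ)..t, hφ.timeDeriv.slice r) x = φ (t, x) - φ (0, x) := by
      rw [← h2]; exact h1.symm
    rw [BoundedContinuousFunction.add_apply, h3]
    simp
  rw [e]
  exact (intervalIntegral.integral_hasDerivAt_right (hc.intervalIntegrable _ _)
    (hc.stronglyMeasurableAtFilter _ _) hc.continuousAt).const_add _

lemma IsTestFunction.eq_zero (hφ : IsTestFunction T φ) {t : ℝ} (ht : T ≤ t) (x : ℝ) :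
    φ (t, x) = 0 := by
  by_contra h
  have h1 : t < T := hφ.2.2 (subset_tsupport _ h)
  linarith

lemma IsTestFunction.contDiff_slice (hφ : IsTestFunction T φ) (t : ℝ) :
    ContDiff ℝ ∞ fun x => φ (t, x) := hφ.1.comp (by fun_prop)

lemma IsTestFunction.deriv_slice (hφ : IsTestFunction T φ) (t : ℝ) :
    deriv (fun x => φ (t, x)) = fun x => IsentropicNS.spaceDeriv φ (t, x) :=
  funext fun x => (hφ.hasDerivAt_space t x).deriv

lemma IsTestFunction.intervalIntegrable_pairing (hφ : IsTestFunction T φ) (hT : 0 < T)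
    {Y : ℝ → L1} (hY : IntegrableCurve T Y) (X₀ : L1) :
    IntervalIntegrable (fun t => pairing (X₀ + ∫ r in (0 : ℝ)..t, Y r) (hφ.timeDeriv.slice t) +
      pairing (Y t) (hφ.slice t)) volume 0 T := by
  have hX := hY.continuousOn_primitive hT.le X₀
  have hc1 : ContinuousOn (fun t => pairing (X₀ + ∫ r in (0 : ℝ)..t, Y r)
      (hφ.timeDeriv.slice t)) (Icc 0 T) :=
    (pairing.continuous.comp_continuousOn hX).clm_apply
      hφ.timeDeriv.continuous_slice.continuousOn
  have hc2 : ContinuousOn (fun t => pairing (Y t) (hφ.slice t)) (Ioo 0 T) :=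
    (pairing.continuous.comp_continuousOn hY.continuousOn).clm_apply
      hφ.continuous_slice.continuousOn
  obtain ⟨B, hB⟩ := hφ.2.1.exists_bound_of_continuous hφ.1.continuous
  have hB0 : 0 ≤ B := (norm_nonneg _).trans (hB 0)
  refine (ContinuousOn.intervalIntegrable (by rwa [uIcc_of_le hT.le])).add
    (intervalIntegrable_of_bound hT.le hc2 (hY.intervalIntegrable.norm.mul_const B)
      fun r hr => ?_)
  exact (norm_pairing_le _ _).trans (mul_le_mul_of_nonneg_left
    ((BoundedContinuousFunction.norm_le hB0).2 fun x => hB (r, x)) (norm_nonneg _))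

/-- Integration by parts in time. -/
theorem IsTestFunction.integral_pairing (hφ : IsTestFunction T φ) (hT : 0 < T) {Y : ℝ → L1}
    (hY : IntegrableCurve T Y) (X₀ : L1) :
    ∫ t in Ioo 0 T, (pairing (X₀ + ∫ r in (0 : ℝ)..t, Y r) (hφ.timeDeriv.slice t) +
      pairing (Y t) (hφ.slice t)) = -pairing X₀ (hφ.slice 0) := by
  have hX := hY.continuousOn_primitive hT.le X₀
  have h := intervalIntegral.integral_eq_sub_of_hasDerivAt_of_le hT.le
    (f := fun t => pairing (X₀ + ∫ r in (0 : ℝ)..t, Y r) (hφ.slice t))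
    ((pairing.continuous.comp_continuousOn hX).clm_apply hφ.continuous_slice.continuousOn)
    (fun t ht => ContinuousLinearMap.hasDerivAt_of_bilinear
      (fun _ => hY.hasDerivAt_primitive X₀ ht) fun _ => hφ.hasDerivAt_slice t)
    (hφ.intervalIntegrable_pairing hT hY X₀)
  rw [intervalIntegral.integral_of_le hT.le, integral_Ioc_eq_integral_Ioo] at h
  rw [h]
  have h0 : hφ.slice T = 0 := by
    ext x
    exact hφ.eq_zero le_rfl x
  simp [h0]

end TestFunction

end IsentropicNS

end

noncomputable section

open Filter Topology BoundedContinuousFunction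

namespace IsentropicNS

/-! ### Mild solutions are weak solutions -/

section Strip

variable {T : ℝ} {f : ℝ × ℝ → ℝ}

lemma setIntegral_strip (hf : IntegrableOn f (strip T)) :
    ∫ z in strip T, f z = ∫ t in Ioo 0 T, ∫ x, f (t, x) := by
  have h := setIntegral_prod f (μ := volume) (ν := volume) (s := Ioo 0 T) (t := univ) hf
  rw [← Measure.volume_eq_prod] at h
  simpa [strip] using h

lemma HasCompactSupport.exists_eq_zero {η : ℝ × ℝ → ℝ} (hs : HasCompactSupport η) :
    ∃ R : ℝ, ∀ t x, x ∉ Icc (-R) R → η (t, x) = 0 := by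
  obtain ⟨R, hR⟩ := hs.isCompact.isBounded.exists_norm_le
  refine ⟨R, fun t x hx => ?_⟩
  by_contra h
  have h1 : ‖x‖ ≤ R := (norm_snd_le (t, x)).trans (hR _ (subset_tsupport _ h))
  exact hx (abs_le.1 h1)

lemma LocIntegrableOnStrip.integrableOn_mul (hf : LocIntegrableOnStrip T f) {η : ℝ × ℝ → ℝ}
    (hc : Continuous η) (hs : HasCompactSupport η) :
    IntegrableOn (fun z => f z * η z) (strip T) := by
  obtain ⟨R, hR⟩ := HasCompactSupport.exists_eq_zero hs
  obtain ⟨B, hB⟩ := hs.exists_bound_of_continuous hc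
  have h1 : IntegrableOn (fun z => f z * η z) (Ioo 0 T ×ˢ Icc (-R) R) :=
    (hf R).mul_bdd (c := B) hc.aestronglyMeasurable (Eventually.of_forall hB)
  refine h1.of_forall_sdiff_eq_zero (measurableSet_strip T) fun z hz => ?_
  rw [hR z.1 z.2 fun h => hz.2 ⟨hz.1.1, h⟩, mul_zero]

lemma IntegrableOn.locIntegrableOnStrip (hf : IntegrableOn f (strip T)) :
    LocIntegrableOnStrip T f := fun _ => hf.mono_set (prod_mono le_rfl (subset_univ _))

lemma locIntegrableOnStrip_of_bound {B : ℝ} (hf : AEStronglyMeasurable f volume)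
    (hB : ∀ z, ‖f z‖ ≤ B) : LocIntegrableOnStrip T f := fun R =>
  Measure.integrableOn_of_bounded (by
    rw [Measure.volume_eq_prod, Measure.prod_prod]
    exact ENNReal.mul_ne_top measure_Ioo_lt_top.ne measure_Icc_lt_top.ne) hf
    (Eventually.of_forall hB)

end Strip

/-- The characteristic function of `[-R,R]` as an element of `L¹`. -/
def unitOn (R : ℝ) : L1 :=
  indicatorConstLp 1 (measurableSet_Icc (a := -R) (b := R)) measure_Icc_lt_top.ne (1 : ℝ)

/-- The density 1 + V is not integrable. On the support of a test function the constant 1 may be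
replaced by an indicator, which keeps the pairing inside L¹. -/
lemma add_unitOn_mul_ae (f : L1) {R : ℝ} {η : ℝ → ℝ} (hη : ∀ x, x ∉ Icc (-R) R → η x = 0) :
    ∀ᵐ x, (f + unitOn R : L1) x * η x = (1 + f x) * η x := by
  filter_upwards [Lp.coeFn_add f (unitOn R), indicatorConstLp_coeFn (p := 1) (μ := volume)
    (hs := measurableSet_Icc (a := -R) (b := R)) (hμs := measure_Icc_lt_top.ne) (c := (1 : ℝ))]
    with x h1 h2
  rw [h1, Pi.add_apply, unitOn, h2]
  by_cases hx : x ∈ Icc (-R) R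
  · rw [indicator_of_mem hx, add_comm]
  · rw [hη x hx, mul_zero, mul_zero]

lemma integral_spaceDeriv {T : ℝ} {φ : ℝ × ℝ → ℝ} (hφ : IsTestFunction T φ) (t : ℝ) :
    ∫ x, spaceDeriv φ (t, x) = 0 :=
  integral_eq_zero_of_hasDerivAt_of_integrable (fun x => hφ.hasDerivAt_space t x)
    ((hφ.spaceDeriv.contDiff_slice t).continuous.integrable_of_hasCompactSupport
      (hasCompactSupport_slice hφ.spaceDeriv.2.1 t))
    ((hφ.contDiff_slice t).continuous.integrable_of_hasCompactSupport
      (hasCompactSupport_slice hφ.2.1 t))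

lemma IntegrableCurve.const {E : Type*} [NormedAddCommGroup E] (T : ℝ) (c : E) :
    IntegrableCurve T fun _ => c := ⟨continuousOn_const, intervalIntegrable_const⟩

lemma IntegrableCurve.primitive {E : Type*} [NormedAddCommGroup E] [NormedSpace ℝ E] {T : ℝ}
    {Y : ℝ → E} (hY : IntegrableCurve T Y) (hT : 0 ≤ T) (X₀ : E) :
    IntegrableCurve T fun t => X₀ + ∫ r in (0 : ℝ)..t, Y r :=
  ⟨(hY.continuousOn_primitive hT X₀).mono Ioo_subset_Icc_self,
    ContinuousOn.intervalIntegrable (by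
      rw [uIcc_of_le hT]; exact hY.continuousOn_primitive hT X₀)⟩

/-- Curves in `L¹` that solve the integrated equations give weak solutions. -/
theorem exists_isWeakSolution {T A ν μ : ℝ} (hT : 0 < T) {v₀ u₀ : ℝ → ℝ} {V₀ U₀ : L1}
    (hv₀ : (fun x => v₀ x - 1) =ᵐ[volume] V₀) (hu₀ : u₀ =ᵐ[volume] U₀) {W G : ℝ → L1}
    (hA : 0 ≤ A) (hν : 0 ≤ ν)
    (hW : IntegrableCurve T W) (hG : IntegrableCurve T G)
    (hsmall : ∀ t ∈ Ioo 0 T, ∀ᵐ x, |density V₀ W t x| ≤ 1 / 2)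
    (hflux : ∀ t ∈ Ioo 0 T, ∀ᵐ x, pressure A ν (1 + density V₀ W t x) -
      μ * W t x / (1 + density V₀ W t x) = A - G t x)
    (hfour : ∀ t ∈ Ioo 0 T, ∀ m, fourierAt m (W t) = Complex.I * m *
      (fourierAt m U₀ + Complex.I * m * fourierAt m (∫ r in (0 : ℝ)..t, G r))) :
    ∃ v u ux : ℝ → ℝ → ℝ, IsWeakSolution A ν μ T v₀ u₀ v u ux ∧
      ∀ t ∈ Ioo 0 T, (fun x => v t x - 1) =ᵐ[volume] density V₀ W t ∧ ux t =ᵐ[volume] W t := by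
  have hV : IntegrableCurve T (density V₀ W) := hW.primitive hT.le V₀
  have hH : IntegrableCurve T fun t => ∫ r in (0 : ℝ)..t, G r := by
    simpa using hG.primitive hT.le 0
  set H : ℝ → L1 := fun t => ∫ r in (0 : ℝ)..t, G r with hHdef
  set U : ℝ → L1 := fun t => velocity U₀ (H t) (W t) with hUdef
  have hU : IntegrableCurve T U := by
    have := ((IntegrableCurve.const T (heat 1 U₀)).add (hH.comp (gradHeat 1))).add
      (hW.comp (-((1 / 2 : ℝ) • gradHeatIntegral)))
    convert this using 2 with t
    simp [U, velocity, sub_eq_add_neg]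
  have hUW : ∀ t ∈ Ioo 0 T, IsFourierDeriv (U t) (W t) := fun t ht m => by
    rw [fourierAt_velocity (hfour t ht m), hfour t ht m]
  have hHU : ∀ t ∈ Ioo 0 T, IsFourierDeriv (H t) (U t - U₀) := fun t ht m => by
    rw [map_sub, fourierAt_velocity (hfour t ht m)]; ring
  obtain ⟨r, hrm, hr⟩ := exists_representative_curve hV.continuousOn
  obtain ⟨u, hum, hu⟩ := exists_representative_curve hU.continuousOn
  obtain ⟨w, hwm, hw⟩ := exists_representative_curve hW.continuousOn
  -- Clamping changes each slice only on a null set and makes 1/2 ≤ v ≤ 3/2 hold at every point,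
  -- which gives positivity and integrability of the flux.
  have hv : ∀ t ∈ Ioo 0 T, ∀ᵐ x, clamp (r t x) = density V₀ W t x := fun t ht => by
    filter_upwards [hr t ht, hsmall t ht] with x h1 h2
    rw [h1, clamp_of_mem (abs_le.1 h2)]
  have hvm : StronglyMeasurable fun z : ℝ × ℝ => 1 + clamp (r z.1 z.2) :=
    stronglyMeasurable_const.add (continuous_clamp.comp_stronglyMeasurable hrm)
  have hv1 : ∀ z : ℝ × ℝ, 1 / 2 ≤ 1 + clamp (r z.1 z.2) ∧ 1 + clamp (r z.1 z.2) ≤ 3 / 2 :=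
    fun z => by
    have := clamp_mem (r z.1 z.2)
    constructor <;> linarith [this.1, this.2]
  have hvloc : LocIntegrableOnStrip T fun z : ℝ × ℝ => 1 + clamp (r z.1 z.2) :=
    locIntegrableOnStrip_of_bound (B := 3 / 2) hvm.aestronglyMeasurable fun z => by
      rw [Real.norm_eq_abs, abs_of_pos (by linarith [(hv1 z).1])]
      exact (hv1 z).2
  have huloc := IntegrableOn.locIntegrableOnStrip (integrableOn_strip hU hT.le hum hu)
  have hwloc := IntegrableOn.locIntegrableOnStrip (integrableOn_strip hW hT.le hwm hw)
  have hfloc : LocIntegrableOnStrip T (flux A ν μ (fun t x => 1 + clamp (r t x)) w) := by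
    intro R
    refine Integrable.sub ?_ ?_
    · refine locIntegrableOnStrip_of_bound (B := A * (1 / 2) ^ (-ν))
        ((hvm.measurable.pow_const (-ν)).const_mul A).aestronglyMeasurable (fun z => ?_) R
      have h0 : 0 < 1 + clamp (r z.1 z.2) := by linarith [(hv1 z).1]
      rw [Real.norm_eq_abs, abs_of_nonneg (by positivity)]
      exact mul_le_mul_of_nonneg_left
        (Real.rpow_le_rpow_of_nonpos (by norm_num) (hv1 z).1 (by linarith)) hA
    · simp only [div_eq_mul_inv]
      refine ((hwloc R).const_mul μ).mul_bdd (c := 2)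
        hvm.measurable.inv.aestronglyMeasurable (Eventually.of_forall fun z => ?_)
      have h0 : 0 < 1 + clamp (r z.1 z.2) := by linarith [(hv1 z).1]
      rw [Real.norm_eq_abs, abs_of_pos (by positivity), inv_le_comm₀ h0 two_pos]
      linarith [(hv1 z).1]
  refine ⟨fun t x => 1 + clamp (r t x), u, w, ⟨fun t ht => ?_, fun t ht => ⟨?_, ?_, ?_⟩, hvloc,
    huloc, hwloc, Eventually.of_forall fun z => by linarith [(hv1 z).1], hfloc, fun φ hφ => ?_,
    fun φ hφ => ?_⟩, fun t ht => ⟨?_, hw t ht⟩⟩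
  · exact (hvm.comp_measurable measurable_prodMk_left).aestronglyMeasurable
  · exact ((integrable_coe (U t)).congr (hu t ht).symm).locallyIntegrable
  · exact ((integrable_coe (W t)).congr (hw t ht).symm).locallyIntegrable
  · intro η hη hc
    have := (hUW t ht).integral_mul_deriv hη hc
    have e1 : ∫ x, u t x * deriv η x = ∫ x, U t x * deriv η x :=
      integral_congr_ae (by filter_upwards [hu t ht] with x hx; rw [hx])
    have e2 : ∫ x, w t x * η x = ∫ x, W t x * η x :=
      integral_congr_ae (by filter_upwards [hw t ht] with x hx; rw [hx])
    rw [e1, e2, this]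
  · obtain ⟨R, hR⟩ := HasCompactSupport.exists_eq_zero hφ.2.1
    obtain ⟨R', hR'⟩ := HasCompactSupport.exists_eq_zero hφ.timeDeriv.2.1
    set N := max R R'
    have hN : ∀ t x, x ∉ Icc (-N) N → φ (t, x) = 0 := fun t x hx => hR t x fun h =>
      hx ⟨by linarith [h.1, le_max_left R R'], h.2.trans (le_max_left R R')⟩
    have hN' : ∀ t x, x ∉ Icc (-N) N → timeDeriv φ (t, x) = 0 := fun t x hx => hR' t x fun h =>
      hx ⟨by linarith [h.1, le_max_right R R'], h.2.trans (le_max_right R R')⟩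
    have h1 := hφ.integral_pairing hT hW (V₀ + unitOn N)
    have h2 : pairing (V₀ + unitOn N) (hφ.slice 0) = ∫ x, v₀ x * φ (0, x) := by
      rw [pairing_apply]
      refine integral_congr_ae ?_
      filter_upwards [add_unitOn_mul_ae V₀ (hN 0), hv₀] with x hx1 hx2
      rw [hφ.slice_apply, hx1, ← hx2]
      ring
    have hI : IntegrableOn (fun z : ℝ × ℝ => (1 + clamp (r z.1 z.2)) * timeDeriv φ z -
        u z.1 z.2 * spaceDeriv φ z) (strip T) :=
      (hvloc.integrableOn_mul hφ.timeDeriv.1.continuous hφ.timeDeriv.2.1).sub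
        (huloc.integrableOn_mul hφ.spaceDeriv.1.continuous hφ.spaceDeriv.2.1)
    change (∫ z in strip T, ((1 + clamp (r z.1 z.2)) * timeDeriv φ z -
      u z.1 z.2 * spaceDeriv φ z)) + _ = 0
    rw [setIntegral_strip hI, ← h2, add_eq_zero_iff_eq_neg, ← h1]
    symm
    refine setIntegral_congr_fun measurableSet_Ioo fun t ht => ?_
    have e1 : ∫ x, U t x * spaceDeriv φ (t, x) = -∫ x, W t x * φ (t, x) := by
      have := (hUW t ht).integral_mul_deriv (hφ.contDiff_slice t)
        (hasCompactSupport_slice hφ.2.1 t)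
      rwa [hφ.deriv_slice] at this
    have e2 : ∫ x, ((1 + clamp (r t x)) * timeDeriv φ (t, x) - u t x * spaceDeriv φ (t, x)) =
        ∫ x, ((density V₀ W t + unitOn N : L1) x * hφ.timeDeriv.slice t x -
          U t x * hφ.spaceDeriv.slice t x) := by
      refine integral_congr_ae ?_
      filter_upwards [add_unitOn_mul_ae (density V₀ W t) (hN' t), hv t ht, hu t ht]
        with x hx1 hx2 hx3
      rw [hφ.timeDeriv.slice_apply, hx1, hx2, hx3, hφ.spaceDeriv.slice_apply]
    have e3 : V₀ + unitOn N + ∫ r in (0 : ℝ)..t, W r = density V₀ W t + unitOn N := by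
      rw [density]; abel
    simp only
    rw [e3]
    refine Eq.trans ?_ e2.symm
    rw [integral_sub (integrable_mul_bcf (integrable_coe _) _)
      (integrable_mul_bcf (integrable_coe _) _)]
    simp only [hφ.spaceDeriv.slice_apply, e1, pairing_apply, sub_neg_eq_add, hφ.slice_apply]
  -- The momentum equation uses U = U₀ + ∂ₓH with H = ∫ G: the constant curve U₀ is tested with φ,
  -- the primitive H with ∂ₓφ, and the two identities are subtracted. The constant A in the flux
  -- integrates to zero against ∂ₓφ.
  · have h1 := hφ.integral_pairing hT (IntegrableCurve.const T (0 : L1)) U₀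
    have h1' := hφ.intervalIntegrable_pairing hT (IntegrableCurve.const T (0 : L1)) U₀
    have h2 := hφ.spaceDeriv.integral_pairing hT hG 0
    have h2' := hφ.spaceDeriv.intervalIntegrable_pairing hT hG 0
    simp only [intervalIntegral.integral_zero, add_zero, map_zero, zero_add,
      _root_.zero_apply, neg_zero] at h1 h1' h2 h2'
    rw [intervalIntegrable_iff_integrableOn_Ioo_of_le hT.le] at h1' h2'
    have h3 : pairing U₀ (hφ.slice 0) = ∫ x, u₀ x * φ (0, x) := by
      rw [pairing_apply]
      refine integral_congr_ae ?_
      filter_upwards [hu₀] with x hx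
      rw [hφ.slice_apply, hx]
    have h4 := integral_sub h1' h2'
    rw [h1, h2, sub_zero, h3] at h4
    have hI : IntegrableOn (fun z : ℝ × ℝ => u z.1 z.2 * timeDeriv φ z +
        flux A ν μ (fun t x => 1 + clamp (r t x)) w z * spaceDeriv φ z) (strip T) :=
      (huloc.integrableOn_mul hφ.timeDeriv.1.continuous hφ.timeDeriv.2.1).add
        (hfloc.integrableOn_mul hφ.spaceDeriv.1.continuous hφ.spaceDeriv.2.1)
    change (∫ z in strip T, (u z.1 z.2 * timeDeriv φ z +
      flux A ν μ (fun t x => 1 + clamp (r t x)) w z * spaceDeriv φ z)) + _ = 0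
    rw [setIntegral_strip hI, add_eq_zero_iff_eq_neg, ← h4]
    symm
    refine setIntegral_congr_fun measurableSet_Ioo fun t ht => ?_
    have e1 : ∫ x, H t x * timeDeriv (spaceDeriv φ) (t, x) =
        -∫ x, (U t - U₀ : L1) x * timeDeriv φ (t, x) := by
      have := (hHU t ht).integral_mul_deriv (hφ.timeDeriv.contDiff_slice t)
        (hasCompactSupport_slice hφ.timeDeriv.2.1 t)
      rwa [hφ.timeDeriv.deriv_slice, ← hφ.timeDeriv_spaceDeriv] at this
    have hAi : Integrable fun x => A * hφ.spaceDeriv.slice t x :=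
      ((hφ.spaceDeriv.contDiff_slice t).continuous.integrable_of_hasCompactSupport
        (hasCompactSupport_slice hφ.spaceDeriv.2.1 t)).const_mul A
    have e2 : ∫ x, (u t x * timeDeriv φ (t, x) +
        flux A ν μ (fun t x => 1 + clamp (r t x)) w (t, x) * spaceDeriv φ (t, x)) =
        ∫ x, ((U t - U₀ : L1) x * hφ.timeDeriv.slice t x + U₀ x * hφ.timeDeriv.slice t x +
          (A * hφ.spaceDeriv.slice t x - G t x * hφ.spaceDeriv.slice t x)) := by
      refine integral_congr_ae ?_
      filter_upwards [Lp.coeFn_sub (U t) U₀, hv t ht, hu t ht, hw t ht, hflux t ht]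
        with x hx1 hx2 hx3 hx4 hx5
      simp only [flux]
      rw [hx1, hx2, hx3, hx4, hx5, hφ.timeDeriv.slice_apply, hφ.spaceDeriv.slice_apply,
        Pi.sub_apply]
      ring
    have i : ∀ (f : L1) (η : ℝ →ᵇ ℝ), Integrable fun x => f x * η x := fun f η =>
      integrable_mul_bcf (integrable_coe f) η
    refine Eq.trans ?_ e2.symm
    have i1 : Integrable fun x => (U t - U₀ : L1) x * hφ.timeDeriv.slice t x +
        U₀ x * hφ.timeDeriv.slice t x := (i _ _).add (i _ _)
    have i2 : Integrable fun x => A * hφ.spaceDeriv.slice t x - G t x * hφ.spaceDeriv.slice t x :=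
      hAi.sub (i _ _)
    rw [integral_add i1 i2, integral_add (i _ _) (i _ _),
      integral_sub hAi (i _ _), integral_const_mul]
    simp only [hφ.spaceDeriv.slice_apply, integral_spaceDeriv hφ, hφ.timeDeriv.slice_apply,
      pairing_apply, hφ.spaceDeriv.timeDeriv.slice_apply]
    simp only [hHdef] at e1
    rw [e1]
    ring
  · filter_upwards [hv t ht] with x hx
    rw [hx, add_sub_cancel_left]

end IsentropicNS

end

noncomputable section

open Filter Topology BoundedContinuousFunction

namespace IsentropicNS

/-! ### Weak equations and smooth test functions -/

lemma contDiff_primitive {b : ℝ → ℝ} (hb : ContDiff ℝ ∞ b) (c : ℝ) :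
    ContDiff ℝ ∞ fun t => ∫ s in c..t, b s := by
  have h : ∀ t, HasDerivAt (fun t => ∫ s in c..t, b s) (b t) t := fun t =>
    intervalIntegral.integral_hasDerivAt_right (hb.continuous.intervalIntegrable _ _)
      (hb.continuous.stronglyMeasurableAtFilter _ _) hb.continuous.continuousAt
  refine contDiff_infty_iff_deriv.2 ⟨fun t => (h t).differentiableAt, ?_⟩
  rwa [funext fun t => (h t).deriv]

lemma deriv_primitive {b : ℝ → ℝ} (hb : Continuous b) (c t : ℝ) :
    deriv (fun t => ∫ s in c..t, b s) t = b t :=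
  (intervalIntegral.integral_hasDerivAt_right (hb.intervalIntegrable _ _)
    (hb.stronglyMeasurableAtFilter _ _) hb.continuousAt).deriv

lemma IsCompact.exists_subset_Iic {s : Set ℝ} (hs : IsCompact s) {T : ℝ} (h : s ⊆ Iio T) :
    ∃ t < T, s ⊆ Iic t := by
  rcases s.eq_empty_or_nonempty with rfl | hne
  · exact ⟨T - 1, by linarith, empty_subset _⟩
  · exact ⟨sSup s, h (hs.sSup_mem hne), fun x hx => le_csSup hs.bddAbove hx⟩

/-- The primitive vanishing at T already vanishes near T, since b does; a bump equal to 1 on [-T,T]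
cuts it off at negative times. It may be nonzero at t = 0, as test functions are allowed to be. -/
lemma exists_antiderivative {T : ℝ} (hT : 0 < T) {b : ℝ → ℝ} (hb : ContDiff ℝ ∞ b)
    (hc : HasCompactSupport b) (hs : tsupport b ⊆ Ioo 0 T) :
    ∃ a : ℝ → ℝ, ContDiff ℝ ∞ a ∧ HasCompactSupport a ∧ tsupport a ⊆ Iio T ∧
      ∀ t ∈ Ioo 0 T, deriv a t = b t := by
  obtain ⟨t₁, ht₁, hs₁⟩ := IsCompact.exists_subset_Iic hc.isCompact
    (hs.trans Ioo_subset_Iio_self)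
  let χ : ContDiffBump (0 : ℝ) := ⟨T, T + 1, hT, by linarith⟩
  set a₀ : ℝ → ℝ := fun t => ∫ s in T..t, b s with ha₀
  have hz : ∀ t, t₁ < t → a₀ t = 0 := fun t ht => by
    refine (intervalIntegral.integral_congr fun s hs => ?_).trans intervalIntegral.integral_zero
    by_contra h
    have h1 : s ≤ t₁ := hs₁ (subset_tsupport _ h)
    have h2 := hs.1
    have h3 : min T t ≤ s := h2
    rcases min_choice T t with h' | h' <;> rw [h'] at h3 <;> linarith
  refine ⟨fun t => χ t * a₀ t, χ.contDiff.mul (contDiff_primitive hb T),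
    χ.hasCompactSupport.mul_right, ?_, fun t ht => ?_⟩
  · refine (closure_minimal (fun t ht => ?_) isClosed_Iic : _ ⊆ Iic t₁).trans fun t ht =>
      lt_of_le_of_lt ht ht₁
    by_contra h
    exact ht (by simp only [hz t (not_le.1 h), mul_zero])
  · rw [← deriv_primitive hb.continuous T t]
    refine Filter.EventuallyEq.deriv_eq ?_
    filter_upwards [isOpen_Ioo.mem_nhds ht] with s hs
    rw [χ.one_of_mem_closedBall, one_mul]
    rw [mem_closedBall_zero_iff, Real.norm_eq_abs, abs_of_pos hs.1]
    exact hs.2.le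

/-- Freedom of the test function at t = 0 makes every b a derivative on (0,T), so q vanishes and is
not merely constant. -/
lemma ae_eq_zero_of_integral_deriv_mul {T : ℝ} (hT : 0 < T) {q : ℝ → ℝ}
    (hq : IntegrableOn q (Ioo 0 T))
    (h : ∀ a : ℝ → ℝ, ContDiff ℝ ∞ a → HasCompactSupport a → tsupport a ⊆ Iio T →
      ∫ t in Ioo 0 T, deriv a t * q t = 0) : ∀ᵐ t, t ∈ Ioo 0 T → q t = 0 := by
  refine isOpen_Ioo.ae_eq_zero_of_integral_contDiff_smul_eq_zero hq.locallyIntegrableOn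
    fun b hb hc hs => ?_
  obtain ⟨a, ha, hac, has, hab⟩ := exists_antiderivative hT hb hc hs
  rw [← h a ha hac has, ← setIntegral_eq_integral_of_forall_compl_eq_zero (s := Ioo 0 T)]
  · refine setIntegral_congr_fun measurableSet_Ioo fun t ht => ?_
    simp only [hab t ht, smul_eq_mul]
  · intro t ht
    have : b t = 0 := by
      by_contra h
      exact ht (hs (subset_tsupport _ h))
    rw [this, zero_smul]

/-- A weak scalar evolution equation holds in integrated form. -/
lemma eq_add_integral_of_weak {T : ℝ} (hT : 0 < T) {p r : ℝ → ℝ} {p₀ : ℝ}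
    (hp : IntegrableCurve T p) (hr : IntegrableCurve T r)
    (h : ∀ a : ℝ → ℝ, ContDiff ℝ ∞ a → HasCompactSupport a → tsupport a ⊆ Iio T →
      ∫ t in Ioo 0 T, (deriv a t * p t + a t * r t) = -(a 0 * p₀)) {t : ℝ} (ht : t ∈ Ioo 0 T) :
    p t = p₀ + ∫ s in (0 : ℝ)..t, r s := by
  have hX := hr.continuousOn_primitive hT.le p₀
  set X : ℝ → ℝ := fun t => p₀ + ∫ s in (0 : ℝ)..t, r s with hXdef
  have hXi : IntegrableOn X (Ioo 0 T) :=
    (intervalIntegrable_iff_integrableOn_Ioo_of_le hT.le).1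
      (ContinuousOn.intervalIntegrable (by rwa [uIcc_of_le hT.le]))
  have hpi := (intervalIntegrable_iff_integrableOn_Ioo_of_le hT.le).1 hp.intervalIntegrable
  have hri := (intervalIntegrable_iff_integrableOn_Ioo_of_le hT.le).1 hr.intervalIntegrable
  have h1 : ∀ᵐ t, t ∈ Ioo 0 T → p t - X t = 0 := by
    refine ae_eq_zero_of_integral_deriv_mul hT (hpi.sub hXi) fun a ha hac has => ?_
    have hda : Continuous (deriv a) := (contDiff_infty_iff_deriv.1 ha).2.continuous
    have hm : ∀ {c f : ℝ → ℝ}, Continuous c → HasCompactSupport c → IntegrableOn f (Ioo 0 T) →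
        IntegrableOn (fun t => c t * f t) (Ioo 0 T) := fun hc hcs hf => by
      obtain ⟨B, hB⟩ := hcs.exists_bound_of_continuous hc
      exact hf.bdd_mul (c := B) hc.aestronglyMeasurable (Eventually.of_forall hB)
    have hFTC := intervalIntegral.integral_eq_sub_of_hasDerivAt_of_le hT.le
      (f := fun t => a t * X t) (f' := fun t => deriv a t * X t + a t * r t)
      (ha.continuous.continuousOn.mul hX) (fun t ht =>
        ((ha.differentiable (by simp) t).hasDerivAt).mul (hr.hasDerivAt_primitive p₀ ht))
      ((intervalIntegrable_iff_integrableOn_Ioo_of_le hT.le).2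
        ((hm hda hac.deriv hXi).add (hm ha.continuous hac hri)))
    have haT : a T = 0 := by
      by_contra h'
      exact lt_irrefl T (has (subset_tsupport _ h'))
    rw [intervalIntegral.integral_of_le hT.le, integral_Ioc_eq_integral_Ioo, haT, zero_mul,
      zero_sub] at hFTC
    have i1 : IntegrableOn (fun t => deriv a t * p t + a t * r t) (Ioo 0 T) :=
      (hm hda hac.deriv hpi).add (hm ha.continuous hac hri)
    have i2 : IntegrableOn (fun t => deriv a t * X t + a t * r t) (Ioo 0 T) :=
      (hm hda hac.deriv hXi).add (hm ha.continuous hac hri)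
    have h3 := integral_sub i1 i2
    rw [h a ha hac has, hFTC] at h3
    refine Eq.trans (setIntegral_congr_fun measurableSet_Ioo fun t _ => ?_) (h3.trans ?_)
    · ring
    · simp [hXdef]
  have h2 : p =ᵐ[volume.restrict (Ioo 0 T)] X := by
    refine (ae_restrict_iff' measurableSet_Ioo).2 ?_
    filter_upwards [h1] with s hs hs'
    exact sub_eq_zero.1 (hs hs')
  -- Both sides are continuous in time, so equality almost everywhere holds at every time.
  exact Measure.eqOn_open_of_ae_eq h2 isOpen_Ioo hp.continuousOn
    (hX.mono Ioo_subset_Icc_self) ht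

lemma isTestFunction_mul {T : ℝ} {a η : ℝ → ℝ} (ha : ContDiff ℝ ∞ a) (hac : HasCompactSupport a)
    (has : tsupport a ⊆ Iio T) (hη : ContDiff ℝ ∞ η) (hηc : HasCompactSupport η) :
    IsTestFunction T fun z => a z.1 * η z.2 := by
  refine ⟨(ha.comp contDiff_fst).mul (hη.comp contDiff_snd), ?_, ?_⟩
  · refine HasCompactSupport.intro (hac.isCompact.prod hηc.isCompact) fun z hz => ?_
    by_contra h
    exact hz ⟨subset_tsupport _ (left_ne_zero_of_mul h), subset_tsupport _ (right_ne_zero_of_mul h)⟩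
  · refine (closure_minimal (fun z hz => ?_)
      ((isClosed_tsupport a).preimage continuous_fst)).trans fun z hz => has hz
    exact subset_tsupport _ (left_ne_zero_of_mul hz)

lemma timeDeriv_mul {a η : ℝ → ℝ} (ha : ContDiff ℝ ∞ a) (hη : ContDiff ℝ ∞ η) (t x : ℝ) :
    timeDeriv (fun z => a z.1 * η z.2) (t, x) = deriv a t * η x := by
  have hd : DifferentiableAt ℝ (fun z : ℝ × ℝ => a z.1 * η z.2) (t, x) :=
    ((ha.comp contDiff_fst).mul (hη.comp contDiff_snd)).differentiable (by simp) _
  have h1 := hd.hasFDerivAt.comp_hasDerivAt t ((hasDerivAt_id t).prodMk (hasDerivAt_const t x))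
  exact h1.unique (((ha.differentiable (by simp) t).hasDerivAt).mul_const (η x))

lemma spaceDeriv_mul {a η : ℝ → ℝ} (ha : ContDiff ℝ ∞ a) (hη : ContDiff ℝ ∞ η) (t x : ℝ) :
    spaceDeriv (fun z => a z.1 * η z.2) (t, x) = a t * deriv η x := by
  have hd : DifferentiableAt ℝ (fun z : ℝ × ℝ => a z.1 * η z.2) (t, x) :=
    ((ha.comp contDiff_fst).mul (hη.comp contDiff_snd)).differentiable (by simp) _
  have h1 := hd.hasFDerivAt.comp_hasDerivAt x ((hasDerivAt_const x t).prodMk (hasDerivAt_id x))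
  exact h1.unique (((hη.differentiable (by simp) x).hasDerivAt).const_mul (a t))

lemma ext_integral_mul {f g : L1} (h : ∀ η : ℝ → ℝ, ContDiff ℝ ∞ η → HasCompactSupport η →
    ∫ x, f x * η x = ∫ x, g x * η x) : f = g := by
  refine sub_eq_zero.1 (Lp.ext (EventuallyEq.trans ?_ (Lp.coeFn_zero ℝ 1 volume).symm))
  refine ae_eq_zero_of_integral_contDiff_smul_eq_zero (integrable_coe _).locallyIntegrable
    fun η hη hc => ?_
  have h1 := h η hη hc
  have h2 := congrArg (fun k => pairing k (compactBCF η hη.continuous hc)) (sub_add_cancel f g)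
  simp only [map_add, _root_.add_apply, pairing_apply, compactBCF_apply] at h2
  rw [← h1] at h2
  simpa [mul_comm] using h2

/-! ### From compactly supported to bounded test functions -/

section Cutoff

/-- A smooth bump function. -/
def cutoffBump : ContDiffBump (0 : ℝ) := ⟨1, 2, one_pos, one_lt_two⟩

/-- Smooth cut-off functions exhausting the real line. -/
def cutoff (n : ℕ) (x : ℝ) : ℝ := cutoffBump ((n + 1 : ℝ)⁻¹ * x)

lemma contDiff_cutoff (n : ℕ) : ContDiff ℝ ∞ (cutoff n) :=
  cutoffBump.contDiff.comp (contDiff_const.mul contDiff_id)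

lemma hasCompactSupport_cutoff (n : ℕ) : HasCompactSupport (cutoff n) := by
  have hn : (0 : ℝ) < n + 1 := by positivity
  refine HasCompactSupport.intro (isCompact_closedBall (0 : ℝ) (2 * (n + 1))) fun x hx => ?_
  refine cutoffBump.zero_of_le_dist ?_
  rw [Metric.mem_closedBall, not_le, dist_zero_right, Real.norm_eq_abs] at hx
  rw [dist_zero_right, Real.norm_eq_abs, abs_mul, abs_inv, abs_of_pos hn,
    ← div_eq_inv_mul, le_div_iff₀ hn]
  exact hx.le

/-- The derivative of the rescaled function `x ↦ c (x / (n + 1))`. -/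
lemma hasDerivAt_cutoff {c : ℝ → ℝ} (hc : ContDiff ℝ ∞ c) (n : ℕ) (x : ℝ) :
    HasDerivAt (fun x => c ((n + 1 : ℝ)⁻¹ * x)) ((n + 1 : ℝ)⁻¹ * deriv c ((n + 1 : ℝ)⁻¹ * x)) x := by
  have h := (hc.differentiable (by simp) ((n + 1 : ℝ)⁻¹ * x)).hasDerivAt.scomp x
    ((hasDerivAt_id x).const_mul ((n + 1 : ℝ)⁻¹))
  rw [smul_eq_mul, mul_one] at h
  exact h

lemma tendsto_inv_nat_add_one : Tendsto (fun n : ℕ => (n + 1 : ℝ)⁻¹) atTop (𝓝 0) := by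
  simpa using tendsto_one_div_add_atTop_nhds_zero_nat (𝕜 := ℝ)

lemma tendsto_integral_mul {f : L1} {η : ℕ → ℝ → ℝ} {θ : ℝ → ℝ} {B : ℝ}
    (hη : ∀ n, Continuous (η n)) (hB : ∀ n x, |η n x| ≤ B)
    (h : ∀ x, Tendsto (fun n => η n x) atTop (𝓝 (θ x))) :
    Tendsto (fun n => ∫ x, f x * η n x) atTop (𝓝 (∫ x, f x * θ x)) := by
  refine tendsto_integral_of_dominated_convergence (fun x => |f x| * B)
    (fun n => (integrable_coe f).aestronglyMeasurable.mul (hη n).aestronglyMeasurable)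
    ((integrable_coe f).abs.mul_const B) (fun n => Eventually.of_forall fun x => ?_)
    (Eventually.of_forall fun x => (h x).const_mul _)
  rw [norm_mul, Real.norm_eq_abs, Real.norm_eq_abs]
  gcongr
  exact hB n x

/-- A second order equation against test functions extends to bounded functions. -/
lemma integral_mul_eq_of_bounded {f g h : L1}
    (H : ∀ η : ℝ → ℝ, ContDiff ℝ ∞ η → HasCompactSupport η →
      ∫ x, f x * η x = -(∫ x, g x * deriv η x) + ∫ x, h x * deriv (deriv η) x)
    {θ θ' θ'' : ℝ → ℝ} (hθ : ContDiff ℝ ∞ θ) (h1 : ∀ x, HasDerivAt θ (θ' x) x)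
    (h2 : ∀ x, HasDerivAt θ' (θ'' x) x) (hc2 : Continuous θ'') {B : ℝ} (b0 : ∀ x, |θ x| ≤ B)
    (b1 : ∀ x, |θ' x| ≤ B) (b2 : ∀ x, |θ'' x| ≤ B) :
    ∫ x, f x * θ x = -(∫ x, g x * θ' x) + ∫ x, h x * θ'' x := by
  have hχ : ContDiff ℝ ∞ cutoffBump := cutoffBump.contDiff
  have hχ' : ContDiff ℝ ∞ (deriv cutoffBump) := (contDiff_infty_iff_deriv.1 hχ).2
  have hχ'' : ContDiff ℝ ∞ (deriv (deriv cutoffBump)) := (contDiff_infty_iff_deriv.1 hχ').2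
  have hcs := cutoffBump.hasCompactSupport
  obtain ⟨C₁, hC₁⟩ := hcs.deriv.exists_bound_of_continuous hχ'.continuous
  obtain ⟨C₂, hC₂⟩ := hcs.deriv.deriv.exists_bound_of_continuous hχ''.continuous
  simp only [Real.norm_eq_abs] at hC₁ hC₂
  have hC₁0 : 0 ≤ C₁ := (abs_nonneg _).trans (hC₁ 0)
  have hC₂0 : 0 ≤ C₂ := (abs_nonneg _).trans (hC₂ 0)
  have hB0 : 0 ≤ B := (abs_nonneg _).trans (b0 0)
  have hc1 : Continuous θ' := continuous_iff_continuousAt.2 fun x => (h2 x).continuousAt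
  -- Each derivative falling on the dilated cut-off brings a factor `e n`, which tends to 0; in the
  -- limit only the terms in which all derivatives fall on θ remain, by dominated convergence.
  set e : ℕ → ℝ := fun n => (n + 1 : ℝ)⁻¹ with he
  have he0 : ∀ n, 0 ≤ e n := fun n => by positivity
  have he1 : ∀ n, e n ≤ 1 := fun n => by
    rw [he]
    exact inv_le_one_of_one_le₀ (by linarith [(Nat.cast_nonneg n : (0 : ℝ) ≤ n)])
  set D0 : ℕ → ℝ → ℝ := fun n x => cutoffBump (e n * x) with hD0
  set D1 : ℕ → ℝ → ℝ := fun n x => deriv cutoffBump (e n * x) with hD1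
  set D2 : ℕ → ℝ → ℝ := fun n x => deriv (deriv cutoffBump) (e n * x) with hD2
  have d0 : ∀ n x, HasDerivAt (D0 n) (e n * D1 n x) x := fun n x => hasDerivAt_cutoff hχ n x
  have d1 : ∀ n x, HasDerivAt (D1 n) (e n * D2 n x) x := fun n x => hasDerivAt_cutoff hχ' n x
  have dη : ∀ n, deriv (fun x => D0 n x * θ x) = fun x => e n * D1 n x * θ x + D0 n x * θ' x :=
    fun n => funext fun x => ((d0 n x).mul (h1 x)).deriv
  have dη' : ∀ n, deriv (deriv fun x => D0 n x * θ x) = fun x =>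
      e n * (e n * D2 n x) * θ x + e n * D1 n x * θ' x + (e n * D1 n x * θ' x + D0 n x * θ'' x) :=
    fun n => by
    rw [dη n]
    exact funext fun x => ((((d1 n x).const_mul (e n)).mul (h1 x)).add
      ((d0 n x).mul (h2 x))).deriv
  have k0 : ∀ n x, |D0 n x| ≤ 1 := fun n x => by
    rw [abs_of_nonneg (cutoffBump.nonneg)]; exact cutoffBump.le_one
  have k1 : ∀ n x, |e n * D1 n x| ≤ C₁ := fun n x => by
    rw [abs_mul, abs_of_nonneg (he0 n)]
    exact (mul_le_of_le_one_left (abs_nonneg _) (he1 n)).trans (hC₁ _)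
  have k2 : ∀ n x, |e n * (e n * D2 n x)| ≤ C₂ := fun n x => by
    rw [abs_mul, abs_mul, abs_of_nonneg (he0 n)]
    exact (mul_le_of_le_one_left (mul_nonneg (he0 n) (abs_nonneg _)) (he1 n)).trans
      ((mul_le_of_le_one_left (abs_nonneg _) (he1 n)).trans (hC₂ _))
  have l0 : ∀ x, Tendsto (fun n => D0 n x) atTop (𝓝 1) := fun x => by
    have : Tendsto (fun n => cutoffBump (e n * x)) atTop (𝓝 (cutoffBump (0 * x))) :=
      (hχ.continuous.tendsto _).comp (tendsto_inv_nat_add_one.mul_const x)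
    rwa [zero_mul, cutoffBump.one_of_mem_closedBall (by simp [cutoffBump])] at this
  have l1 : ∀ x, Tendsto (fun n => e n * D1 n x) atTop (𝓝 0) := fun x =>
    squeeze_zero_norm (a := fun n => e n * C₁) (fun n => by
      rw [norm_mul, Real.norm_eq_abs, Real.norm_eq_abs, abs_of_nonneg (he0 n)]
      exact mul_le_mul_of_nonneg_left (hC₁ _) (he0 n))
      (by simpa using tendsto_inv_nat_add_one.mul_const C₁)
  have l2 : ∀ x, Tendsto (fun n => e n * (e n * D2 n x)) atTop (𝓝 0) := fun x =>
    squeeze_zero_norm (a := fun n => e n * C₂) (fun n => by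
      rw [norm_mul, norm_mul, Real.norm_eq_abs, Real.norm_eq_abs, abs_of_nonneg (he0 n)]
      exact mul_le_mul_of_nonneg_left ((mul_le_of_le_one_left (abs_nonneg _) (he1 n)).trans
        (hC₂ _)) (he0 n))
      (by simpa using tendsto_inv_nat_add_one.mul_const C₂)
  have cD0 : ∀ n, Continuous (D0 n) := fun n => hχ.continuous.comp (by fun_prop)
  have cD1 : ∀ n, Continuous (D1 n) := fun n => hχ'.continuous.comp (by fun_prop)
  have cD2 : ∀ n, Continuous (D2 n) := fun n => hχ''.continuous.comp (by fun_prop)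
  have cθ := hθ.continuous
  have mb : ∀ {a b c d : ℝ}, |a| ≤ c → |b| ≤ d → 0 ≤ c → |a * b| ≤ c * d := fun ha hb hc => by
    rw [abs_mul]; exact mul_le_mul ha hb (abs_nonneg _) hc
  have t0 := tendsto_integral_mul (f := f) (η := fun n x => D0 n x * θ x) (θ := θ) (B := 1 * B)
    (fun n => by fun_prop) (fun n x => mb (k0 n x) (b0 x) zero_le_one)
    (fun x => by simpa using (l0 x).mul_const (θ x))
  have t1 := tendsto_integral_mul (f := g) (η := fun n x => e n * D1 n x * θ x + D0 n x * θ' x)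
    (θ := θ') (B := C₁ * B + 1 * B) (fun n => by fun_prop)
    (fun n x => (abs_add_le _ _).trans (add_le_add (mb (k1 n x) (b0 x) hC₁0)
      (mb (k0 n x) (b1 x) zero_le_one)))
    (fun x => by simpa using ((l1 x).mul_const (θ x)).add ((l0 x).mul_const (θ' x)))
  have t2 := tendsto_integral_mul (f := h) (η := fun n x =>
      e n * (e n * D2 n x) * θ x + e n * D1 n x * θ' x + (e n * D1 n x * θ' x + D0 n x * θ'' x))
    (θ := θ'') (B := C₂ * B + C₁ * B + (C₁ * B + 1 * B)) (fun n => by fun_prop)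
    (fun n x => (abs_add_le _ _).trans (add_le_add
      ((abs_add_le _ _).trans (add_le_add (mb (k2 n x) (b0 x) hC₂0) (mb (k1 n x) (b1 x) hC₁0)))
      ((abs_add_le _ _).trans (add_le_add (mb (k1 n x) (b1 x) hC₁0)
        (mb (k0 n x) (b2 x) zero_le_one)))))
    (fun x => by
      simpa using (((l2 x).mul_const (θ x)).add ((l1 x).mul_const (θ' x))).add
        (((l1 x).mul_const (θ' x)).add ((l0 x).mul_const (θ'' x))))
  refine tendsto_nhds_unique t0 ((t1.neg.add t2).congr fun n => ?_)
  have := H (fun x => D0 n x * θ x) ((contDiff_cutoff n).mul hθ)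
    (hasCompactSupport_cutoff n).mul_right
  rw [dη', dη] at this
  exact this.symm

lemma fourierAt_eq_cos_sin (m : ℝ) (f : L1) :
    fourierAt m f = (∫ x, f x * Real.cos (m * x) : ℝ) -
      Complex.I * (∫ x, f x * Real.sin (m * x) : ℝ) := by
  have hi : ∀ {c : ℝ → ℝ}, Continuous c → (∀ x, |c x| ≤ 1) → Integrable fun x => f x * c x :=
    fun hc hb => (integrable_coe f).mul_bdd (c := 1) hc.aestronglyMeasurable
      (Eventually.of_forall hb)
  have h1 := hi (c := fun x => Real.cos (m * x)) (by fun_prop) fun x => Real.abs_cos_le_one _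
  have h2 := hi (c := fun x => Real.sin (m * x)) (by fun_prop) fun x => Real.abs_sin_le_one _
  rw [fourierAt_apply, ← integral_complex_ofReal, ← integral_complex_ofReal,
    ← integral_const_mul, ← integral_sub h1.ofReal (h2.ofReal.const_mul _)]
  refine integral_congr_ae (Eventually.of_forall fun x => ?_)
  simp only
  rw [show (-(m * x : ℝ) * Complex.I : ℂ) = ((-(m * x) : ℝ) : ℂ) * Complex.I by push_cast; ring,
    Complex.exp_mul_I, ← Complex.ofReal_cos, ← Complex.ofReal_sin, Real.cos_neg, Real.sin_neg]
  push_cast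
  ring

/-- The weak identity extends to the bounded functions cos(mx) and sin(mx), whose combination is
exp(-imx). -/
lemma fourierAt_eq_of_weak {f g h : L1}
    (H : ∀ η : ℝ → ℝ, ContDiff ℝ ∞ η → HasCompactSupport η →
      ∫ x, f x * η x = -(∫ x, g x * deriv η x) + ∫ x, h x * deriv (deriv η) x) (m : ℝ) :
    fourierAt m f = Complex.I * m * (fourierAt m g + Complex.I * m * fourierAt m h) := by
  have dl : ∀ x, HasDerivAt (fun x : ℝ => m * x) m x := fun x => by
    simpa using (hasDerivAt_id x).const_mul m
  have ds : ∀ x, HasDerivAt (fun x => Real.sin (m * x)) (m * Real.cos (m * x)) x := fun x => by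
    simpa [mul_comm] using (dl x).sin
  have dc : ∀ x, HasDerivAt (fun x => Real.cos (m * x)) (-m * Real.sin (m * x)) x := fun x => by
    simpa [mul_comm] using (dl x).cos
  have bs : ∀ c x : ℝ, |c * Real.sin (m * x)| ≤ |c| := fun c x => by
    rw [abs_mul]; exact mul_le_of_le_one_right (abs_nonneg _) (Real.abs_sin_le_one _)
  have bc : ∀ c x : ℝ, |c * Real.cos (m * x)| ≤ |c| := fun c x => by
    rw [abs_mul]; exact mul_le_of_le_one_right (abs_nonneg _) (Real.abs_cos_le_one _)
  set B := 1 + |m| + |-m * m| + |m * -m|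
  have p1 := abs_nonneg m
  have p2 := abs_nonneg (-m * m)
  have p3 := abs_nonneg (m * -m)
  have hcos := integral_mul_eq_of_bounded H (θ := fun x => Real.cos (m * x))
    (θ' := fun x => -m * Real.sin (m * x)) (θ'' := fun x => -m * m * Real.cos (m * x)) (B := B)
    (by fun_prop) dc (fun x => by simpa [mul_assoc] using (ds x).const_mul (-m))
    (by fun_prop) (fun x => (Real.abs_cos_le_one _).trans (by simp only [B]; linarith))
    (fun x => (bs _ x).trans (by rw [abs_neg]; simp only [B]; linarith))
    (fun x => (bc _ x).trans (by simp only [B]; linarith))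
  have hsin := integral_mul_eq_of_bounded H (θ := fun x => Real.sin (m * x))
    (θ' := fun x => m * Real.cos (m * x)) (θ'' := fun x => m * -m * Real.sin (m * x)) (B := B)
    (by fun_prop) ds (fun x => by simpa [mul_assoc] using (dc x).const_mul m)
    (by fun_prop) (fun x => (Real.abs_sin_le_one _).trans (by simp only [B]; linarith))
    (fun x => (bc _ x).trans (by simp only [B]; linarith))
    (fun x => (bs _ x).trans (by simp only [B]; linarith))
  have e : ∀ (k : L1) (c : ℝ) (s : ℝ → ℝ), ∫ x, k x * (c * s x) = c * ∫ x, k x * s x :=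
    fun k c s => by
    rw [← integral_const_mul]
    exact integral_congr_ae (Eventually.of_forall fun x => by simp only; ring)
  simp only [e] at hcos hsin
  simp only [fourierAt_eq_cos_sin, hcos, hsin]
  push_cast
  linear_combination (m * (∫ x, g x * Real.sin (m * x) : ℝ) + m * Complex.I * m *
    (∫ x, h x * Real.sin (m * x) : ℝ) - m ^ 2 * (∫ x, h x * Real.cos (m * x) : ℝ) : ℂ) *
    Complex.I_sq

end Cutoff

end IsentropicNS

end

noncomputable section

open Filter Topology BoundedContinuousFunction

namespace IsentropicNS

/-! ### Weak solutions are mild solutions -/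

lemma integrable_mul_of_locallyIntegrable {f η : ℝ → ℝ} (hf : LocallyIntegrable f volume)
    (hη : Continuous η) (hc : HasCompactSupport η) : Integrable fun x => f x * η x := by
  simpa [mul_comm] using hf.integrable_smul_left_of_hasCompactSupport hη hc

section Weak

variable {T A ν μ : ℝ} {v₀ u₀ : ℝ → ℝ} {v u ux v' u' ux' : ℝ → ℝ → ℝ} {V₀ U₀ : L1}
  {V W G : ℝ → L1}

lemma IsWeakSolution.mass_product (hs : IsWeakSolution A ν μ T v₀ u₀ v u ux) {a η : ℝ → ℝ}
    (ha : ContDiff ℝ ∞ a) (hac : HasCompactSupport a) (has : tsupport a ⊆ Iio T)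
    (hη : ContDiff ℝ ∞ η) (hηc : HasCompactSupport η) :
    ∫ t in Ioo 0 T, ∫ x, (v t x * (deriv a t * η x) - u t x * (a t * deriv η x)) =
      -(a 0 * ∫ x, v₀ x * η x) := by
  have hφ := isTestFunction_mul ha hac has hη hηc
  have h := hs.mass _ hφ
  have hI : IntegrableOn (fun z : ℝ × ℝ => v z.1 z.2 * timeDeriv (fun z => a z.1 * η z.2) z -
      u z.1 z.2 * spaceDeriv (fun z => a z.1 * η z.2) z) (strip T) :=
    (hs.locIntegrable_v.integrableOn_mul hφ.timeDeriv.1.continuous hφ.timeDeriv.2.1).sub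
      (hs.locIntegrable_u.integrableOn_mul hφ.spaceDeriv.1.continuous hφ.spaceDeriv.2.1)
  change (∫ z in strip T, (v z.1 z.2 * timeDeriv (fun z => a z.1 * η z.2) z -
    u z.1 z.2 * spaceDeriv (fun z => a z.1 * η z.2) z)) + _ = 0 at h
  rw [setIntegral_strip hI, add_eq_zero_iff_eq_neg] at h
  simp only [timeDeriv_mul ha hη, spaceDeriv_mul ha hη] at h
  rw [h, ← integral_const_mul]
  congr 1
  exact integral_congr_ae (Eventually.of_forall fun x => by ring)

lemma IsWeakSolution.momentum_product (hs : IsWeakSolution A ν μ T v₀ u₀ v u ux) {a η : ℝ → ℝ}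
    (ha : ContDiff ℝ ∞ a) (hac : HasCompactSupport a) (has : tsupport a ⊆ Iio T)
    (hη : ContDiff ℝ ∞ η) (hηc : HasCompactSupport η) :
    ∫ t in Ioo 0 T, ∫ x, (u t x * (deriv a t * η x) +
      flux A ν μ v ux (t, x) * (a t * deriv η x)) = -(a 0 * ∫ x, u₀ x * η x) := by
  have hφ := isTestFunction_mul ha hac has hη hηc
  have h := hs.momentum _ hφ
  have hI : IntegrableOn (fun z : ℝ × ℝ => u z.1 z.2 * timeDeriv (fun z => a z.1 * η z.2) z +
      flux A ν μ v ux z * spaceDeriv (fun z => a z.1 * η z.2) z) (strip T) :=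
    (hs.locIntegrable_u.integrableOn_mul hφ.timeDeriv.1.continuous hφ.timeDeriv.2.1).add
      (hs.locIntegrable_flux.integrableOn_mul hφ.spaceDeriv.1.continuous hφ.spaceDeriv.2.1)
  change (∫ z in strip T, (u z.1 z.2 * timeDeriv (fun z => a z.1 * η z.2) z +
    flux A ν μ v ux z * spaceDeriv (fun z => a z.1 * η z.2) z)) + _ = 0 at h
  rw [setIntegral_strip hI, add_eq_zero_iff_eq_neg] at h
  simp only [timeDeriv_mul ha hη, spaceDeriv_mul ha hη] at h
  rw [h, ← integral_const_mul]
  congr 1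
  exact integral_congr_ae (Eventually.of_forall fun x => by ring)

lemma contDiff_deriv {η : ℝ → ℝ} (hη : ContDiff ℝ ∞ η) : ContDiff ℝ ∞ (deriv η) :=
  (contDiff_infty_iff_deriv.1 hη).2

lemma IsWeakSolution.integral_mul_deriv (hs : IsWeakSolution A ν μ T v₀ u₀ v u ux)
    (hux : ∀ t ∈ Ioo 0 T, ux t =ᵐ[volume] W t) {t : ℝ} (ht : t ∈ Ioo 0 T) {η : ℝ → ℝ}
    (hη : ContDiff ℝ ∞ η) (hηc : HasCompactSupport η) :
    ∫ x, u t x * deriv η x = -∫ x, W t x * η x := by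
  rw [(hs.hasWeakDeriv t ht).2.2 η hη hηc]
  congr 1
  exact integral_congr_ae (by filter_upwards [hux t ht] with x hx; rw [hx])

lemma IntegrableCurve.pairing (hW : IntegrableCurve T W) (η : ℝ →ᵇ ℝ) :
    IntegrableCurve T fun t => pairing (W t) η :=
  hW.comp (IsentropicNS.pairing.flip η)

lemma pairing_integral (hW : IntegrableCurve T W) (η : ℝ →ᵇ ℝ) {t : ℝ} (ht : t ∈ Ioo 0 T) :
    pairing (∫ r in (0 : ℝ)..t, W r) η = ∫ r in (0 : ℝ)..t, pairing (W r) η :=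
  (ContinuousLinearMap.intervalIntegral_comp_comm (pairing.flip η) (hW.mono ht.1.le ht.2.le)).symm

/-- Product test functions a(t)η(x) turn the mass equation into a scalar weak equation in time for
the pairing of 1 + V with η, whose derivative is the pairing of W with η. -/
theorem IsWeakSolution.eq_density (hs : IsWeakSolution A ν μ T v₀ u₀ v u ux) (hT : 0 < T)
    (hv₀ : (fun x => v₀ x - 1) =ᵐ[volume] V₀) (hV : IntegrableCurve T V)
    (hW : IntegrableCurve T W) (hv : ∀ t ∈ Ioo 0 T, (fun x => v t x - 1) =ᵐ[volume] V t)
    (hux : ∀ t ∈ Ioo 0 T, ux t =ᵐ[volume] W t) {t : ℝ} (ht : t ∈ Ioo 0 T) :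
    V t = density V₀ W t := by
  refine ext_integral_mul fun η hη hc => ?_
  have hη' := contDiff_deriv hη
  set θ := compactBCF η hη.continuous hc with hθ
  obtain ⟨R, hR⟩ := hc.isCompact.isBounded.exists_norm_le
  have hηR : ∀ x, x ∉ Icc (-R) R → η x = 0 := fun x hx => by
    by_contra h
    exact hx (abs_le.1 (hR x (subset_tsupport _ h)))
  have hVR : IntegrableCurve T fun t => V t + unitOn R := hV.add (.const T _)
  have hp0 : ∫ x, v₀ x * η x = pairing (V₀ + unitOn R) θ := by
    rw [pairing_apply]
    refine integral_congr_ae ?_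
    filter_upwards [add_unitOn_mul_ae V₀ hηR, hv₀] with x hx1 hx2
    rw [hθ, compactBCF_apply, hx1, ← hx2]
    ring
  have key := eq_add_integral_of_weak hT (hVR.pairing θ) (hW.pairing θ)
    (p₀ := pairing (V₀ + unitOn R) θ) (fun a ha hac has => by
      rw [← hp0, ← hs.mass_product ha hac has hη hc]
      refine setIntegral_congr_fun measurableSet_Ioo fun t ht => ?_
      have e1 : ∫ x, v t x * (deriv a t * η x) = deriv a t * pairing (V t + unitOn R) θ := by
        rw [pairing_apply, ← integral_const_mul]
        refine integral_congr_ae ?_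
        filter_upwards [add_unitOn_mul_ae (V t) hηR, hv t ht] with x hx1 hx2
        rw [hθ, compactBCF_apply, hx1, ← hx2]
        ring
      have i1 : Integrable fun x => v t x * (deriv a t * η x) := by
        refine ((integrable_mul_bcf (integrable_coe (V t + unitOn R)) θ).const_mul
          (deriv a t)).congr ?_
        filter_upwards [add_unitOn_mul_ae (V t) hηR, hv t ht] with x hx1 hx2
        rw [hθ, compactBCF_apply, hx1, ← hx2]
        ring
      have i2 : Integrable fun x => u t x * (a t * deriv η x) :=
        integrable_mul_of_locallyIntegrable (hs.hasWeakDeriv t ht).1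
          (continuous_const.mul hη'.continuous) hc.deriv.mul_left
      have e2 : ∫ x, u t x * (a t * deriv η x) = -(a t * pairing (W t) θ) := by
        rw [pairing_apply, ← mul_neg]
        simp only [hθ, compactBCF_apply]
        rw [← hs.integral_mul_deriv hux ht hη hc, ← integral_const_mul]
        exact integral_congr_ae (Eventually.of_forall fun x => by ring)
      rw [integral_sub i1 i2, e1, e2, sub_neg_eq_add]) ht
  rw [← pairing_integral hW θ ht, map_add, map_add] at key
  simp only [_root_.add_apply] at key
  change pairing (V t) θ = pairing (density V₀ W t) θ
  rw [density, map_add, _root_.add_apply]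
  linarith

/-- The momentum equation is tested with a(t)η'(x), so that u enters only through W. No
integrability of u over the whole line is available here, whereas W and G are curves in L¹. -/
theorem IsWeakSolution.fourierAt_eq (hs : IsWeakSolution A ν μ T v₀ u₀ v u ux) (hT : 0 < T)
    (hu₀ : u₀ =ᵐ[volume] U₀) (hW : IntegrableCurve T W) (hG : IntegrableCurve T G)
    (hux : ∀ t ∈ Ioo 0 T, ux t =ᵐ[volume] W t)
    (hflux : ∀ t ∈ Ioo 0 T, ∀ᵐ x, flux A ν μ v ux (t, x) = A - G t x) {t : ℝ}
    (ht : t ∈ Ioo 0 T) (m : ℝ) :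
    fourierAt m (W t) = Complex.I * m *
      (fourierAt m U₀ + Complex.I * m * fourierAt m (∫ r in (0 : ℝ)..t, G r)) := by
  refine fourierAt_eq_of_weak (fun η hη hc => ?_) m
  have hη' := contDiff_deriv hη
  have hη'' := contDiff_deriv hη'
  set θ := compactBCF η hη.continuous hc with hθ
  set θ₁ := compactBCF (deriv η) hη'.continuous hc.deriv with hθ₁
  set θ₂ := compactBCF (deriv (deriv η)) hη''.continuous hc.deriv.deriv with hθ₂
  have hp0 : ∫ x, u₀ x * deriv η x = pairing U₀ θ₁ := by
    rw [pairing_apply]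
    refine integral_congr_ae ?_
    filter_upwards [hu₀] with x hx
    rw [hθ₁, compactBCF_apply, hx]
  have hz : ∫ x, deriv (deriv η) x = 0 :=
    integral_eq_zero_of_hasDerivAt_of_integrable
      (fun x => (hη'.differentiable (by simp) x).hasDerivAt)
      (hη''.continuous.integrable_of_hasCompactSupport hc.deriv.deriv)
      (hη'.continuous.integrable_of_hasCompactSupport hc.deriv)
  have hneg : ∀ {Y : ℝ → L1}, IntegrableCurve T Y → IntegrableCurve T fun t => -Y t := fun hY =>
    ⟨hY.continuousOn.neg, hY.intervalIntegrable.neg⟩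
  have key := eq_add_integral_of_weak hT ((hneg hW).pairing θ) ((hneg hG).pairing θ₂)
    (p₀ := pairing U₀ θ₁) (fun a ha hac has => by
      rw [← hp0, ← hs.momentum_product ha hac has hη' hc.deriv]
      refine setIntegral_congr_fun measurableSet_Ioo fun t ht => ?_
      have i1 : Integrable fun x => u t x * (deriv a t * deriv η x) :=
        integrable_mul_of_locallyIntegrable (hs.hasWeakDeriv t ht).1
          (continuous_const.mul hη'.continuous) hc.deriv.mul_left
      have e1 : ∫ x, u t x * (deriv a t * deriv η x) = deriv a t * pairing (-W t) θ := by
        rw [map_neg, _root_.neg_apply, pairing_apply]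
        simp only [hθ, compactBCF_apply]
        rw [← hs.integral_mul_deriv hux ht hη hc, ← integral_const_mul]
        exact integral_congr_ae (Eventually.of_forall fun x => by ring)
      have i2 : Integrable fun x => (a t * A) * deriv (deriv η) x :=
        (hη''.continuous.integrable_of_hasCompactSupport hc.deriv.deriv).const_mul _
      have i3 : Integrable fun x => a t * (G t x * deriv (deriv η) x) :=
        (integrable_mul_bcf (integrable_coe (G t)) θ₂).const_mul _
      have h23 : (fun x => a t * A * deriv (deriv η) x - a t * (G t x * deriv (deriv η) x))
          =ᵐ[volume] fun x => flux A ν μ v ux (t, x) * (a t * deriv (deriv η) x) := by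
        filter_upwards [hflux t ht] with x hx
        rw [hx]
        ring
      have e2 : ∫ x, flux A ν μ v ux (t, x) * (a t * deriv (deriv η) x) =
          a t * pairing (-G t) θ₂ := by
        rw [← integral_congr_ae h23, integral_sub i2 i3, integral_const_mul, integral_const_mul,
          hz, map_neg, _root_.neg_apply, pairing_apply]
        simp only [hθ₂, compactBCF_apply]
        ring
      rw [integral_add i1 ((i2.sub i3).congr h23), e1, e2]) ht
  simp only [map_neg, _root_.neg_apply, intervalIntegral.integral_neg] at key
  rw [← pairing_integral hG θ₂ ht] at key
  change pairing (W t) θ = -pairing U₀ θ₁ + pairing (∫ r in (0 : ℝ)..t, G r) θ₂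
  linarith

end Weak

/-- A locally integrable function with vanishing weak derivative and one vanishing mean is zero. -/
lemma ae_eq_zero_of_integral_mul_deriv {d η₀ : ℝ → ℝ} (hd : LocallyIntegrable d volume)
    (hη₀ : ContDiff ℝ ∞ η₀) (hc₀ : HasCompactSupport η₀) (h1 : ∫ x, η₀ x = 1)
    (h0 : ∫ x, d x * η₀ x = 0)
    (h : ∀ η : ℝ → ℝ, ContDiff ℝ ∞ η → HasCompactSupport η → ∫ x, d x * deriv η x = 0) :
    d =ᵐ[volume] 0 := by
  refine ae_eq_zero_of_integral_contDiff_smul_eq_zero hd fun η hη hc => ?_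
  set c := ∫ x, η x
  -- Subtracting c η₀ makes the mean zero, so that the primitive of θ has compact support and is an
  -- admissible test function.
  set θ : ℝ → ℝ := fun x => η x - c * η₀ x with hθ
  have hθd : ContDiff ℝ ∞ θ := hη.sub (contDiff_const.mul hη₀)
  have hi : Integrable η := hη.continuous.integrable_of_hasCompactSupport hc
  have hi₀ : Integrable η₀ := hη₀.continuous.integrable_of_hasCompactSupport hc₀
  have hθ0 : ∫ x, θ x = 0 := by
    rw [hθ, integral_sub hi (hi₀.const_mul c), integral_const_mul, h1, mul_one, sub_self]
  obtain ⟨R, hR⟩ := (hc.isCompact.union hc₀.isCompact).isBounded.exists_norm_le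
  have hθR : ∀ x, x ∉ Icc (-R) R → θ x = 0 := fun x hx => by
    have h2 : ∀ {k : ℝ → ℝ}, tsupport k ⊆ tsupport η ∪ tsupport η₀ → k x = 0 := fun hk => by
      by_contra h3
      exact hx (abs_le.1 (hR x (hk (subset_tsupport _ h3))))
    rw [hθ]
    simp only [h2 subset_union_left, h2 subset_union_right, mul_zero, sub_zero]
  have hζ := h (fun x => ∫ s in (-R)..x, θ s) (contDiff_primitive hθd _) (by
    refine HasCompactSupport.intro (isCompact_Icc (a := -R) (b := R)) fun x hx => ?_
    have hint : ∀ a b, IntervalIntegrable θ volume a b := fun a b =>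
      hθd.continuous.intervalIntegrable a b
    rcases lt_or_ge x (-R) with hx1 | hx1
    · refine (intervalIntegral.integral_congr_ae (g := fun _ => 0)
        (Eventually.of_forall fun s hs => ?_)).trans intervalIntegral.integral_zero
      rw [uIoc_of_ge hx1.le] at hs
      rcases eq_or_lt_of_le hs.2 with rfl | hs2
      · by_contra h3
        have hopen : IsOpen {s | θ s ≠ 0} := isOpen_ne_fun hθd.continuous continuous_const
        obtain ⟨ε, hε, hball⟩ := Metric.isOpen_iff.1 hopen _ h3
        have h4 : -R - ε / 2 ∈ Metric.ball (-R) ε := by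
          rw [Metric.mem_ball, Real.dist_eq, abs_lt]; constructor <;> linarith
        exact hball h4 (hθR _ fun h5 => by linarith [h5.1])
      · exact hθR s fun h5 => by linarith [h5.1]
    · have hx2 : R < x := by
        by_contra h3
        exact hx ⟨hx1, not_lt.1 h3⟩
      rw [intervalIntegral.integral_of_le hx1, ← hθ0]
      refine setIntegral_eq_integral_of_ae_compl_eq_zero ?_
      have hne : ∀ᵐ s : ℝ, s ≠ -R := by simp [ae_iff]
      filter_upwards [hne] with s hs1 hs2
      refine hθR s fun h5 => hs2 ⟨lt_of_le_of_ne h5.1 (Ne.symm hs1), h5.2.trans hx2.le⟩)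
  rw [funext fun x => deriv_primitive hθd.continuous (-R) x] at hζ
  have e : ∫ x, d x * θ x = (∫ x, d x * η x) - c * ∫ x, d x * η₀ x := by
    rw [← integral_const_mul, ← integral_sub
      (integrable_mul_of_locallyIntegrable hd hη.continuous hc)
      ((integrable_mul_of_locallyIntegrable hd hη₀.continuous hc₀).const_mul c)]
    exact integral_congr_ae (Eventually.of_forall fun x => by simp only [hθ]; ring)
  rw [hζ, h0, mul_zero, sub_zero] at e
  simpa [mul_comm] using e.symm

lemma LocIntegrableOnStrip.aestronglyMeasurable {T : ℝ} {f : ℝ × ℝ → ℝ}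
    (hf : LocIntegrableOnStrip T f) : AEStronglyMeasurable f (volume.restrict (strip T)) := by
  have h := aestronglyMeasurable_iUnion_iff.2 fun n : ℕ =>
    (hf n).aestronglyMeasurable
  refine h.mono_measure (Measure.restrict_mono (fun z hz => ?_) le_rfl)
  obtain ⟨n, hn⟩ := exists_nat_ge |z.2|
  exact mem_iUnion.2 ⟨n, hz.1, abs_le.1 hn⟩

/-- Slicewise equality gives joint equality by Fubini, but only for a measurable set; the difference
is therefore replaced by a measurable modification first. -/
lemma LocIntegrableOnStrip.ae_eq {T : ℝ} {f g : ℝ → ℝ → ℝ}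
    (hf : LocIntegrableOnStrip T fun z => f z.1 z.2)
    (hg : LocIntegrableOnStrip T fun z => g z.1 z.2)
    (h : ∀ᵐ t, t ∈ Ioo 0 T → f t =ᵐ[volume] g t) :
    ∀ᵐ z ∂(volume.restrict (strip T)), f z.1 z.2 = g z.1 z.2 := by
  have hm := hf.aestronglyMeasurable.sub hg.aestronglyMeasurable
  have hvol : volume.restrict (strip T) =
      (volume.restrict (Ioo (0 : ℝ) T)).prod (volume : Measure ℝ) := by
    rw [strip, Measure.volume_eq_prod, ← Measure.prod_restrict, Measure.restrict_univ]
  rw [hvol] at hm ⊢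
  have h1 := Measure.ae_ae_of_ae_prod hm.ae_eq_mk
  have h2 : ∀ᵐ z ∂(volume.restrict (Ioo (0 : ℝ) T)).prod (volume : Measure ℝ),
      hm.mk _ z = 0 := by
    rw [Measure.ae_prod_iff_ae_ae (measurableSet_eq_fun hm.stronglyMeasurable_mk.measurable
      measurable_const)]
    filter_upwards [h1, (ae_restrict_iff' measurableSet_Ioo).2 h] with t ht1 ht2
    filter_upwards [ht1, ht2] with x hx1 hx2
    rw [← hx1]
    simp [hx2]
  filter_upwards [h2, hm.ae_eq_mk] with z hz1 hz2
  rw [hz1] at hz2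
  exact sub_eq_zero.1 hz2

/-- Weak solutions with the same density and velocity gradient coincide. -/
theorem IsWeakSolution.ae_eq {T A ν μ : ℝ} {v₀ u₀ : ℝ → ℝ} {v u ux v' u' ux' : ℝ → ℝ → ℝ}
    (hs : IsWeakSolution A ν μ T v₀ u₀ v u ux) (hs' : IsWeakSolution A ν μ T v₀ u₀ v' u' ux')
    (hT : 0 < T) (hv : ∀ t ∈ Ioo 0 T, v' t =ᵐ[volume] v t)
    (hux : ∀ t ∈ Ioo 0 T, ux' t =ᵐ[volume] ux t) :
    ∀ᵐ z ∂(volume.restrict (strip T)), v' z.1 z.2 = v z.1 z.2 ∧ u' z.1 z.2 = u z.1 z.2 := by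
  refine (hs'.locIntegrable_v.ae_eq hs.locIntegrable_v (Eventually.of_forall hv)).and
    (hs'.locIntegrable_u.ae_eq hs.locIntegrable_u ?_)
  set η₀ : ℝ → ℝ := cutoffBump.normed volume with hη₀def
  have hη₀ : ContDiff ℝ ∞ η₀ := cutoffBump.contDiff_normed
  have hc₀ : HasCompactSupport η₀ := cutoffBump.hasCompactSupport_normed
  have hd : LocIntegrableOnStrip T fun z => u' z.1 z.2 - u z.1 z.2 := fun R =>
    (hs'.locIntegrable_u R).sub (hs.locIntegrable_u R)
  have hdl : ∀ t ∈ Ioo 0 T, LocallyIntegrable (fun x => u' t x - u t x) := fun t ht =>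
    (hs'.hasWeakDeriv t ht).1.sub (hs.hasWeakDeriv t ht).1
  have hsub : ∀ t ∈ Ioo 0 T, ∀ η : ℝ → ℝ, Continuous η → HasCompactSupport η →
      ∫ x, (u' t x - u t x) * η x = (∫ x, u' t x * η x) - ∫ x, u t x * η x :=
    fun t ht η hη hc => by
    rw [← integral_sub (integrable_mul_of_locallyIntegrable (hs'.hasWeakDeriv t ht).1 hη hc)
      (integrable_mul_of_locallyIntegrable (hs.hasWeakDeriv t ht).1 hη hc)]
    exact integral_congr_ae (Eventually.of_forall fun x => by ring)
  have hqi : IntegrableOn (fun t => ∫ x, (u' t x - u t x) * η₀ x) (Ioo 0 T) := by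
    have hi : IntegrableOn (fun z : ℝ × ℝ => (u' z.1 z.2 - u z.1 z.2) * η₀ z.2) (strip T) := by
      obtain ⟨R, hR⟩ := hc₀.isCompact.isBounded.exists_norm_le
      obtain ⟨B, hB⟩ := hc₀.exists_bound_of_continuous hη₀.continuous
      have h1 : IntegrableOn (fun z : ℝ × ℝ => (u' z.1 z.2 - u z.1 z.2) * η₀ z.2)
          (Ioo 0 T ×ˢ Icc (-R) R) :=
        (hd R).mul_bdd (c := B)
          (hη₀.continuous.comp continuous_snd).aestronglyMeasurable
          (Eventually.of_forall fun z => hB z.2)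
      refine h1.of_forall_sdiff_eq_zero (measurableSet_strip T) fun z hz => ?_
      have : η₀ z.2 = 0 := by
        by_contra h
        exact hz.2 ⟨hz.1.1, abs_le.1 (hR _ (subset_tsupport _ h))⟩
      rw [this, mul_zero]
    rw [IntegrableOn, strip, Measure.volume_eq_prod, ← Measure.prod_restrict,
      Measure.restrict_univ] at hi
    exact hi.integral_prod_left
  -- The two velocities have the same spatial derivative, so they differ by a function of time. Its
  -- mean against η₀ vanishes because both momentum equations have the same flux and the same
  -- initial data.
  have hq := ae_eq_zero_of_integral_deriv_mul hT hqi fun a ha hac has => by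
    have hη₀' := contDiff_deriv hη₀
    have m1 := hs.momentum_product ha hac has hη₀ hc₀
    have m2 := hs'.momentum_product ha hac has hη₀ hc₀
    have hφ := isTestFunction_mul ha hac has hη₀ hc₀
    have hI : ∀ {v u ux : ℝ → ℝ → ℝ}, IsWeakSolution A ν μ T v₀ u₀ v u ux →
        IntegrableOn (fun t => ∫ x, (u t x * (deriv a t * η₀ x) +
          flux A ν μ v ux (t, x) * (a t * deriv η₀ x))) (Ioo 0 T) := fun {v u ux} hs => by
      have hI : IntegrableOn (fun z : ℝ × ℝ =>
          u z.1 z.2 * timeDeriv (fun z => a z.1 * η₀ z.2) z +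
          flux A ν μ v ux z * spaceDeriv (fun z => a z.1 * η₀ z.2) z) (strip T) :=
        (hs.locIntegrable_u.integrableOn_mul hφ.timeDeriv.1.continuous hφ.timeDeriv.2.1).add
          (hs.locIntegrable_flux.integrableOn_mul hφ.spaceDeriv.1.continuous hφ.spaceDeriv.2.1)
      rw [IntegrableOn, strip, Measure.volume_eq_prod, ← Measure.prod_restrict,
        Measure.restrict_univ] at hI
      have := hI.integral_prod_left
      simp only [timeDeriv_mul ha hη₀, spaceDeriv_mul ha hη₀] at this
      exact this
    have hfl : ∀ᵐ t ∂volume.restrict (Ioo 0 T),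
        Integrable fun x => flux A ν μ v ux (t, x) * (a t * deriv η₀ x) := by
      have hJ := hs.locIntegrable_flux.integrableOn_mul hφ.spaceDeriv.1.continuous
        hφ.spaceDeriv.2.1
      rw [IntegrableOn, strip, Measure.volume_eq_prod, ← Measure.prod_restrict,
        Measure.restrict_univ] at hJ
      have := hJ.prod_right_ae
      simp only [spaceDeriv_mul ha hη₀] at this
      exact this
    have m3 := integral_sub (hI hs') (hI hs)
    rw [m1, m2, sub_self] at m3
    refine (integral_congr_ae ?_).trans m3
    filter_upwards [hfl, ae_restrict_mem measurableSet_Ioo] with t hft ht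
    have i : ∀ {v u ux : ℝ → ℝ → ℝ}, IsWeakSolution A ν μ T v₀ u₀ v u ux →
        Integrable fun x => u t x * (deriv a t * η₀ x) := fun hs =>
      integrable_mul_of_locallyIntegrable (hs.hasWeakDeriv t ht).1
        (continuous_const.mul hη₀.continuous) hc₀.mul_left
    have hff : (fun x => flux A ν μ v ux (t, x) * (a t * deriv η₀ x)) =ᵐ[volume]
        fun x => flux A ν μ v' ux' (t, x) * (a t * deriv η₀ x) := by
      filter_upwards [hv t ht, hux t ht] with x h1 h2
      simp only [flux, h1, h2]
    have e : ∀ u : ℝ → ℝ → ℝ, ∫ x, u t x * (deriv a t * η₀ x) =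
        deriv a t * ∫ x, u t x * η₀ x := fun u => by
      rw [← integral_const_mul]
      exact integral_congr_ae (Eventually.of_forall fun x => by ring)
    rw [integral_add (i hs') (hft.congr hff), integral_add (i hs) hft, ← integral_congr_ae hff,
      add_sub_add_right_eq_sub, e, e, hsub t ht _ hη₀.continuous hc₀, mul_sub]
  filter_upwards [hq] with t hqt ht
  have h3 := ae_eq_zero_of_integral_mul_deriv (hdl t ht) hη₀ hc₀ (cutoffBump.integral_normed)
    (hqt ht) fun η hη hc => by
      rw [hsub t ht _ (contDiff_deriv hη).continuous hc.deriv, (hs'.hasWeakDeriv t ht).2.2 η hη hc,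
        (hs.hasWeakDeriv t ht).2.2 η hη hc, sub_eq_zero]
      congr 1
      refine integral_congr_ae ?_
      filter_upwards [hux t ht] with x hx
      rw [hx]
  filter_upwards [h3] with x hx
  exact sub_eq_zero.1 hx

end IsentropicNS

end

noncomputable section

open Filter Topology

namespace IsentropicNS

/-! ### The space-time norms in terms of curves in `L¹` -/

section TimeNorm

variable {N : (ℝ → ℝ) → ℝ≥0∞} {α T σ K : ℝ} {f : ℝ → ℝ → ℝ} {F : ℝ → L1}

lemma ofReal_mul_le {c K : ℝ} {x : ℝ≥0∞} (hc : 0 ≤ c) {d : ℝ} (hcd : c * d = 1)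
    (h : x ≤ ENNReal.ofReal (K * d)) : ENNReal.ofReal c * x ≤ ENNReal.ofReal K := by
  refine (mul_le_mul_right h _).trans (le_of_eq ?_)
  rw [← ENNReal.ofReal_mul hc]
  congr 1
  linear_combination K * hcd

lemma le_ofReal_mul {c K : ℝ} {x : ℝ≥0∞} {d : ℝ} (hd : 0 ≤ d) (hcd : c * d = 1)
    (h : ENNReal.ofReal c * x ≤ ENNReal.ofReal K) : x ≤ ENNReal.ofReal (K * d) := by
  have h1 := mul_le_mul_right h (ENNReal.ofReal d)
  rwa [← mul_assoc, ← ENNReal.ofReal_mul hd, mul_comm d c, hcd, ENNReal.ofReal_one, one_mul,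
    ← ENNReal.ofReal_mul hd, mul_comm d K] at h1

lemma rpow_mul_rpow_neg_eq_one {s : ℝ} (hs : 0 < s) (σ : ℝ) : s ^ σ * s ^ (-σ) = 1 := by
  rw [← Real.rpow_add hs, add_neg_cancel, Real.rpow_zero]

lemma holder_weight_eq_one {s h : ℝ} (hs : 0 < s) (hh : 0 < h) (σ α : ℝ) :
    s ^ (σ + α) / h ^ α * (s ^ (-(σ + α)) * h ^ α) = 1 := by
  have h1 := rpow_mul_rpow_neg_eq_one hs (σ + α)
  have h2 : h ^ α ≠ 0 := by positivity
  field_simp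
  exact h1

lemma timeNorm_le (hK : 0 ≤ K)
    (h1 : ∀ s, 0 < s → s < T → N (f s) ≤ ENNReal.ofReal (K * s ^ (-σ)))
    (h2 : ∀ s t, 0 < s → s < t → t < T → N (fun x => f t x - f s x) ≤
      ENNReal.ofReal (K * (s ^ (-(σ + α)) * (t - s) ^ α))) :
    timeNorm N α T σ f ≤ ENNReal.ofReal (2 * K) := by
  rw [two_mul, ENNReal.ofReal_add hK hK, timeNorm]
  gcongr
  · refine iSup₂_le fun s hs => ?_
    have := hs.1
    exact ofReal_mul_le (by positivity) (rpow_mul_rpow_neg_eq_one hs.1 σ) (h1 s hs.1 hs.2)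
  · refine iSup₂_le fun s hs => iSup₂_le fun t ht => ?_
    have h3 := hs.1
    have h4 : 0 < t - s := sub_pos.2 ht.1
    exact ofReal_mul_le (by positivity) (holder_weight_eq_one h3 h4 σ α) (h2 s t h3 ht.1 ht.2)

lemma le_of_timeNorm_le (h : timeNorm N α T σ f ≤ ENNReal.ofReal K) :
    (∀ s, 0 < s → s < T → N (f s) ≤ ENNReal.ofReal (K * s ^ (-σ))) ∧
    ∀ s t, 0 < s → s < t → t < T → N (fun x => f t x - f s x) ≤
      ENNReal.ofReal (K * (s ^ (-(σ + α)) * (t - s) ^ α)) := by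
  refine ⟨fun s hs hsT => ?_, fun s t hs hst htT => ?_⟩
  · refine le_ofReal_mul (c := s ^ σ) (by positivity)
      (rpow_mul_rpow_neg_eq_one hs σ) (le_trans ?_ (le_self_add.trans h))
    exact le_iSup₂ (f := fun s (_ : s ∈ Ioo 0 T) => ENNReal.ofReal (s ^ σ) * N (f s)) s ⟨hs, hsT⟩
  · have hh : 0 < t - s := sub_pos.2 hst
    refine le_ofReal_mul (c := s ^ (σ + α) / (t - s) ^ α) (by positivity)
      (holder_weight_eq_one hs hh σ α) (le_trans ?_ (le_add_self.trans h))
    refine le_trans ?_ (le_iSup₂ (f := fun s (_ : s ∈ Ioo 0 T) => ⨆ t ∈ Ioo s T,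
      ENNReal.ofReal (s ^ (σ + α) / (t - s) ^ α) * N (fun x => f t x - f s x)) s
      ⟨hs, hst.trans htT⟩)
    exact le_iSup₂ (f := fun t (_ : t ∈ Ioo s T) =>
      ENNReal.ofReal (s ^ (σ + α) / (t - s) ^ α) * N (fun x => f t x - f s x)) t ⟨hst, htT⟩

lemma eLpNorm_one_eq {f : ℝ → ℝ} {F : L1} (h : f =ᵐ[volume] F) :
    eLpNorm f 1 volume = ENNReal.ofReal ‖F‖ := by
  rw [eLpNorm_congr_ae h, Lp.norm_def, ENNReal.ofReal_toReal (Lp.eLpNorm_ne_top F)]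

lemma sub_ae_eq {f g : ℝ → ℝ} {F G : L1} (hf : f =ᵐ[volume] F) (hg : g =ᵐ[volume] G) :
    (fun x => f x - g x) =ᵐ[volume] (F - G : L1) := by
  filter_upwards [hf, hg, Lp.coeFn_sub F G] with x h1 h2 h3
  rw [h1, h2, h3, Pi.sub_apply]

lemma WHolder.xNorm_one_le (hF : WHolder α T σ K F) (hK : 0 ≤ K)
    (hf : ∀ t ∈ Ioo 0 T, f t =ᵐ[volume] F t) :
    xNorm α T σ 1 f ≤ ENNReal.ofReal (2 * K) := by
  refine timeNorm_le hK (fun s hs hsT => ?_) fun s t hs hst htT => ?_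
  · rw [eLpNorm_one_eq (hf s ⟨hs, hsT⟩)]
    exact ENNReal.ofReal_le_ofReal (hF.bound s hs hsT)
  · rw [eLpNorm_one_eq (sub_ae_eq (hf t ⟨hs.trans hst, htT⟩) (hf s ⟨hs, hst.trans htT⟩))]
    exact ENNReal.ofReal_le_ofReal (hF.holder s t hs hst htT)

lemma WHolderBV.bvTimeNorm_le (hF : WHolderBV α T σ K F) (hK : 0 ≤ K)
    (hf : ∀ t ∈ Ioo 0 T, f t =ᵐ[volume] F t) :
    bvTimeNorm α T σ f ≤ ENNReal.ofReal (2 * K) :=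
  timeNorm_le hK (fun s hs hsT => (hF.hasBV hs hsT).bvNorm_le (hf s ⟨hs, hsT⟩))
    fun s t hs hst htT => (hF.hasBV_sub hs hst htT).bvNorm_le
      (sub_ae_eq (hf t ⟨hs.trans hst, htT⟩) (hf s ⟨hs, hst.trans htT⟩))

lemma WHolderBV.xNorm_top_le (hF : WHolderBV α T σ K F) (hK : 0 ≤ K)
    (hf : ∀ t ∈ Ioo 0 T, f t =ᵐ[volume] F t) :
    xNorm α T σ ∞ f ≤ ENNReal.ofReal (2 * K) := by
  have key : ∀ {g : ℝ → ℝ} {G : L1} {k : ℝ}, g =ᵐ[volume] G → HasBV k G →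
      eLpNorm g ∞ volume ≤ ENNReal.ofReal k := fun hg hG => by
    rw [eLpNorm_exponent_top]
    refine eLpNormEssSup_le_of_ae_bound ?_
    filter_upwards [hg, hG.ae_abs_le] with x h1 h2
    rwa [h1, Real.norm_eq_abs]
  exact timeNorm_le hK (fun s hs hsT => key (hf s ⟨hs, hsT⟩) (hF.hasBV hs hsT))
    fun s t hs hst htT => key
      (sub_ae_eq (hf t ⟨hs.trans hst, htT⟩) (hf s ⟨hs, hst.trans htT⟩))
      (hF.hasBV_sub hs hst htT)

lemma wHolder_of_xNorm_le (hf : ∀ t ∈ Ioo 0 T, f t =ᵐ[volume] F t) (hK : 0 ≤ K)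
    (h : xNorm α T σ 1 f ≤ ENNReal.ofReal K) :
    WHolder α T σ K F := by
  obtain ⟨h1, h2⟩ := le_of_timeNorm_le h
  refine ⟨fun s hs hsT => ?_, fun s t hs hst htT => ?_⟩
  · have := h1 s hs hsT
    rwa [eLpNorm_one_eq (hf s ⟨hs, hsT⟩), ENNReal.ofReal_le_ofReal_iff (by positivity)] at this
  · have := h2 s t hs hst htT
    have hh : 0 < t - s := sub_pos.2 hst
    rwa [eLpNorm_one_eq (sub_ae_eq (hf t ⟨hs.trans hst, htT⟩) (hf s ⟨hs, hst.trans htT⟩)),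
      ENNReal.ofReal_le_ofReal_iff (by positivity)] at this

lemma wHolderBV_of_bvTimeNorm_le (hf : ∀ t ∈ Ioo 0 T, f t =ᵐ[volume] F t) (hK : 0 ≤ K)
    (h : bvTimeNorm α T σ f ≤ ENNReal.ofReal K) :
    WHolderBV α T σ K F := by
  obtain ⟨h1, h2⟩ := le_of_timeNorm_le h
  refine .of_hasBV (fun s hs hsT => .of_bvNorm_le (by positivity) (hf s ⟨hs, hsT⟩) (h1 s hs hsT))
    fun s t hs hst htT => ?_
  have hh : 0 < t - s := sub_pos.2 hst
  exact .of_bvNorm_le (by positivity)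
    (sub_ae_eq (hf t ⟨hs.trans hst, htT⟩) (hf s ⟨hs, hst.trans htT⟩)) (h2 s t hs hst htT)

lemma exists_curve_of_xNorm_le (hm : ∀ t ∈ Ioo 0 T, AEStronglyMeasurable (f t) volume)
    (h : xNorm α T σ 1 f ≤ ENNReal.ofReal K) :
    ∃ F : ℝ → L1, ∀ t ∈ Ioo 0 T, f t =ᵐ[volume] F t := by
  have h1 := (le_of_timeNorm_le h).1
  have : ∀ t, ∃ F : L1, t ∈ Ioo 0 T → f t =ᵐ[volume] F := fun t => by
    by_cases ht : t ∈ Ioo 0 T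
    · have hL : MemLp (f t) 1 volume :=
        ⟨hm t ht, (h1 t ht.1 ht.2).trans_lt ENNReal.ofReal_lt_top⟩
      exact ⟨hL.toLp (f t), fun _ => hL.coeFn_toLp.symm⟩
    · exact ⟨0, fun h => absurd h ht⟩
  choose F hF using this
  exact ⟨F, hF⟩

end TimeNorm

/-- The initial data as elements of `L¹`. -/
lemma exists_dataBound {γ M : ℝ} {v₀ u₀ : ℝ → ℝ} (hM : 0 ≤ M)
    (hv : AEStronglyMeasurable v₀ volume) (hu : AEStronglyMeasurable u₀ volume)
    (h : dataSize γ v₀ u₀ ≤ ENNReal.ofReal M) :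
    ∃ V₀ U₀ : L1, (fun x => v₀ x - 1) =ᵐ[volume] V₀ ∧ u₀ =ᵐ[volume] U₀ ∧
      DataBound γ M V₀ U₀ := by
  rw [dataSize, sobolevNorm] at h
  have h1 : eLpNorm (fun x => v₀ x - 1) 1 volume ≤ ENNReal.ofReal M :=
    (le_self_add.trans le_self_add).trans h
  have h2 : bvNorm (fun x => v₀ x - 1) ≤ ENNReal.ofReal M :=
    (le_add_self.trans le_self_add).trans h
  have h3 : eLpNorm u₀ 1 volume ≤ ENNReal.ofReal M := (le_self_add.trans le_add_self).trans h
  have h4 : homSobolevNorm (2 * γ) u₀ ≤ ENNReal.ofReal M :=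
    (le_add_self.trans le_add_self).trans h
  have hL : MemLp (fun x => v₀ x - 1) 1 volume :=
    ⟨hv.sub aestronglyMeasurable_const, h1.trans_lt ENNReal.ofReal_lt_top⟩
  have hL' : MemLp u₀ 1 volume := ⟨hu, h3.trans_lt ENNReal.ofReal_lt_top⟩
  have e1 := hL.coeFn_toLp.symm
  have e2 := hL'.coeFn_toLp.symm
  rw [homSobolevNorm_congr e2] at h4
  rw [eLpNorm_one_eq e1, ENNReal.ofReal_le_ofReal_iff hM] at h1
  exact ⟨_, _, e1, e2, h1, .of_bvNorm_le hM e1 h2, integrable_translateNorm h4,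
    translateNorm_le hM h4⟩

/-- The viscosity at v = 1 and the deviation from it are separated: the flux is A - (μW + F), and
the constant A plays no role under ∂ₓ. -/
lemma flux_eq {A ν μ L : ℝ} {V W : L1}
    (hφ : SmoothNonlinearity L fun z => viscousPart μ (clamp z))
    (hψ : SmoothNonlinearity L fun z => pressurePart A ν (clamp z))
    (hV : ∀ᵐ x, |V x| ≤ 1 / 2) :
    ∀ᵐ x, pressure A ν (1 + V x) - μ * W x / (1 + V x) =
      A - (μ • W + nonlin (fun z => viscousPart μ (clamp z))
        (fun z => pressurePart A ν (clamp z)) V W : L1) x := by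
  filter_upwards [hV, hφ.nonlin_ae hψ V W, Lp.coeFn_smul μ W,
    Lp.coeFn_add (μ • W) (nonlin (fun z => viscousPart μ (clamp z))
      (fun z => pressurePart A ν (clamp z)) V W)] with x h1 h2 h3 h4
  rw [h4, Pi.add_apply, h2, h3, Pi.smul_apply, clamp_of_mem (abs_le.1 h1), pressure, viscousPart,
    pressurePart, smul_eq_mul]
  ring

/-- T is chosen through T^(1/2-γ) = ε, so one small parameter governs both the length of the time
interval and the size of the data. -/
lemma exists_small_time {γ ε : ℝ} (hγ : γ ≤ 1 / 100) (hε : 0 < ε) (hε1 : ε < 1) :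
    ∃ T ∈ Ioo (0 : ℝ) 1, T ^ (1 / 2 - γ) = ε := by
  have h : 0 < 1 / 2 - γ := by linarith
  refine ⟨ε ^ (1 / 2 - γ)⁻¹, ⟨by positivity, Real.rpow_lt_one hε.le hε1 (by positivity)⟩, ?_⟩
  rw [← Real.rpow_mul hε.le, inv_mul_cancel₀ h.ne', Real.rpow_one]

lemma exists_small {Q d : ℝ} (hQ : 0 ≤ Q) (hd : 0 < d) : ∃ ε, 0 < ε ∧ ε < 1 ∧ Q * ε ≤ d := by
  refine ⟨min (1 / 2) (d / (Q + 1)), by positivity, (min_le_left _ _).trans_lt (by norm_num), ?_⟩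
  calc Q * min (1 / 2) (d / (Q + 1)) ≤ (Q + 1) * (d / (Q + 1)) := by
        gcongr
        · linarith
        · exact min_le_right _ _
    _ = d := by field_simp

/-- Local well-posedness, in terms of the constants of the fixed point argument. -/
theorem exists_unique_weakSolution {α γ T μ A ν L M K b K' b' : ℝ} (hp : Admissible α γ T)
    (hμ : 0 < μ) (hA : 0 ≤ A) (hν : 0 ≤ ν)
    (hφ : SmoothNonlinearity L fun z => viscousPart μ (clamp z))
    (hψ : SmoothNonlinearity L fun z => pressurePart A ν (clamp z))
    (hM : 0 ≤ M) (hK : 0 ≤ K) (hbK : M + K / γ * T ^ γ ≤ b)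
    (hstab : layerConst μ γ * M +
      solverConst α γ μ * (L * (5 * b * K + 2 * b * T ^ (1 / 2 - γ))) ≤ K)
    (hbK' : M + K' / γ * T ^ γ ≤ b') (hb' : b' ≤ 1 / 2)
    (hcontr : solverConst α γ μ * (L * (2 * b' + 6 * K' + 4 * T ^ (1 / 2 - γ))) ≤ 1 / 2)
    (hbb : b ≤ b') (hKK : 6 * (b + K) ≤ K') {v₀ u₀ : ℝ → ℝ}
    (hv₀ : AEStronglyMeasurable v₀ volume) (hu₀ : AEStronglyMeasurable u₀ volume)
    (hdata : dataSize γ v₀ u₀ ≤ ENNReal.ofReal M) :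
    ∃ v u ux : ℝ → ℝ → ℝ, IsWeakSolution A ν μ T v₀ u₀ v u ux ∧
      yNorm α T (fun t x => v t x - 1) + velocityNorm α γ T ux ≤ ENNReal.ofReal K' ∧
      ∀ v' u' ux' : ℝ → ℝ → ℝ, IsWeakSolution A ν μ T v₀ u₀ v' u' ux' →
        yNorm α T (fun t x => v' t x - 1) + velocityNorm α γ T ux' ≤ ENNReal.ofReal K' →
        ∀ᵐ z ∂(volume.restrict (strip T)), v' z.1 z.2 = v z.1 z.2 ∧ u' z.1 z.2 = u z.1 z.2 := by
  have hp' := hp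
  obtain ⟨hα, hαγ, hγ, hT, hT1⟩ := hp'
  have hγ0 : 0 < γ := hα.trans hαγ
  have hL := hφ.nonneg
  have hS := solverConst_nonneg hp hμ
  have hb0 : 0 ≤ b := le_trans (by positivity) hbK
  have hK'0 : 0 ≤ K' := le_trans (by positivity) hKK
  have hb'0 : 0 ≤ b' := hb0.trans hbb
  have hKK' : K ≤ K' := by linarith
  obtain ⟨V₀, U₀, hV₀, hU₀, hd⟩ := exists_dataBound hM hv₀ hu₀ hdata
  set φ : ℝ → ℝ := fun z => viscousPart μ (clamp z)
  set ψ : ℝ → ℝ := fun z => pressurePart A ν (clamp z)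
  have hball : ∀ {W}, InBall α γ T K' W → InDensityBall α T b' (density V₀ W) := fun hW => by
    have := hW.inDensityBall hp hK'0 hd.norm_le hd.hasBV
    exact ⟨this.l1.mono hbK', this.bv.mono hbK'⟩
  have hcurve : ∀ {W}, InBall α γ T K' W → IntegrableCurve T W := fun hW =>
    hW.l1.integrableCurve hα (by linarith) (by linarith) hK'0 hT.le
  have hN := fun {W} (hW : InBall α γ T K' W) =>
    (nonlin_inBall hp hφ hψ (hball hW) hW hb' hb'0 hK'0).l1
  have hN0 : 0 ≤ L * (5 * b' * K' + 2 * b' * T ^ (1 / 2 - γ)) := by positivity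
  have hG : ∀ {W}, InBall α γ T K' W →
      IntegrableCurve T fun t => μ • W t + nonlin φ ψ (density V₀ W t) (W t) := fun hW =>
    ((hcurve hW).comp (μ • ContinuousLinearMap.id ℝ L1)).add
      ((hN hW).integrableCurve hα (by linarith) (by linarith) hN0 hT.le)
  have hsmall : ∀ {W}, InBall α γ T K' W → ∀ t ∈ Ioo 0 T, ∀ᵐ x, |density V₀ W t x| ≤ 1 / 2 :=
    fun hW t ht => ((hball hW).abs_le ht.1 ht.2).mono fun x hx => hx.trans hb'
  have hiff := fun {W} (hW : InBall α γ T K' W) => mild_iff_fourierAt (u₀ := U₀) hμ (hN hW) hα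
    (by linarith) (by linarith) hN0 (hcurve hW)
  -- Existence takes place in the ball of radius K, uniqueness in the larger ball of radius K'.
  -- Three norms of V and three of W, each at most twice its radius, sum to 6(b + K) ≤ K', so the
  -- constructed solution lies in the uniqueness class.
  obtain ⟨W, hWK, hWm⟩ := exists_mildSolution hp hμ hφ hψ hd hK hbK (hbb.trans hb') hstab
    (le_trans (by gcongr) hcontr)
  have hW : InBall α γ T K' W := ⟨hWK.l1.mono hKK', hWK.bv.mono hKK'⟩
  have hVK : InDensityBall α T b (density V₀ W) := by
    have := hWK.inDensityBall hp hK hd.norm_le hd.hasBV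
    exact ⟨this.l1.mono hbK, this.bv.mono hbK⟩
  obtain ⟨v, u, ux, hs, hrep⟩ := exists_isWeakSolution hT hV₀ hU₀ hA hν (hcurve hW) (hG hW)
    (hsmall hW) (fun t ht => flux_eq hφ hψ (hsmall hW t ht))
    fun t ht m => (hiff hW).1 hWm t ht.1 ht.2 m
  refine ⟨v, u, ux, hs, ?_, fun v' u' ux' hs' hnorm => ?_⟩
  · have hv : ∀ t ∈ Ioo 0 T, (fun x => v t x - 1) =ᵐ[volume] density V₀ W t :=
      fun t ht => (hrep t ht).1
    have hux : ∀ t ∈ Ioo 0 T, ux t =ᵐ[volume] W t := fun t ht => (hrep t ht).2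
    have n1 := hVK.l1.xNorm_one_le hb0 hv
    have n2 := hVK.bv.xNorm_top_le hb0 hv
    have n3 := hVK.bv.bvTimeNorm_le hb0 hv
    have n4 := hWK.bv.xNorm_top_le hK hux
    have n5 := hWK.l1.xNorm_one_le hK hux
    have n6 := hWK.bv.bvTimeNorm_le hK hux
    refine (add_le_add (add_le_add (add_le_add n1 n2) n3)
      (add_le_add (add_le_add n4 n5) n6)).trans ?_
    rw [← ENNReal.ofReal_add (by positivity) (by positivity),
      ← ENNReal.ofReal_add (by positivity) (by positivity),
      ← ENNReal.ofReal_add (by positivity) (by positivity),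
      ← ENNReal.ofReal_add (by positivity) (by positivity),
      ← ENNReal.ofReal_add (by positivity) (by positivity)]
    exact ENNReal.ofReal_le_ofReal (by linarith)
  -- Three of the six norms suffice: L¹ for V, and L¹ and BV for W. The BV bound of V follows once V
  -- is known to be the primitive of W.
  · rw [yNorm, velocityNorm] at hnorm
    have n1 : xNorm α T 0 1 (fun t x => v' t x - 1) ≤ ENNReal.ofReal K' :=
      (le_self_add.trans (le_self_add.trans le_self_add)).trans hnorm
    have n5 : xNorm α T (1 / 2 - γ) 1 ux' ≤ ENNReal.ofReal K' :=
      (le_add_self.trans (le_self_add.trans le_add_self)).trans hnorm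
    have n6 : bvTimeNorm α T (1 - γ) ux' ≤ ENNReal.ofReal K' :=
      (le_add_self.trans le_add_self).trans hnorm
    obtain ⟨V', hV'⟩ := exists_curve_of_xNorm_le (f := fun t x => v' t x - 1) (fun t ht =>
      (hs'.aestronglyMeasurable_slice t ht).sub aestronglyMeasurable_const) n1
    obtain ⟨W', hW'⟩ := exists_curve_of_xNorm_le (fun t ht =>
      (hs'.hasWeakDeriv t ht).2.1.aestronglyMeasurable) n5
    have hB' : InBall α γ T K' W' := ⟨wHolder_of_xNorm_le hW' hK'0 n5,
      wHolderBV_of_bvTimeNorm_le hW' hK'0 n6⟩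
    have hVc := (wHolder_of_xNorm_le hV' hK'0 n1).integrableCurve hα le_rfl zero_lt_one hK'0 hT.le
    have hVd : ∀ t ∈ Ioo 0 T, V' t = density V₀ W' t := fun t ht =>
      hs'.eq_density hT hV₀ hVc (hcurve hB') hV' hW' ht
    have hfl : ∀ t ∈ Ioo 0 T, ∀ᵐ x, flux A ν μ v' ux' (t, x) =
        A - (μ • W' t + nonlin φ ψ (density V₀ W' t) (W' t) : L1) x := fun t ht => by
      filter_upwards [flux_eq (W := W' t) hφ hψ (hsmall hB' t ht), hV' t ht, hW' t ht]
        with x h1 h2 h3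
      rw [hVd t ht] at h2
      rw [← h1, ← h2, ← h3, flux, add_sub_cancel]
    have hWm' := (hiff hB').2 fun t ht htT m =>
      hs'.fourierAt_eq hT hU₀ (hcurve hB') (hG hB') hW' hfl ⟨ht, htT⟩ m
    have hWW : ∀ t, 0 < t → t < T → W' t = W t := fun t ht htT =>
      mildSolution_unique hp hμ hφ hψ hd hK'0 hbK' hb' hcontr hB' hW hWm' hWm ht htT
    refine hs.ae_eq hs' hT (fun t ht => ?_) fun t ht => ?_
    · have hdd : density V₀ W' t = density V₀ W t := by
        rw [density, density]
        congr 1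
        refine intervalIntegral.integral_congr_ae (Eventually.of_forall fun r hr => ?_)
        rw [uIoc_of_le ht.1.le] at hr
        exact hWW r hr.1 (hr.2.trans_lt ht.2)
      filter_upwards [hV' t ht, (hrep t ht).1] with x h1 h2
      rw [hVd t ht, hdd, ← h2] at h1
      exact sub_left_injective h1
    · have h1 := hW' t ht
      rw [hWW t ht.1 ht.2] at h1
      exact h1.trans (hrep t ht).2.symm

end IsentropicNS

end

/-! ### Choice of the constants -/

theorem theorem3p1 (γ α A ν μ : ℝ) (hα : 0 < α) (hαγ : α < γ) (hγ : γ ≤ 1 / 100)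
    (hA : 0 < A) (hν : 1 ≤ ν) (hν' : ν < Real.exp 1) (hμ : 0 < μ) :
    ∃ ε₀ ∈ Ioo (0 : ℝ) 1, ∃ T ∈ Ioo (0 : ℝ) 1, ∃ C : ℝ, 0 < C ∧
      ∀ v₀ u₀ : ℝ → ℝ, AEStronglyMeasurable v₀ volume → AEStronglyMeasurable u₀ volume →
        IsentropicNS.dataSize γ v₀ u₀ ≤ ENNReal.ofReal ε₀ →
        ∃ v u ux : ℝ → ℝ → ℝ,
          IsentropicNS.IsWeakSolution A ν μ T v₀ u₀ v u ux ∧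
          IsentropicNS.yNorm α T (fun t x => v t x - 1) + IsentropicNS.velocityNorm α γ T ux
            ≤ ENNReal.ofReal C * IsentropicNS.dataSize γ v₀ u₀ ∧
          ∀ v' u' ux' : ℝ → ℝ → ℝ,
            IsentropicNS.IsWeakSolution A ν μ T v₀ u₀ v' u' ux' →
            IsentropicNS.yNorm α T (fun t x => v' t x - 1) + IsentropicNS.velocityNorm α γ T ux'
              ≤ ENNReal.ofReal C * IsentropicNS.dataSize γ v₀ u₀ →
            (∀ᵐ z ∂(volume.restrict (IsentropicNS.strip T)),
              v' z.1 z.2 = v z.1 z.2 ∧ u' z.1 z.2 = u z.1 z.2) := by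
  obtain ⟨L₁, hL₁⟩ := IsentropicNS.exists_smoothNonlinearity_viscousPart μ
  obtain ⟨L₂, hL₂⟩ := IsentropicNS.exists_smoothNonlinearity_pressurePart A ν
  set L := max L₁ L₂
  have hφ := hL₁.mono (le_max_left L₁ L₂)
  have hψ := hL₂.mono (le_max_right L₁ L₂)
  have hL : 0 ≤ L := hφ.nonneg
  have hγ0 : 0 < γ := hα.trans hαγ
  set c := IsentropicNS.layerConst μ γ
  have hc : 0 < c := IsentropicNS.layerConst_pos hμ
  set S := IsentropicNS.solverConst α γ μ
  have hS : 0 ≤ S :=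
    IsentropicNS.solverConst_nonneg (T := 1) ⟨hα, hαγ, hγ, one_pos, le_rfl⟩ hμ
  -- All radii are multiples of the data size M: kM and BM for the constructed solution, CM and B'M
  -- for the uniqueness class. The choice k = 2c leaves one half for the initial layer and one half
  -- for the Duhamel term.
  set k := 2 * c with hk
  set B := 1 + k / γ with hB
  set C := 6 * (B + k) with hC
  set B' := 1 + C / γ with hB'
  have hk0 : 0 < k := by positivity
  have hB0 : 0 < B := by positivity
  have hC0 : 0 < C := by positivity
  have hB'0 : 0 < B' := by positivity
  -- Q is a sum of three nonnegative terms, so one ε settles stability of the ball, contraction in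
  -- the larger ball, and the bound 1/2 on the density.
  obtain ⟨ε, hε, hε1, hQε⟩ := IsentropicNS.exists_small
    (Q := S * L * (5 * B * k + 2 * B) + S * L * (2 * B' + 6 * C + 4) + B') (d := min c (1 / 2))
    (by positivity) (by positivity)
  have hq1 : S * L * (5 * B * k + 2 * B) * ε ≤ c := by
    have : 0 ≤ (S * L * (2 * B' + 6 * C + 4) + B') * ε := by positivity
    linarith [min_le_left c (1 / 2)]
  have hq2 : S * L * (2 * B' + 6 * C + 4) * ε ≤ 1 / 2 := by
    have : 0 ≤ (S * L * (5 * B * k + 2 * B) + B') * ε := by positivity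
    linarith [min_le_right c (1 / 2)]
  have hq3 : B' * ε ≤ 1 / 2 := by
    have : 0 ≤ (S * L * (5 * B * k + 2 * B) + S * L * (2 * B' + 6 * C + 4)) * ε := by positivity
    linarith [min_le_right c (1 / 2)]
  obtain ⟨T, hT, hTε⟩ := IsentropicNS.exists_small_time hγ hε hε1
  have hp : IsentropicNS.Admissible α γ T := ⟨hα, hαγ, hγ, hT.1, hT.2.le⟩
  have hTγ : T ^ γ ≤ 1 := Real.rpow_le_one hT.1.le hT.2.le hγ0.le
  refine ⟨ε, ⟨hε, hε1⟩, T, hT, C, hC0, fun v₀ u₀ hv₀ hu₀ hdata => ?_⟩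
  -- The actual size of the data, not its upper bound ε, fixes the radii; this makes the estimate
  -- linear in the data while T and C stay fixed.
  set M := (IsentropicNS.dataSize γ v₀ u₀).toReal with hMdef
  have hM : 0 ≤ M := ENNReal.toReal_nonneg
  have hMε : M ≤ ε := ENNReal.toReal_le_of_le_ofReal hε.le hdata
  have hMd : IsentropicNS.dataSize γ v₀ u₀ = ENNReal.ofReal M :=
    (ENNReal.ofReal_toReal (ne_top_of_le_ne_top ENNReal.ofReal_ne_top hdata)).symm
  have hCM : ENNReal.ofReal C * IsentropicNS.dataSize γ v₀ u₀ = ENNReal.ofReal (C * M) := by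
    rw [hMd, ENNReal.ofReal_mul hC0.le]
  have hdens : ∀ {x}, 0 ≤ x → M + x * M / γ * T ^ γ ≤ (1 + x / γ) * M := fun {x} hx => by
    have : x * M / γ * T ^ γ ≤ x * M / γ := mul_le_of_le_one_right (by positivity) hTγ
    linarith [(by ring : (1 + x / γ) * M = M + x * M / γ)]
  rw [hCM]
  refine IsentropicNS.exists_unique_weakSolution (K := k * M) (b := B * M) (b' := B' * M) hp hμ
    hA.le (by linarith) hφ hψ hM (by positivity) (hdens hk0.le) ?_ (hdens hC0.le) ?_ ?_ ?_
    (le_of_eq (by rw [hC]; ring)) hv₀ hu₀ hMd.le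
  · rw [hTε]
    calc c * M + S * (L * (5 * (B * M) * (k * M) + 2 * (B * M) * ε))
        ≤ c * M + S * (L * (5 * (B * M) * (k * ε) + 2 * (B * M) * ε)) := by gcongr
      _ = c * M + S * L * (5 * B * k + 2 * B) * ε * M := by ring
      _ ≤ c * M + c * M := by gcongr
      _ = k * M := by rw [hk]; ring
  · exact (mul_le_mul_of_nonneg_left hMε hB'0.le).trans hq3
  · rw [hTε]
    calc S * (L * (2 * (B' * M) + 6 * (C * M) + 4 * ε))
        ≤ S * (L * (2 * (B' * ε) + 6 * (C * ε) + 4 * ε)) := by gcongr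
      _ = S * L * (2 * B' + 6 * C + 4) * ε := by ring
      _ ≤ 1 / 2 := hq2
  · have hkC : k ≤ C := by rw [hC]; linarith
    rw [hB, hB']
    gcongr
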